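/- **Setting.** Let $V$ be a complete locally convex real topological vector space, $(\xi_i)_{i\in I}$ a family of seminorms generating its topology, and let seminorms $\xi_{i_1}\otimes\cdots\otimes\xi_{i_k}$ on $V^{\otimes k}$ ($k\ge 0$, $i_1,\dots,i_k\in I$) be given that form a *symmetric system of cross seminorms*: for $k=1$ they are the $\xi_i$, for $k=0$ the absolute value on $V^{\otimes 0}=\mathbf R$, and $$(\xi_{i_1}\otimes\cdots\otimes\xi_{i_{m+n}})(a\otimes b)=(\xi_{i_1}\otimes\cdots\otimes\xi_{i_m})(a)\,(\xi_{i_{m+1}}\otimes\cdots\otimes\xi_{i_{m+n}})(b),$$ $$(\xi_{i_1}\otimes\cdots\otimes\xi_{i_k})(a)=(\xi_{i_{\sigma(1)}}\otimes\cdots\otimes\xi_{i_{\sigma(k)}})(\sigma(a)),\qquad \sigma(v_1\otimes\cdots\otimes v_k)=v_{\sigma(1)}\otimes\cdots\otimes v_{\sigma(k)},$$ for all tensors $a,b$ and all permutations $\sigma$. Let $V^{\hat\otimes k}$ be the completion of $V^{\otimes k}$ for these seminorms; for a group $G$ of permutations of the $k$ factors let $\mathrm{sym}_G=|G|^{-1}\sum_{\sigma\in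 G}\sigma$ on $V^{\hat\otimes k}$. Let $\mathfrak{Tr}$ be the set of isomorphism classes of finite non-planar rooted trees $\mathfrak t$ (finite posets with a least element, the root, in which every set $\{w: w<v\}$ is totally ordered). Let $\mathrm v(\mathfrak t)$ be the set of vertices other than the root, $|\mathfrak t|$ its cardinality (the degree), $\mathrm{SG}(\mathfrak t)$ the group of order automorphisms of $\mathrm v(\mathfrak t)$, and $\mathbf 1$ the tree consisting of the root only. Index the factors of $V^{\hat\otimes|\mathfrak t|}$ by $\mathrm v(\mathfrak t)$ and put $$V^{\hat\otimes\mathfrak t}=V^{\hat\otimes|\mathfrak t|}/\ker \mathrm{sym}_{\mathrm{SG}(\mathfrak t)},\qquad \widehat{\mathfrak{Tr}}(V)=\prod_{\mathfrak t}V^{\hat\otimes\mathfrak t},$$ $$\widehat{\mathfrak{Tr}}(V)\hat\otimes\widehat{\mathfrak{Tr}}(V)=\prod_{\mathfrak t,\mathfrak s}V^{\hat\otimes(|\mathfrak t|+|\mathfrak s|)}/\ker \mathrm{sym}_{\mathrm{SG}(\mathfrak t)\times\mathrm{SG}(\mathfrak s)}$$ with the product topologies (these are the closures of the direct sums in the product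 topology); higher completed tensor powers are defined in the same way. For a tree $\mathfrak t$ and a labelling $v:\mathrm v(\mathfrak t)\to V$ let $[\mathfrak t,v]\in V^{\hat\otimes\mathfrak t}\subset\widehat{\mathfrak{Tr}}(V)$ be the class of the elementary tensor $\bigotimes_{x\in \mathrm v(\mathfrak t)}v(x)$ (an *elementary labelled tree*). Labellings of trees made from vertices of other trees are the inherited ones. **Operations.** On elementary labelled trees $\mathbf t$, $\mathbf s$ with underlying trees $\mathfrak t$, $\mathfrak s$ define: * $\mathbf t\star\mathbf s=\sum_d[\mathbf t\stackrel d\rightharpoonup\mathbf s]$, the sum over all maps $d$ from the set of children of the root of $\mathfrak t$ to the set of all vertices of $\mathfrak s$ (root included), where $\mathbf t\stackrel d\rightharpoonup\mathbf s$ is the tree on $\mathrm v(\mathfrak t)\sqcup\mathfrak s$ in which each child $c$ of the root of $\mathfrak t$ is attached to $d(c)$; * $\mathbf t\circ\mathbf s$, the single term of this sum in which $d$ is constantly the root of $\mathfrak s$; * $\Delta_{\mathrm{GL}}(\mathbf t)=\sum_{J\subset\{1,\dots,k\}}\big(\bigcirc_{j\in J}\mathbf t_j\big)\otimes\big(\bigcirc_{j\notin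 J}\mathbf t_j\big)$, where $\mathbf t=\mathbf t_1\circ\cdots\circ\mathbf t_k$ is the decomposition of $\mathbf t$ into its branches at the $k$ children of the root, and $\bigcirc_{j\in\emptyset}\mathbf t_j=\mathbf 1$; * $\Delta_{\mathrm{CK}}(\mathbf t)=\sum_C \mathbf P^C(\mathbf t)\otimes\mathbf R^C(\mathbf t)$, the sum over all sets $C\subset\mathrm v(\mathfrak t)$ of pairwise incomparable vertices, where $\mathbf R^C(\mathbf t)$ is what remains after removing all vertices $\ge$ some $w\in C$, and $\mathbf P^C(\mathbf t)$ consists of the removed vertices together with a new root below them; * $\eta(\lambda)=\lambda\mathbf 1$ for $\lambda\in\mathbf R$; $\varepsilon(\mathbf 1)=1$, and $\varepsilon(\mathbf t)=0$ if $\mathfrak t\ne\mathbf 1$. **Proposition.** These formulas do not depend on the choices made and extend uniquely to continuous linear maps $\star,\circ:\widehat{\mathfrak{Tr}}(V)\hat\otimes\widehat{\mathfrak{Tr}}(V)\to\widehat{\mathfrak{Tr}}(V)$, $\Delta_{\mathrm{GL}},\Delta_{\mathrm{CK}}:\widehat{\mathfrak{Tr}}(V)\to\widehat{\mathfrak{Tr}}(V)\hat\otimes\widehat{\mathfrak{Tr}}(V)$,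 $\eta:\mathbf R\to\widehat{\mathfrak{Tr}}(V)$ and $\varepsilon:\widehat{\mathfrak{Tr}}(V)\to\mathbf R$. Each of the tuples $$\widehat{\mathcal H}_{\mathrm{GL}}(V)=(\widehat{\mathfrak{Tr}}(V),\star,\eta,\Delta_{\mathrm{GL}},\varepsilon),\qquad \widehat{\mathcal H}_{\mathrm{CK}}(V)=(\widehat{\mathfrak{Tr}}(V),\circ,\eta,\Delta_{\mathrm{CK}},\varepsilon)$$ is a topological graded bialgebra: the bialgebra axioms hold with completed tensor products (all tensor products of operations that occur in them extending continuously to the completed tensor powers), $\widehat{\mathfrak{Tr}}(V)$ is as a topological vector space the product of its homogeneous parts $\bigoplus_{|\mathfrak t|=n}V^{\hat\otimes\mathfrak t}$, $n\ge 0$, and all operations respect the degree. Moreover each of them is a topological Hopf algebra: there is a continuous linear map $s$ on $\widehat{\mathfrak{Tr}}(V)$, the antipode, such that $s\hat\otimes\mathrm{id}$ and $\mathrm{id}\hat\otimes s$ exist as continuous maps on the completed tensor square and, with $m$ the product and $\Delta$ the coproduct, $m\circ(s\hat\otimes\mathrm{id})\circ\Delta=\eta\circ\varepsilon=m\circ(\mathrm{id}\hat\otimes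 s)\circ\Delta$. -/

import Mathlib

open scoped TensorProduct Topology

noncomputable section

namespace TreeHopf

/-! ## Symmetric systems of cross seminorms on tensor powers -/

/-- The action of a permutation on tensors, `σ (v₁ ⊗ ⋯ ⊗ vₖ) = v_{σ 1} ⊗ ⋯ ⊗ v_{σ k}`,
here for tensors whose factors are indexed by an arbitrary type `ι`. -/
def permTensor {V : Type*} [AddCommGroup V] [Module ℝ V] {ι : Type*} (σ : Equiv.Perm ι) :
    (⨂[ℝ] _ : ι, V) ≃ₗ[ℝ] (⨂[ℝ] _ : ι, V) :=
  PiTensorProduct.reindex ℝ (fun _ => V) σ.symm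

/-- A family of seminorms `ξ i`, `i : I`, that generates the topology of `V`, together with a
symmetric system of cross seminorms `ξ (i 1) ⊗ ⋯ ⊗ ξ (i k)` (written `cross k i`) on the tensor
powers of `V`. On `V^{⊗0} = ℝ` the (empty) product of seminorms is the absolute value, on
`V^{⊗1} = V` it is the given seminorm. -/
structure SymmetricCrossSeminorms (V : Type*) [AddCommGroup V] [Module ℝ V] [TopologicalSpace V]
    (I : Type*) where
  ξ : I → Seminorm ℝ V
  generates : WithSeminorms ξ
  cross : ∀ k : ℕ, (Fin k → I) → Seminorm ℝ (⨂[ℝ]^k V)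
  cross_zero : ∀ (i : Fin 0 → I) (v : Fin 0 → V), cross 0 i (PiTensorProduct.tprod ℝ v) = 1
  cross_one : ∀ (i : Fin 1 → I) (v : Fin 1 → V),
    cross 1 i (PiTensorProduct.tprod ℝ v) = ξ (i 0) (v 0)
  cross_mul : ∀ (m n : ℕ) (i : Fin m → I) (j : Fin n → I) (a : ⨂[ℝ]^m V) (b : ⨂[ℝ]^n V),
    cross (m + n) (Fin.append i j) (TensorPower.mulEquiv (a ⊗ₜ[ℝ] b)) = cross m i a * cross n j b
  symm : ∀ (k : ℕ) (i : Fin k → I) (a : ⨂[ℝ]^k V) (σ : Equiv.Perm (Fin k)),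
    cross k i a = cross k (fun l => i (σ l)) (permTensor σ a)

section ExtendBilin

set_option linter.unusedSectionVars false

open UniformSpace Completion

variable {E F Z : Type*}
  [UniformSpace E] [AddCommGroup E] [IsUniformAddGroup E] [Module ℝ E]
  [UniformContinuousConstSMul ℝ E]
  [UniformSpace F] [AddCommGroup F] [IsUniformAddGroup F] [Module ℝ F]
  [UniformContinuousConstSMul ℝ F]
  [UniformSpace Z] [AddCommGroup Z] [IsUniformAddGroup Z] [Module ℝ Z]
  [UniformContinuousConstSMul ℝ Z]
  (B : E →ₗ[ℝ] F →ₗ[ℝ] Z)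

/-- The extension by continuity of a continuous bilinear map to the completions. -/
def extendBilinFun (x : Completion E) (y : Completion F) : Completion Z :=
  (isDenseInducing_coe.prodMap isDenseInducing_coe).extend
    (fun p : E × F => (B p.1 p.2 : Completion Z)) (x, y)

theorem continuous_extendBilinFun (hB : Continuous fun p : E × F => B p.1 p.2) :
    Continuous fun p : Completion E × Completion F => extendBilinFun B p.1 p.2 :=
  IsDenseInducing.extend_Z_bilin
    (e := (toCompl : E →+ Completion E)) (f := (toCompl : F →+ Completion F))
    (φ := (AddMonoidHom.compHom (toCompl : Z →+ Completion Z)).comp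
        (LinearMap.toAddMonoidHom'.comp B.toAddMonoidHom))
    isDenseInducing_coe isDenseInducing_coe ((continuous_coe _).comp hB)

theorem extendBilinFun_coe (hB : Continuous fun p : E × F => B p.1 p.2)
    (a : E) (b : F) :
    extendBilinFun B (a : Completion E) (b : Completion F) = (B a b : Completion Z) :=
  (isDenseInducing_coe.prodMap isDenseInducing_coe).extend_eq ((continuous_coe _).comp hB) (a, b)

theorem extendBilinFun_add_left (hB : Continuous fun p : E × F => B p.1 p.2)
    (x x' : Completion E) (y : Completion F) :
    extendBilinFun B (x + x') y = extendBilinFun B x y + extendBilinFun B x' y := by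
  have hc := continuous_extendBilinFun B hB
  induction x, x', y using induction_on₃ with
  | hp =>
    have h1 : Continuous fun p : Completion E × Completion E × Completion F =>
        extendBilinFun B (p.1 + p.2.1) p.2.2 :=
      hc.comp ((continuous_fst.add continuous_snd.fst).prodMk continuous_snd.snd)
    have h2 : Continuous fun p : Completion E × Completion E × Completion F =>
        extendBilinFun B p.1 p.2.2 := hc.comp (continuous_fst.prodMk continuous_snd.snd)
    have h3 : Continuous fun p : Completion E × Completion E × Completion F =>
        extendBilinFun B p.2.1 p.2.2 := hc.comp (continuous_snd.fst.prodMk continuous_snd.snd)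
    exact isClosed_eq h1 (h2.add h3)
  | ih x x' y =>
    rw [← coe_add, extendBilinFun_coe B hB, extendBilinFun_coe B hB, extendBilinFun_coe B hB,
      map_add, LinearMap.add_apply, coe_add]

theorem extendBilinFun_add_right (hB : Continuous fun p : E × F => B p.1 p.2)
    (x : Completion E) (y y' : Completion F) :
    extendBilinFun B x (y + y') = extendBilinFun B x y + extendBilinFun B x y' := by
  have hc := continuous_extendBilinFun B hB
  induction x, y, y' using induction_on₃ with
  | hp =>
    have h1 : Continuous fun p : Completion E × Completion F × Completion F =>
        extendBilinFun B p.1 (p.2.1 + p.2.2) :=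
      hc.comp (continuous_fst.prodMk (continuous_snd.fst.add continuous_snd.snd))
    have h2 : Continuous fun p : Completion E × Completion F × Completion F =>
        extendBilinFun B p.1 p.2.1 := hc.comp (continuous_fst.prodMk continuous_snd.fst)
    have h3 : Continuous fun p : Completion E × Completion F × Completion F =>
        extendBilinFun B p.1 p.2.2 := hc.comp (continuous_fst.prodMk continuous_snd.snd)
    exact isClosed_eq h1 (h2.add h3)
  | ih x y y' =>
    rw [← coe_add, extendBilinFun_coe B hB, extendBilinFun_coe B hB, extendBilinFun_coe B hB,
      map_add, coe_add]

theorem extendBilinFun_smul_left (hB : Continuous fun p : E × F => B p.1 p.2)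
    (c : ℝ) (x : Completion E) (y : Completion F) :
    extendBilinFun B (c • x) y = c • extendBilinFun B x y := by
  have hc := continuous_extendBilinFun B hB
  induction x, y using induction_on₂ with
  | hp =>
    have h1 : Continuous fun p : Completion E × Completion F => extendBilinFun B (c • p.1) p.2 :=
      hc.comp ((continuous_fst.const_smul c).prodMk continuous_snd)
    have h2 : Continuous fun p : Completion E × Completion F => c • extendBilinFun B p.1 p.2 :=
      (continuous_const_smul c).comp hc
    exact isClosed_eq h1 h2
  | ih x y =>
    rw [← coe_smul, extendBilinFun_coe B hB, extendBilinFun_coe B hB, map_smul,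
      LinearMap.smul_apply, coe_smul]

theorem extendBilinFun_smul_right (hB : Continuous fun p : E × F => B p.1 p.2)
    (c : ℝ) (x : Completion E) (y : Completion F) :
    extendBilinFun B x (c • y) = c • extendBilinFun B x y := by
  have hc := continuous_extendBilinFun B hB
  induction x, y using induction_on₂ with
  | hp =>
    have h1 : Continuous fun p : Completion E × Completion F => extendBilinFun B p.1 (c • p.2) :=
      hc.comp (continuous_fst.prodMk (continuous_snd.const_smul c))
    have h2 : Continuous fun p : Completion E × Completion F => c • extendBilinFun B p.1 p.2 :=
      (continuous_const_smul c).comp hc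
    exact isClosed_eq h1 h2
  | ih x y =>
    rw [← coe_smul, extendBilinFun_coe B hB, extendBilinFun_coe B hB, map_smul, coe_smul]

/-- The extension by continuity of a continuous bilinear map, as a bilinear map. -/
def extendBilin (hB : Continuous fun p : E × F => B p.1 p.2) :
    Completion E →ₗ[ℝ] Completion F →ₗ[ℝ] Completion Z :=
  LinearMap.mk₂ ℝ (extendBilinFun B) (extendBilinFun_add_left B hB) (extendBilinFun_smul_left B hB)
    (extendBilinFun_add_right B hB) (extendBilinFun_smul_right B hB)

theorem continuous_extendBilin (hB : Continuous fun p : E × F => B p.1 p.2) :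
    Continuous fun p : Completion E × Completion F => extendBilin B hB p.1 p.2 :=
  continuous_extendBilinFun B hB

theorem extendBilin_coe (hB : Continuous fun p : E × F => B p.1 p.2) (a : E) (b : F) :
    extendBilin B hB (a : Completion E) (b : Completion F) = (B a b : Completion Z) :=
  extendBilinFun_coe B hB a b

end ExtendBilin

section TensorPowers

theorem reindex_reindex' {V : Type*} [AddCommGroup V] [Module ℝ V] {ι κ l : Type*} (e : ι ≃ κ)
    (f : κ ≃ l) (a : ⨂[ℝ] _ : ι, V) :
    PiTensorProduct.reindex ℝ (fun _ => V) f (PiTensorProduct.reindex ℝ (fun _ => V) e a) =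
      PiTensorProduct.reindex ℝ (fun _ => V) (e.trans f) a :=
  PiTensorProduct.reindex_reindex (s := fun _ => V) e f a

variable {V : Type*} [AddCommGroup V] [Module ℝ V] [TopologicalSpace V] {I : Type*}

/-- The seminorm `⨂_{x ∈ ι} ξ (i x)` on the tensor power of `V` with factors indexed by a finite
set `ι`; by symmetry of the system it does not depend on the enumeration of `ι` used here. -/
def SymmetricCrossSeminorms.seminorm (S : SymmetricCrossSeminorms V I) (ι : Type*) [Finite ι] :
    SeminormFamily ℝ (⨂[ℝ] _ : ι, V) (ι → I) := fun i =>
  (S.cross (Nat.card ι) (i ∘ (Finite.equivFin ι).symm)).comp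
    (PiTensorProduct.reindex ℝ (fun _ => V) (Finite.equivFin ι)).toLinearMap

theorem SymmetricCrossSeminorms.cross_reindex (S : SymmetricCrossSeminorms V I) {ι : Type*}
    {m n : ℕ} (e : ι ≃ Fin m) (f : ι ≃ Fin n) (i : ι → I) (a : ⨂[ℝ] _ : ι, V) :
    S.cross m (i ∘ e.symm) (PiTensorProduct.reindex ℝ (fun _ => V) e a) =
      S.cross n (i ∘ f.symm) (PiTensorProduct.reindex ℝ (fun _ => V) f a) := by
  obtain rfl : m = n := by simpa using Fintype.card_congr (e.symm.trans f)
  rw [S.symm m (i ∘ e.symm) _ (f.symm.trans e), permTensor, reindex_reindex']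
  congr 2
  · funext l; simp
  · congr 1; ext x; simp

theorem SymmetricCrossSeminorms.seminorm_eq (S : SymmetricCrossSeminorms V I) {ι : Type*}
    [Finite ι] {n : ℕ} (f : ι ≃ Fin n) (i : ι → I) (a : ⨂[ℝ] _ : ι, V) :
    S.seminorm ι i a =
      S.cross n (i ∘ f.symm) (PiTensorProduct.reindex ℝ (fun _ => V) f a) :=
  S.cross_reindex _ f i a

theorem SymmetricCrossSeminorms.seminorm_perm (S : SymmetricCrossSeminorms V I) {ι : Type*}
    [Finite ι] (σ : Equiv.Perm ι) (i : ι → I) (a : ⨂[ℝ] _ : ι, V) :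
    S.seminorm ι i (permTensor σ a) = S.seminorm ι (i ∘ σ.symm) a := by
  rw [S.seminorm_eq (σ.trans (Finite.equivFin ι)) i, S.seminorm_eq (Finite.equivFin ι), permTensor,
    reindex_reindex']
  congr 2
  congr 1; ext x; simp

theorem SymmetricCrossSeminorms.seminorm_tmul (S : SymmetricCrossSeminorms V I) {ι κ : Type*}
    [Finite ι] [Finite κ] (i : ι ⊕ κ → I) (a : ⨂[ℝ] _ : ι, V) (b : ⨂[ℝ] _ : κ, V) :
    S.seminorm (ι ⊕ κ) i (PiTensorProduct.tmulEquiv ℝ V (a ⊗ₜ[ℝ] b)) =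
      S.seminorm ι (i ∘ Sum.inl) a * S.seminorm κ (i ∘ Sum.inr) b := by
  rw [S.seminorm_eq (((Finite.equivFin ι).sumCongr (Finite.equivFin κ)).trans finSumFinEquiv),
    S.seminorm_eq (Finite.equivFin ι), S.seminorm_eq (Finite.equivFin κ), ← S.cross_mul]
  congr 2
  · funext l
    refine Fin.addCases (fun l => ?_) (fun l => ?_) l <;> simp
  · induction a using PiTensorProduct.induction_on with
    | add a a' h h' => simp only [TensorProduct.add_tmul, map_add, h, h']
    | smul_tprod r v =>
      induction b using PiTensorProduct.induction_on with
      | add b b' h h' => simp only [TensorProduct.tmul_add, map_add, h, h']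
      | smul_tprod s w =>
        simp only [TensorPower.mulEquiv, LinearEquiv.trans_apply, map_smul,
          PiTensorProduct.reindex_tprod, ← TensorProduct.smul_tmul', TensorProduct.tmul_smul,
          PiTensorProduct.tmulEquiv_apply]
        congr 3
        funext l
        refine Fin.addCases (fun l => ?_) (fun l => ?_) l <;> simp

/-- The tensor power of `V` with factors indexed by `ι`, as a type carrying the locally convex
topology given by the cross seminorms of `S`. -/
def TPow (_S : SymmetricCrossSeminorms V I) (ι : Type*) : Type _ := ⨂[ℝ] _ : ι, V

variable (S : SymmetricCrossSeminorms V I) (ι : Type*) {κ : Type*}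

instance : AddCommGroup (TPow S ι) := inferInstanceAs (AddCommGroup (⨂[ℝ] _ : ι, V))
instance : Module ℝ (TPow S ι) := inferInstanceAs (Module ℝ (⨂[ℝ] _ : ι, V))

/-- The cross seminorms as seminorms on `TPow S ι`. -/
def TPow.family [Finite ι] : SeminormFamily ℝ (TPow S ι) (ι → I) := S.seminorm ι

instance [Finite ι] : UniformSpace (TPow S ι) :=
  letI := (TPow.family S ι).moduleFilterBasis.topology
  letI : IsTopologicalAddGroup (TPow S ι) :=
    (TPow.family S ι).addGroupFilterBasis.isTopologicalAddGroup
  IsTopologicalAddGroup.rightUniformSpace (TPow S ι)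

theorem TPow.withSeminorms [Finite ι] : WithSeminorms (TPow.family S ι) := ⟨rfl⟩

instance [Finite ι] : IsUniformAddGroup (TPow S ι) :=
  letI := (TPow.family S ι).moduleFilterBasis.topology
  letI : IsTopologicalAddGroup (TPow S ι) :=
    (TPow.family S ι).addGroupFilterBasis.isTopologicalAddGroup
  isUniformAddGroup_of_addCommGroup

instance [Finite ι] : ContinuousSMul ℝ (TPow S ι) := (TPow.withSeminorms S ι).continuousSMul

instance [Finite ι] : UniformContinuousConstSMul ℝ (TPow S ι) :=
  uniformContinuousConstSMul_of_continuousConstSMul ℝ (TPow S ι)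

/-- The completion `V^{⊗̂ ι}` of the tensor power of `V` with factors indexed by `ι`. -/
abbrev CPow [Finite ι] : Type _ := UniformSpace.Completion (TPow S ι)

variable {ι}

/-- The elementary tensor `⨂_{x ∈ ι} v x`. -/
def TPow.pure (v : ι → V) : TPow S ι := PiTensorProduct.tprod ℝ v

/-- Permutation of the factors, on the uncompleted tensor power. -/
def TPow.perm [Finite ι] (σ : Equiv.Perm ι) : TPow S ι →L[ℝ] TPow S ι where
  toLinearMap := (permTensor σ).toLinearMap
  cont := by
    refine (TPow.withSeminorms S ι).continuous_of_isBounded (TPow.withSeminorms S ι) _ ?_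
    intro i
    refine ⟨{i ∘ σ.symm}, 1, fun a => ?_⟩
    simp only [Finset.sup_singleton, one_smul]
    exact (S.seminorm_perm σ i a).le

/-- Permutation of the factors, on the completed tensor power. -/
def CPow.perm [Finite ι] (σ : Equiv.Perm ι) : CPow S ι →L[ℝ] CPow S ι :=
  (TPow.perm S σ).completion

/-- The projection `sym_G a = |G|⁻¹ ∑_{σ ∈ G} σ a` on the completed tensor power. -/
def CPow.sym [Finite ι] (G : Subgroup (Equiv.Perm ι)) : CPow S ι →L[ℝ] CPow S ι :=
  (Nat.card G : ℝ)⁻¹ • ∑ᶠ σ : G, CPow.perm S (σ : Equiv.Perm ι)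

/-- The quotient `V^{⊗̂ ι} / ker sym_G`, with the quotient topology. -/
abbrev SymPow [Finite ι] (G : Subgroup (Equiv.Perm ι)) : Type _ :=
  CPow S ι ⧸ (CPow.sym S G).ker

instance [Finite ι] (G : Subgroup (Equiv.Perm ι)) : ContinuousConstSMul ℝ (SymPow S G) where
  continuous_const_smul c :=
    (CPow.sym S G).ker.isQuotientMap_mkQ.continuous_iff.2
      ((CPow.sym S G).ker.continuous_mkQ.comp (continuous_const_smul c))

/-- The class of the elementary tensor `⨂_{x ∈ ι} v x` in `V^{⊗̂ ι} / ker sym_G`. -/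
def SymPow.pure [Finite ι] (G : Subgroup (Equiv.Perm ι)) (v : ι → V) : SymPow S G :=
  Submodule.Quotient.mk (TPow.pure S v : CPow S ι)

/-! ### Tensor multiplication -/

/-- The tensor multiplication `V^{⊗ ι} × V^{⊗ κ} → V^{⊗ (ι ⊔ κ)}`. -/
def TPow.tmul : TPow S ι →ₗ[ℝ] TPow S κ →ₗ[ℝ] TPow S (ι ⊕ κ) :=
  (TensorProduct.mk ℝ (⨂[ℝ] _ : ι, V) (⨂[ℝ] _ : κ, V)).compr₂
    (PiTensorProduct.tmulEquiv ℝ V).toLinearMap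

theorem TPow.family_tmul [Finite ι] [Finite κ] (i : ι ⊕ κ → I) (a : TPow S ι) (b : TPow S κ) :
    TPow.family S (ι ⊕ κ) i (TPow.tmul S a b) =
      TPow.family S ι (i ∘ Sum.inl) a * TPow.family S κ (i ∘ Sum.inr) b :=
  S.seminorm_tmul i a b

theorem TPow.continuous_tmul [Finite ι] [Finite κ] :
    Continuous fun p : TPow S ι × TPow S κ => TPow.tmul S p.1 p.2 := by
  rw [continuous_iff_continuousAt]
  rintro ⟨a₀, b₀⟩
  refine ((TPow.withSeminorms S (ι ⊕ κ)).tendsto_nhds _ _).2 fun i ε hε => ?_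
  set p := TPow.family S ι (i ∘ Sum.inl)
  set q := TPow.family S κ (i ∘ Sum.inr)
  have hp : Continuous p := (TPow.withSeminorms S ι).continuous_seminorm _
  have hq : Continuous q := (TPow.withSeminorms S κ).continuous_seminorm _
  have hc : Continuous fun x : TPow S ι × TPow S κ =>
      p (x.1 - a₀) * q x.2 + p a₀ * q (x.2 - b₀) := by fun_prop
  have h0 : (fun x : TPow S ι × TPow S κ =>
      p (x.1 - a₀) * q x.2 + p a₀ * q (x.2 - b₀)) (a₀, b₀) < ε := by simpa using hε
  filter_upwards [hc.continuousAt.eventually_lt continuousAt_const h0] with x hx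
  refine lt_of_le_of_lt ?_ hx
  have : TPow.tmul S x.1 x.2 - TPow.tmul S a₀ b₀ =
      TPow.tmul S (x.1 - a₀) x.2 + TPow.tmul S a₀ (x.2 - b₀) := by
    simp [map_sub]
  rw [this, ← TPow.family_tmul, ← TPow.family_tmul]
  exact map_add_le_add _ _ _

section CompletedTensor

variable [Finite ι] [Finite κ]

/-- The tensor multiplication `V^{⊗̂ ι} × V^{⊗̂ κ} → V^{⊗̂ (ι ⊔ κ)}`. -/
def CPow.tmul : CPow S ι →ₗ[ℝ] CPow S κ →ₗ[ℝ] CPow S (ι ⊕ κ) :=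
  extendBilin (TPow.tmul S) (TPow.continuous_tmul S)

theorem CPow.continuous_tmul :
    Continuous fun p : CPow S ι × CPow S κ => CPow.tmul S p.1 p.2 :=
  continuous_extendBilin _ _

theorem CPow.tmul_coe (a : TPow S ι) (b : TPow S κ) :
    CPow.tmul S (a : CPow S ι) (b : CPow S κ) = (TPow.tmul S a b : CPow S (ι ⊕ κ)) :=
  extendBilin_coe _ _ a b

theorem CPow.perm_coe (σ : Equiv.Perm ι) (a : TPow S ι) :
    CPow.perm S σ (a : CPow S ι) = (TPow.perm S σ a : CPow S ι) :=
  ContinuousLinearMap.completion_apply_coe _ _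

theorem tmulEquiv_permTensor {V : Type*} [AddCommGroup V] [Module ℝ V] {ι κ : Type*}
    (σ : Equiv.Perm ι) (τ : Equiv.Perm κ) (a : ⨂[ℝ] _ : ι, V) (b : ⨂[ℝ] _ : κ, V) :
    PiTensorProduct.tmulEquiv ℝ V (permTensor σ a ⊗ₜ[ℝ] permTensor τ b) =
      permTensor (Equiv.sumCongr σ τ) (PiTensorProduct.tmulEquiv ℝ V (a ⊗ₜ[ℝ] b)) := by
  induction a using PiTensorProduct.induction_on with
  | add a a' h h' =>
    rw [map_add, TensorProduct.add_tmul, TensorProduct.add_tmul, map_add, map_add, map_add, h, h']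
  | smul_tprod r v =>
    induction b using PiTensorProduct.induction_on with
    | add b b' h h' =>
      rw [map_add, TensorProduct.tmul_add, TensorProduct.tmul_add, map_add, map_add, map_add, h, h']
    | smul_tprod s w =>
      simp only [permTensor, map_smul, PiTensorProduct.reindex_tprod,
        ← TensorProduct.smul_tmul', TensorProduct.tmul_smul, PiTensorProduct.tmulEquiv_apply]
      congr 3
      funext l
      rcases l with l | l <;> simp

theorem TPow.tmul_perm (σ : Equiv.Perm ι) (τ : Equiv.Perm κ) (a : TPow S ι) (b : TPow S κ) :
    TPow.tmul S (TPow.perm S σ a) (TPow.perm S τ b) =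
      TPow.perm S (Equiv.sumCongr σ τ) (TPow.tmul S a b) :=
  tmulEquiv_permTensor σ τ a b

theorem CPow.tmul_perm (σ : Equiv.Perm ι) (τ : Equiv.Perm κ) (x : CPow S ι) (y : CPow S κ) :
    CPow.tmul S (CPow.perm S σ x) (CPow.perm S τ y) =
      CPow.perm S (Equiv.sumCongr σ τ) (CPow.tmul S x y) := by
  have hc := CPow.continuous_tmul S (ι := ι) (κ := κ)
  induction x, y using UniformSpace.Completion.induction_on₂ with
  | hp =>
    exact isClosed_eq (hc.comp (f := fun p : CPow S ι × CPow S κ =>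
      (CPow.perm S σ p.1, CPow.perm S τ p.2)) (by fun_prop))
      ((CPow.perm S (Equiv.sumCongr σ τ)).continuous.comp hc)
  | ih a b => simp only [CPow.perm_coe, CPow.tmul_coe, TPow.tmul_perm]

/-- The product `G × K` of permutation groups of `ι` and `κ`, acting on the disjoint union. -/
def prodPerm (G : Subgroup (Equiv.Perm ι)) (K : Subgroup (Equiv.Perm κ)) :
    Subgroup (Equiv.Perm (ι ⊕ κ)) :=
  (G.prod K).map (Equiv.Perm.sumCongrHom ι κ)

theorem CPow.sym_apply [Fintype ι] (G : Subgroup (Equiv.Perm ι)) [Fintype G] (x : CPow S ι) :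
    CPow.sym S G x = (Nat.card G : ℝ)⁻¹ • ∑ σ : G, CPow.perm S (σ : Equiv.Perm ι) x := by
  simp [CPow.sym, finsum_eq_sum_of_fintype]

theorem CPow.sym_tmul (G : Subgroup (Equiv.Perm ι)) (K : Subgroup (Equiv.Perm κ))
    (x : CPow S ι) (y : CPow S κ) :
    CPow.sym S (prodPerm G K) (CPow.tmul S x y) = CPow.tmul S (CPow.sym S G x) (CPow.sym S K y) := by
  have := Fintype.ofFinite ι
  have := Fintype.ofFinite κ
  have := Fintype.ofFinite G
  have := Fintype.ofFinite K
  have := Fintype.ofFinite (prodPerm G K)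
  let e : G × K ≃ prodPerm G K := (Subgroup.prodEquiv G K).symm.toEquiv.trans
    ((G.prod K).equivMapOfInjective _ Equiv.Perm.sumCongrHom_injective).toEquiv
  rw [CPow.sym_apply, CPow.sym_apply, CPow.sym_apply, ← Nat.card_congr e, Nat.card_prod,
    ← e.sum_comp, Fintype.sum_prod_type]
  simp only [map_smul, LinearMap.smul_apply, map_sum, LinearMap.sum_apply, CPow.tmul_perm,
    Nat.cast_mul, mul_inv]
  rw [mul_comm, Finset.sum_comm, mul_smul]
  simp only [← Finset.smul_sum]
  rfl

/-- The tensor multiplication on the quotients,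
`V^{⊗̂ ι} / ker sym_G × V^{⊗̂ κ} / ker sym_K → V^{⊗̂ (ι ⊔ κ)} / ker sym_{G × K}`. -/
def SymPow.tmul (G : Subgroup (Equiv.Perm ι)) (K : Subgroup (Equiv.Perm κ)) :
    SymPow S G →ₗ[ℝ] SymPow S K →ₗ[ℝ] SymPow S (prodPerm G K) :=
  ((CPow.sym S K).ker.liftQ ((CPow.sym S G).ker.liftQ
    ((CPow.tmul S).compr₂ (CPow.sym S (prodPerm G K)).ker.mkQ) (fun x hx => by
      have hx : CPow.sym S G x = 0 := hx
      refine LinearMap.ext fun y => (Submodule.Quotient.mk_eq_zero _).2 ?_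
      change CPow.sym S (prodPerm G K) (CPow.tmul S x y) = 0
      rw [CPow.sym_tmul, hx, map_zero, LinearMap.zero_apply])).flip (fun y hy => by
      have hy : CPow.sym S K y = 0 := hy
      refine LinearMap.ext fun x => ?_
      obtain ⟨x, rfl⟩ := Submodule.Quotient.mk_surjective _ x
      refine (Submodule.Quotient.mk_eq_zero _).2 ?_
      change CPow.sym S (prodPerm G K) (CPow.tmul S x y) = 0
      rw [CPow.sym_tmul, hy, map_zero])).flip

theorem SymPow.tmul_mk (G : Subgroup (Equiv.Perm ι)) (K : Subgroup (Equiv.Perm κ))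
    (x : CPow S ι) (y : CPow S κ) :
    SymPow.tmul S G K (Submodule.Quotient.mk x) (Submodule.Quotient.mk y) =
      Submodule.Quotient.mk (CPow.tmul S x y) := rfl

end CompletedTensor

end TensorPowers

/-! ## Non-planar rooted trees

A rooted tree `T` is encoded by the poset `v(T)` of its vertices other than the root; the tree
itself is `WithBot v(T)`, the root being `⊥`. -/

/-- A poset in which, for every `v`, the set of all `w < v` is totally ordered; for a finite `ι`
this says precisely that `WithBot ι` is a rooted tree. -/
class IsForest (ι : Type*) [PartialOrder ι] : Prop where
  chain : ∀ v : ι, IsChain (· ≤ ·) {w | w < v}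

/-- The rooted trees whose non-root vertices are `0, …, deg - 1`. Every finite rooted tree is
isomorphic to one of these, and the identity is the enumeration of its vertices. -/
structure TreeRep where
  deg : ℕ
  order : PartialOrder (Fin deg)
  forest : @IsForest (Fin deg) order

/-- The vertices other than the root. -/
def TreeRep.Vertex (T : TreeRep) : Type := Fin T.deg

instance (T : TreeRep) : PartialOrder T.Vertex := T.order
instance (T : TreeRep) : IsForest T.Vertex := T.forest
instance (T : TreeRep) : Finite T.Vertex := inferInstanceAs (Finite (Fin T.deg))

instance TreeRep.setoid : Setoid TreeRep where
  r T U := Nonempty (T.Vertex ≃o U.Vertex)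
  iseqv := ⟨fun _ => ⟨OrderIso.refl _⟩, fun ⟨e⟩ => ⟨e.symm⟩, fun ⟨e⟩ ⟨f⟩ => ⟨e.trans f⟩⟩

/-- A non-planar rooted tree: an isomorphism class of finite rooted trees. -/
def RTree : Type := Quotient TreeRep.setoid

/-- The vertices other than the root of the chosen representative of a tree. -/
def RTree.Vertex (t : RTree) : Type := (Quotient.out t).Vertex

instance (t : RTree) : PartialOrder t.Vertex := inferInstanceAs (PartialOrder (Quotient.out t).Vertex)
instance (t : RTree) : IsForest t.Vertex := inferInstanceAs (IsForest (Quotient.out t).Vertex)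
instance (t : RTree) : Finite t.Vertex := inferInstanceAs (Finite (Quotient.out t).Vertex)

/-- The symmetry group of a tree: all order automorphisms of the set of non-root vertices. -/
def RTree.SG (t : RTree) : Subgroup (Equiv.Perm t.Vertex) where
  carrier := {σ | ∀ a b, σ a ≤ σ b ↔ a ≤ b}
  mul_mem' := fun hσ hτ a b => (hσ _ _).trans (hτ a b)
  one_mem' := fun _ _ => Iff.rfl
  inv_mem' := fun {σ} hσ a b => by simpa using (hσ (σ⁻¹ a) (σ⁻¹ b)).symm

theorem RTree.exists_iso (ι : Type*) [Finite ι] [PartialOrder ι] [IsForest ι] :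
    ∃ t : RTree, Nonempty (ι ≃o t.Vertex) := by
  let e := Finite.equivFin ι
  let o : PartialOrder (Fin (Nat.card ι)) := PartialOrder.lift e.symm e.symm.injective
  have hf : @IsForest (Fin (Nat.card ι)) o :=
    @IsForest.mk _ o fun v a ha b hb hab => IsForest.chain (e.symm v) ha hb (fun h => hab (e.symm.injective h))
  let T : TreeRep := ⟨Nat.card ι, o, hf⟩
  let f : ι ≃o T.Vertex :=
    { toEquiv := e
      map_rel_iff' := fun {a b} => by
        change e.symm (e a) ≤ e.symm (e b) ↔ a ≤ b
        simp }
  obtain ⟨g⟩ : Nonempty ((Quotient.out (Quotient.mk TreeRep.setoid T)).Vertex ≃o T.Vertex) :=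
    Quotient.mk_out (s := TreeRep.setoid) T
  let t : RTree := Quotient.mk TreeRep.setoid T
  let g' : t.Vertex ≃o T.Vertex := g
  exact ⟨t, ⟨f.trans g'.symm⟩⟩

/-- The isomorphism class of the tree `WithBot ι`. -/
def treeOf (ι : Type*) [Finite ι] [PartialOrder ι] [IsForest ι] : RTree :=
  (RTree.exists_iso ι).choose

/-- An isomorphism of `WithBot ι` with the chosen representative of its class. -/
def treeIso (ι : Type*) [Finite ι] [PartialOrder ι] [IsForest ι] : ι ≃o (treeOf ι).Vertex :=
  (RTree.exists_iso ι).choose_spec.some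

instance {ι : Type*} [PartialOrder ι] [IsForest ι] (p : ι → Prop) : IsForest {v // p v} :=
  ⟨fun v _ ha _ hb hab => IsForest.chain (v : ι) ha hb (fun h => hab (Subtype.ext h))⟩

instance {J : Type*} {ι : J → Type*} [∀ j, PartialOrder (ι j)] [∀ j, IsForest (ι j)] :
    IsForest (Σ j, ι j) :=
  ⟨fun v a ha b hb hab => by
    obtain ⟨j, v⟩ := v
    cases ha with
    | fiber _ a _ ha =>
      cases hb with
      | fiber _ b _ hb =>
        simp only [Sigma.mk_le_mk_iff]
        exact IsForest.chain v ha hb (fun h => hab (h ▸ rfl))⟩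

instance : IsForest PEmpty := ⟨fun v => v.elim⟩

/-- The children of the root of the tree `WithBot ι`: the minimal elements of `ι`. -/
abbrev RootChild (ι : Type*) [PartialOrder ι] : Type _ := {v : ι // IsMin v}

/-- The branch at the child `c` of the root: the (planted) tree formed by the root and by all
vertices above `c`. The tree `WithBot ι` is the `∘`-product of its branches. -/
abbrev Branch {ι : Type*} [PartialOrder ι] (c : RootChild ι) : Type _ := {v : ι // c.1 ≤ v}

/-- The non-root vertices of the tree obtained by grafting the tree `WithBot ι` to the tree
`WithBot κ` along a grafting map `d` from the children of the root of the first to the vertices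
(root included) of the second. -/
def Graft {ι κ : Type*} [PartialOrder ι] (_d : RootChild ι → WithBot κ) : Type _ := ι ⊕ κ

section Graft

variable {ι κ : Type*} [PartialOrder ι] [PartialOrder κ] (d : RootChild ι → WithBot κ)

instance [Finite ι] [Finite κ] : Finite (Graft d) := inferInstanceAs (Finite (ι ⊕ κ))

/-- The order of the grafted tree is generated by the orders of the two trees and by `d c < c` for
every child `c` of the root of the first tree. -/
def Graft.le : ι ⊕ κ → ι ⊕ κ → Prop
  | .inl a, .inl b => a ≤ b
  | .inr x, .inr y => x ≤ y
  | .inr x, .inl b => ∃ c : RootChild ι, c.1 ≤ b ∧ (x : WithBot κ) ≤ d c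
  | .inl _, .inr _ => False

instance : PartialOrder (Graft d) where
  le := Graft.le d
  le_refl := by rintro (a | x) <;> simp [Graft.le]
  le_trans := by
    rintro (a | x) (b | y) (c | z) h h' <;> simp only [Graft.le] at h h' ⊢
    · exact h.trans h'
    · obtain ⟨r, hr, hx⟩ := h
      exact ⟨r, hr.trans h', hx⟩
    · obtain ⟨r, hr, hy⟩ := h'
      exact ⟨r, hr, (WithBot.coe_le_coe.2 h).trans hy⟩
    · exact h.trans h'
  le_antisymm := by
    rintro (a | x) (b | y) h h' <;> simp only [Graft.le] at h h'
    · exact congrArg Sum.inl (le_antisymm h h')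
    · exact congrArg Sum.inr (le_antisymm h h')

theorem IsForest.comparable {ι : Type*} [PartialOrder ι] [IsForest ι] {a b v : ι}
    (ha : a ≤ v) (hb : b ≤ v) : a ≤ b ∨ b ≤ a := by
  rcases ha.eq_or_lt with rfl | ha
  · exact Or.inr hb
  rcases hb.eq_or_lt with rfl | hb
  · exact Or.inl ha.le
  exact (IsForest.chain v).total ha hb

instance [IsForest ι] [IsForest κ] : IsForest (Graft d) where
  chain := by
    have key : ∀ v a b : ι ⊕ κ, Graft.le d a v → Graft.le d b v →
        Graft.le d a b ∨ Graft.le d b a := by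
      rintro (v | v) (a | a) (b | b) ha hb <;> simp only [Graft.le] at ha hb ⊢
      · exact IsForest.comparable ha hb
      · obtain ⟨r, hr, hx⟩ := hb
        refine Or.inr ⟨r, ?_, hx⟩
        rcases IsForest.comparable ha hr with h | h
        · exact r.2 h
        · exact h
      · obtain ⟨r, hr, hx⟩ := ha
        refine Or.inl ⟨r, ?_, hx⟩
        rcases IsForest.comparable hb hr with h | h
        · exact r.2 h
        · exact h
      · obtain ⟨r, hr, hx⟩ := ha
        obtain ⟨r', hr', hx'⟩ := hb
        have hrr : r = r' := by
          rcases IsForest.comparable hr hr' with h | h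
          · exact Subtype.ext (le_antisymm h (r'.2 h))
          · exact Subtype.ext (le_antisymm (r.2 h) h)
        subst hrr
        cases hd : d r with
        | bot => rw [hd] at hx; simp at hx
        | coe y =>
          rw [hd, WithBot.coe_le_coe] at hx hx'
          exact IsForest.comparable hx hx'
      · exact IsForest.comparable ha hb
    intro v a ha b hb _
    have ha' : a ≤ v := le_of_lt ha
    have hb' : b ≤ v := le_of_lt hb
    exact key v a b ha' hb'

end Graft

/-- The non-root vertices of the tree `P^C` cut off by `C`, with the induced order. -/
abbrev CutOff {ι : Type*} [PartialOrder ι] (C : Set ι) : Type _ := {v : ι // ∃ w ∈ C, w ≤ v}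

/-- The non-root vertices of the tree `R^C` that remains after cutting `C`. -/
abbrev Remain {ι : Type*} [PartialOrder ι] (C : Set ι) : Type _ := {v : ι // ¬ ∃ w ∈ C, w ≤ v}

/-- The admissible cuts: sets of pairwise incomparable non-root vertices. -/
abbrev AdmissibleCut (ι : Type*) [PartialOrder ι] : Type _ := {C : Set ι // IsAntichain (· ≤ ·) C}

/-! ## Completed spaces of labelled trees and their completed tensor powers -/

/-- An index set together with, for each index, a finite set (of vertices) and a group of
permutations of it. -/
structure Shape where
  idx : Type
  vert : idx → Type
  finite : ∀ a, Finite (vert a)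
  sym : ∀ a, Subgroup (Equiv.Perm (vert a))

instance (X : Shape) (a : X.idx) : Finite (X.vert a) := X.finite a

/-- The shape of all pairs of a member of `X` and a member of `Y`. -/
abbrev Shape.prod (X Y : Shape) : Shape where
  idx := X.idx × Y.idx
  vert a := X.vert a.1 ⊕ Y.vert a.2
  finite _ := inferInstance
  sym a := prodPerm (X.sym a.1) (Y.sym a.2)

/-- The rooted trees with their non-root vertices and symmetry groups. -/
abbrev treeShape : Shape where
  idx := RTree
  vert := RTree.Vertex
  finite _ := inferInstance
  sym := RTree.SG

section Spaces

variable {V : Type*} [AddCommGroup V] [Module ℝ V] [TopologicalSpace V] {I : Type*}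
variable (S : SymmetricCrossSeminorms V I)

/-- The topological product of the spaces `V^{⊗̂ vert a} / ker sym_{sym a}`. This is the
closure of their direct sum in the product topology. For the shape of trees it is the
completed space of labelled trees. For `X.prod Y` it is the completed tensor product of the spaces
of `X` and `Y`, because `ker sym_{G × K}` is the closure of
`ker sym_G ⊗ V^{⊗ κ} + V^{⊗ ι} ⊗ ker sym_K`. -/
abbrev Hat (X : Shape) : Type _ := ∀ a : X.idx, SymPow S (X.sym a)

/-- The completed space of labelled trees, the product over all trees `t` of the spaces
`V^{⊗̂ t} = V^{⊗̂ |t|} / ker sym_{SG(t)}`. -/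
abbrev HatTr : Type _ := Hat S treeShape

variable {S} in
/-- The canonical bilinear map `x, y ↦ x ⊗ y` into the completed tensor product. -/
def tens {X Y : Shape} : Hat S X →ₗ[ℝ] Hat S Y →ₗ[ℝ] Hat S (X.prod Y) :=
  LinearMap.mk₂ ℝ (fun x y a => SymPow.tmul S (X.sym a.1) (Y.sym a.2) (x a.1) (y a.2))
    (fun _ _ _ => funext fun a => (SymPow.tmul S (X.sym a.1) (Y.sym a.2)).map_add₂ _ _ _)
    (fun _ _ _ => funext fun a => (SymPow.tmul S (X.sym a.1) (Y.sym a.2)).map_smul₂ _ _ _)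
    (fun _ _ _ => funext fun a => map_add (SymPow.tmul S (X.sym a.1) (Y.sym a.2) _) _ _)
    (fun _ _ _ => funext fun a => map_smul (SymPow.tmul S (X.sym a.1) (Y.sym a.2) _) _ _)

open Classical in
/-- The elementary labelled tree given by a tree `WithBot ι` and a labelling `v` of its vertices
other than the root. -/
def labelled {ι : Type} [Finite ι] [PartialOrder ι] [IsForest ι] (v : ι → V) : HatTr S :=
  Pi.single (M := fun t : RTree => SymPow S t.SG) (treeOf ι)
    (SymPow.pure S (treeOf ι).SG (v ∘ (treeIso ι).symm))

/-- The homogeneous part of degree `n`, consisting of the families supported by the indices with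
`n` vertices. For the shape of trees this is the sum of the `V^{⊗̂ t}` over all trees `t` with
`n` vertices other than the root. -/
def degreePart (X : Shape) (n : ℕ) : Submodule ℝ (Hat S X) where
  carrier := {x | ∀ a, Nat.card (X.vert a) ≠ n → x a = 0}
  add_mem' := fun hx hy a ha => by rw [Pi.add_apply, hx a ha, hy a ha, add_zero]
  zero_mem' := fun _ _ => rfl
  smul_mem' := fun c x hx a ha => by rw [Pi.smul_apply, hx a ha, smul_zero]

end Spaces

/-! ## Topological graded bialgebras and Hopf algebras -/

section Hopf

variable {V : Type*} [AddCommGroup V] [Module ℝ V] [TopologicalSpace V] {I : Type*}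

/-- Continuous linear operations `(H, m, η, Δ, ε)`, with `m` defined on the completed tensor
square of `H` and `Δ` taking values in it. -/
structure HopfOps (S : SymmetricCrossSeminorms V I) (X : Shape) where
  mul : Hat S (X.prod X) →L[ℝ] Hat S X
  unit : ℝ →L[ℝ] Hat S X
  comul : Hat S X →L[ℝ] Hat S (X.prod X)
  counit : Hat S X →L[ℝ] ℝ

variable {S : SymmetricCrossSeminorms V I} {X : Shape}

/-- `F = f ⊗̂ g`. Since the span of the `x ⊗ y` is dense, there is at most one continuous linear
map with this property. -/
def IsTensorMap {X X' Y Y' : Shape} (f : Hat S X →L[ℝ] Hat S X') (g : Hat S Y →L[ℝ] Hat S Y')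
    (F : Hat S (X.prod Y) →L[ℝ] Hat S (X'.prod Y')) : Prop :=
  ∀ x y, F (tens x y) = tens (f x) (g y)

/-- `α` is the associativity isomorphism `(x ⊗ y) ⊗ z ↦ x ⊗ (y ⊗ z)`. -/
def IsAssociator {X Y Z : Shape}
    (α : Hat S ((X.prod Y).prod Z) →L[ℝ] Hat S (X.prod (Y.prod Z))) : Prop :=
  ∀ x y z, α (tens (tens x y) z) = tens x (tens y z)

/-- `τ` is the exchange `(x ⊗ y) ⊗ (z ⊗ w) ↦ (x ⊗ z) ⊗ (y ⊗ w)` of the middle factors. -/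
def IsMiddleSwap {X Y Z W : Shape}
    (τ : Hat S ((X.prod Y).prod (Z.prod W)) →L[ℝ] Hat S ((X.prod Z).prod (Y.prod W))) : Prop :=
  ∀ x y z w, τ (tens (tens x y) (tens z w)) = tens (tens x z) (tens y w)

/-- The axioms of a topological bialgebra: those of a bialgebra, with completed tensor
products. -/
structure IsTopologicalBialgebra (A : HopfOps S X) : Prop where
  assoc : ∃ (α : Hat S ((X.prod X).prod X) →L[ℝ] Hat S (X.prod (X.prod X)))
    (ml : Hat S ((X.prod X).prod X) →L[ℝ] Hat S (X.prod X))
    (mr : Hat S (X.prod (X.prod X)) →L[ℝ] Hat S (X.prod X)),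
    IsAssociator α ∧ IsTensorMap A.mul (.id ℝ _) ml ∧ IsTensorMap (.id ℝ _) A.mul mr ∧
      A.mul ∘L ml = A.mul ∘L mr ∘L α
  one_mul : ∀ x, A.mul (tens (A.unit 1) x) = x
  mul_one : ∀ x, A.mul (tens x (A.unit 1)) = x
  coassoc : ∃ (α : Hat S ((X.prod X).prod X) →L[ℝ] Hat S (X.prod (X.prod X)))
    (Δl : Hat S (X.prod X) →L[ℝ] Hat S ((X.prod X).prod X))
    (Δr : Hat S (X.prod X) →L[ℝ] Hat S (X.prod (X.prod X))),
    IsAssociator α ∧ IsTensorMap A.comul (.id ℝ _) Δl ∧ IsTensorMap (.id ℝ _) A.comul Δr ∧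
      α ∘L Δl ∘L A.comul = Δr ∘L A.comul
  counit_comul : ∃ εl : Hat S (X.prod X) →L[ℝ] Hat S X,
    (∀ x y, εl (tens x y) = A.counit x • y) ∧ εl ∘L A.comul = .id ℝ _
  comul_counit : ∃ εr : Hat S (X.prod X) →L[ℝ] Hat S X,
    (∀ x y, εr (tens x y) = A.counit y • x) ∧ εr ∘L A.comul = .id ℝ _
  comul_mul : ∃ (ΔΔ : Hat S (X.prod X) →L[ℝ] Hat S ((X.prod X).prod (X.prod X)))
    (τ : Hat S ((X.prod X).prod (X.prod X)) →L[ℝ] Hat S ((X.prod X).prod (X.prod X)))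
    (mm : Hat S ((X.prod X).prod (X.prod X)) →L[ℝ] Hat S (X.prod X)),
    IsTensorMap A.comul A.comul ΔΔ ∧ IsMiddleSwap τ ∧ IsTensorMap A.mul A.mul mm ∧
      A.comul ∘L A.mul = mm ∘L τ ∘L ΔΔ
  comul_one : A.comul (A.unit 1) = tens (A.unit 1) (A.unit 1)
  counit_mul : ∀ x y, A.counit (A.mul (tens x y)) = A.counit x * A.counit y
  counit_one : A.counit (A.unit 1) = 1

/-- A topological graded bialgebra: as a topological vector space, `H` is the product of the
homogeneous parts `gr n`, and all operations respect the degree. The part of degree `n` of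
the completed tensor square is the sum over `p + q = n` of the closed spans of the
`x ⊗ y` with `x` of degree `p` and `y` of degree `q`. -/
structure IsTopologicalGradedBialgebra (gr : ℕ → Submodule ℝ (Hat S X)) (A : HopfOps S X) :
    Prop extends IsTopologicalBialgebra A where
  decomposition : ∃ e : Hat S X ≃L[ℝ] (∀ n, gr n), ∀ n (x : gr n), e x = Pi.single n x
  mul_mem : ∀ p q, ∀ x ∈ gr p, ∀ y ∈ gr q, A.mul (tens x y) ∈ gr (p + q)
  one_mem : A.unit 1 ∈ gr 0
  comul_mem : ∀ n, ∀ x ∈ gr n, A.comul x ∈ ⨆ (p : ℕ) (q : ℕ) (_ : p + q = n),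
    (Submodule.span ℝ {z | ∃ x ∈ gr p, ∃ y ∈ gr q, tens x y = z}).topologicalClosure
  counit_eq_zero : ∀ n, n ≠ 0 → ∀ x ∈ gr n, A.counit x = 0

/-- `s` is an antipode: `m ∘ (s ⊗̂ id) ∘ Δ = η ∘ ε = m ∘ (id ⊗̂ s) ∘ Δ`. -/
def IsAntipode (A : HopfOps S X) (s : Hat S X →L[ℝ] Hat S X) : Prop :=
  ∃ sl sr : Hat S (X.prod X) →L[ℝ] Hat S (X.prod X),
    IsTensorMap s (.id ℝ _) sl ∧ IsTensorMap (.id ℝ _) s sr ∧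
      A.mul ∘L sl ∘L A.comul = A.unit ∘L A.counit ∧ A.mul ∘L sr ∘L A.comul = A.unit ∘L A.counit

/-- A topological Hopf algebra: a topological bialgebra that has a continuous antipode. -/
structure IsTopologicalHopfAlgebra (A : HopfOps S X) : Prop extends IsTopologicalBialgebra A where
  antipode : ∃ s : Hat S X →L[ℝ] Hat S X, IsAntipode A s

/-! ## The Grossman-Larson and the Connes-Kreimer operations -/

/-- The unit `η λ = λ 𝟏` and the counit, which is the coefficient of `𝟏`, where `𝟏` is the tree
that consists of the root only. -/
structure HasTreeUnits (A : HopfOps S treeShape) : Prop where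
  unit_apply : ∀ c : ℝ, A.unit c = c • labelled S (ι := PEmpty) PEmpty.elim
  counit_one : ∀ (ι : Type) [Finite ι] [PartialOrder ι] [IsForest ι] [IsEmpty ι] (v : ι → V),
    A.counit (labelled S v) = 1
  counit_of_nonempty : ∀ (ι : Type) [Finite ι] [PartialOrder ι] [IsForest ι] [Nonempty ι]
    (v : ι → V), A.counit (labelled S v) = 0

/-- The operations of the Grossman-Larson algebra on elementary labelled trees: the product is
the sum over all grafting maps, the coproduct is the sum over all ways to distribute the branches
`t₁, …, tₖ` of `t = t₁ ∘ ⋯ ∘ tₖ` to the two factors. -/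
structure IsGrossmanLarson (A : HopfOps S treeShape) : Prop extends HasTreeUnits A where
  mul_labelled : ∀ (ι κ : Type) [Finite ι] [PartialOrder ι] [IsForest ι]
    [Finite κ] [PartialOrder κ] [IsForest κ] (v : ι → V) (w : κ → V),
    A.mul (tens (labelled S v) (labelled S w)) =
      ∑ᶠ d : RootChild ι → WithBot κ, labelled S (ι := Graft d) (Sum.elim v w)
  comul_labelled : ∀ (ι : Type) [Finite ι] [PartialOrder ι] [IsForest ι] (v : ι → V),
    A.comul (labelled S v) = ∑ᶠ J : Set (RootChild ι),
      tens (labelled S (ι := Σ c : J, Branch c.1) fun x => v x.2.1)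
        (labelled S (ι := Σ c : (Jᶜ : Set (RootChild ι)), Branch c.1) fun x => v x.2.1)

/-- The operations of the Connes-Kreimer algebra on elementary labelled trees: the product
`t ∘ s` is the grafting of all children of the root of `t` to the root of `s`, the coproduct is
the sum over all admissible cuts of `P^C ⊗ R^C`. -/
structure IsConnesKreimer (A : HopfOps S treeShape) : Prop extends HasTreeUnits A where
  mul_labelled : ∀ (ι κ : Type) [Finite ι] [PartialOrder ι] [IsForest ι]
    [Finite κ] [PartialOrder κ] [IsForest κ] (v : ι → V) (w : κ → V),
    A.mul (tens (labelled S v) (labelled S w)) =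
      labelled S (ι := Graft fun _ : RootChild ι => (⊥ : WithBot κ)) (Sum.elim v w)
  comul_labelled : ∀ (ι : Type) [Finite ι] [PartialOrder ι] [IsForest ι] (v : ι → V),
    A.comul (labelled S v) = ∑ᶠ C : AdmissibleCut ι,
      tens (labelled S (ι := CutOff C.1) fun x => v x.1)
        (labelled S (ι := Remain C.1) fun x => v x.1)

end Hopf

end TreeHopf

end

noncomputable section

namespace TreeHopf

/-! ## Reindexing operators between completed symmetric powers -/

section Analysis

variable {V : Type*} [AddCommGroup V] [Module ℝ V] [TopologicalSpace V] {I : Type*}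
variable (S : SymmetricCrossSeminorms V I)

section Powers

variable {ι κ : Type*} [Finite ι] [Finite κ]

/-! Renaming tensor factors only permutes the cross seminorms among themselves, so it is continuous,
and so is averaging over a finite permutation group. Call an operator combinatorial (`combOp`) if
each of its components is a linear combination of maps `SymPow.rho`, which symmetrize and then
rename. A renaming needs equally many factors on both sides, so such operators preserve the degree.
They are closed under composition (`combOp_comp`) and under completed tensor products
(`exists_tensorMap`). Hence, once the operations are combinatorial, all tensor products of
operations in the axioms exist, and an identity of continuous operators need only be tested on
elementary labelled trees, whose span is dense.

For such tests all trees are placed on subsets of one finite set `α` with one labelling `v`; a tree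
becomes a partial forest (`PForest`) on `α`. The structure constants of both algebras are then 0 or
1 and come from two ternary relations: `Cut`, where `T` consists of an upper set `P` and the
remaining lower set `Q`, and `DisjUnion`. The ways of grafting `P` onto `Q` are exactly the `T` with
`Cut P Q T`. Grossman-Larson multiplies by `Cut` and comultiplies by `DisjUnion`; Connes-Kreimer
exchanges the two. For a given relation, associativity of the product and coassociativity of the
coproduct are the same statement about splitting a forest into three (`cut_good`, `union_good`).
Compatibility of product and coproduct says that to cut a disjoint union is to cut each part
(`union_cut_iff`), and one reading of it serves each algebra.

The antipode is the inverse of the identity for convolution, given by the geometric series in `id -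
η ∘ ε`. This difference kills degree 0, so its `k`-th convolution power kills all degrees below `k`
(`vanishes_pow`). The series is therefore finite in each degree, and its sum is again combinatorial.
-/

theorem SymmetricCrossSeminorms.seminorm_reindex (e : ι ≃ κ) (i : κ → I) (a : ⨂[ℝ] _ : ι, V) :
    S.seminorm κ i (PiTensorProduct.reindex ℝ (fun _ => V) e a) = S.seminorm ι (i ∘ e) a := by
  rw [S.seminorm_eq (e.trans (Finite.equivFin κ)), S.seminorm_eq (Finite.equivFin κ),
    reindex_reindex']
  congr 2
  funext l
  simp

/-- Renaming of the factors, on the uncompleted tensor power. -/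
def TPow.reindex (e : ι ≃ κ) : TPow S ι →L[ℝ] TPow S κ where
  toLinearMap := (PiTensorProduct.reindex ℝ (fun _ => V) e).toLinearMap
  cont := by
    refine (TPow.withSeminorms S ι).continuous_of_isBounded (TPow.withSeminorms S κ) _ ?_
    intro i
    refine ⟨{i ∘ e}, 1, fun a => ?_⟩
    simp only [Finset.sup_singleton, one_smul]
    exact (S.seminorm_reindex e i a).le

/-- Renaming of the factors, on the completed tensor power. -/
def CPow.reindex (e : ι ≃ κ) : CPow S ι →L[ℝ] CPow S κ := (TPow.reindex S e).completion

/-- Elementary tensors in the completed tensor power. -/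
def CPow.pure (v : ι → V) : CPow S ι := (TPow.pure S v : CPow S ι)

theorem TPow.reindex_pure (e : ι ≃ κ) (v : ι → V) :
    TPow.reindex S e (TPow.pure S v) = TPow.pure S (v ∘ e.symm) :=
  PiTensorProduct.reindex_tprod e v

theorem CPow.reindex_pure (e : ι ≃ κ) (v : ι → V) :
    CPow.reindex S e (CPow.pure S v) = CPow.pure S (v ∘ e.symm) := by
  rw [CPow.pure, CPow.reindex, ContinuousLinearMap.completion_apply_coe, TPow.reindex_pure]
  rfl

theorem CPow.perm_pure (σ : Equiv.Perm ι) (v : ι → V) :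
    CPow.perm S σ (CPow.pure S v) = CPow.pure S (v ∘ σ) := by
  rw [CPow.pure, CPow.perm_coe]
  exact congrArg _ (PiTensorProduct.reindex_tprod σ.symm v)

theorem CPow.tmul_pure (v : ι → V) (w : κ → V) :
    CPow.tmul S (CPow.pure S v) (CPow.pure S w) = CPow.pure S (Sum.elim v w) := by
  rw [CPow.pure, CPow.pure, CPow.tmul_coe]
  exact congrArg _ (PiTensorProduct.tmulEquiv_apply ℝ V v w)

theorem CPow.dense_span_pure :
    Dense (Submodule.span ℝ (Set.range (CPow.pure S (ι := ι))) : Set (CPow S ι)) := by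
  refine (UniformSpace.Completion.denseRange_coe (α := TPow S ι)).mono ?_
  rintro _ ⟨a, rfl⟩
  have h : a ∈ Submodule.span ℝ (Set.range (TPow.pure S (ι := ι))) := by
    exact (PiTensorProduct.span_tprod_eq_top (R := ℝ) (s := fun _ : ι => V)).ge
      (Submodule.mem_top (x := (a : ⨂[ℝ] _ : ι, V)))
  let c : TPow S ι →ₗ[ℝ] CPow S ι :=
    { toFun := fun a => (a : CPow S ι)
      map_add' := UniformSpace.Completion.coe_add
      map_smul' := fun r a => UniformSpace.Completion.coe_smul r a }
  have h2 := Submodule.mem_map_of_mem (f := c) h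
  rw [Submodule.map_span, ← Set.range_comp] at h2
  exact h2

/-- The span of the elementary tensors is dense, so this turns every identity between permutations,
renamings and products of factors into a computation with labellings. -/
theorem CPow.ext_pure {Z : Type*} [AddCommGroup Z] [Module ℝ Z] [TopologicalSpace Z] [T2Space Z]
    {f g : CPow S ι →L[ℝ] Z} (h : ∀ v, f (CPow.pure S v) = g (CPow.pure S v)) : f = g := by
  refine ContinuousLinearMap.ext_on (CPow.dense_span_pure S) ?_
  rintro _ ⟨v, rfl⟩
  exact h v

/-- Permutations act on labellings by precomposition, hence from the right, and the order of the
factors is reversed. -/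
theorem CPow.perm_perm (σ τ : Equiv.Perm ι) (x : CPow S ι) :
    CPow.perm S σ (CPow.perm S τ x) = CPow.perm S (τ * σ) x := by
  have : CPow.perm S σ ∘L CPow.perm S τ = CPow.perm S (τ * σ) :=
    CPow.ext_pure S fun v => by simp [CPow.perm_pure, Function.comp_assoc]
  exact DFunLike.congr_fun this x

theorem CPow.reindex_perm (e : ι ≃ κ) (σ : Equiv.Perm ι) (x : CPow S ι) :
    CPow.reindex S e (CPow.perm S σ x) = CPow.perm S (e.permCongr σ) (CPow.reindex S e x) := by
  have : CPow.reindex S e ∘L CPow.perm S σ = CPow.perm S (e.permCongr σ) ∘L CPow.reindex S e :=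
    CPow.ext_pure S fun v => by
      simp only [ContinuousLinearMap.comp_apply, CPow.perm_pure, CPow.reindex_pure]
      congr 1
      funext x
      simp
  exact DFunLike.congr_fun this x

theorem CPow.sym_perm (G : Subgroup (Equiv.Perm ι)) {σ : Equiv.Perm ι} (hσ : σ ∈ G)
    (x : CPow S ι) : CPow.sym S G (CPow.perm S σ x) = CPow.sym S G x := by
  have := Fintype.ofFinite ι
  have := Fintype.ofFinite G
  rw [CPow.sym_apply, CPow.sym_apply]
  congr 1
  simp only [CPow.perm_perm]
  exact Fintype.sum_equiv (Equiv.mulLeft (⟨σ, hσ⟩ : G)) _ _ fun τ => rfl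

variable (G : Subgroup (Equiv.Perm ι)) (K : Subgroup (Equiv.Perm κ))

/-- The kernel of the continuous map `sym` is closed. The separation property is what makes density
arguments available for maps into the quotient. -/
instance : T3Space (SymPow S G) := by
  have : IsClosed ((CPow.sym S G).ker : Set (CPow S ι)) := (CPow.sym S G).isClosed_ker
  exact Submodule.t3_quotient_of_isClosed _

/-- The quotient map onto the symmetrized power, as a continuous linear map. -/
def SymPow.mkL : CPow S ι →L[ℝ] SymPow S G :=
  ⟨(CPow.sym S G).ker.mkQ, (CPow.sym S G).ker.continuous_mkQ⟩

/-- The symmetrization, factored through the quotient by its kernel. -/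
def SymPow.symLift : SymPow S G →L[ℝ] CPow S ι :=
  ⟨(CPow.sym S G).ker.liftQ (CPow.sym S G).toLinearMap le_rfl,
    (CPow.sym S G).ker.isQuotientMap_mkQ.continuous_iff.2 (CPow.sym S G).continuous⟩

theorem SymPow.symLift_mk (x : CPow S ι) :
    SymPow.symLift S G (SymPow.mkL S G x) = CPow.sym S G x := rfl

theorem SymPow.mkL_pure (v : ι → V) : SymPow.mkL S G (CPow.pure S v) = SymPow.pure S G v := rfl

theorem SymPow.mk_perm {σ : Equiv.Perm ι} (hσ : σ ∈ G) (x : CPow S ι) :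
    SymPow.mkL S G (CPow.perm S σ x) = SymPow.mkL S G x := by
  refine (Submodule.Quotient.eq _).2 ?_
  change CPow.sym S G (_ - _) = 0
  rw [map_sub, CPow.sym_perm S G hσ, sub_self]

theorem SymPow.pure_comp_perm {σ : Equiv.Perm ι} (hσ : σ ∈ G) (v : ι → V) :
    SymPow.pure S G (v ∘ σ) = SymPow.pure S G v := by
  rw [← SymPow.mkL_pure, ← CPow.perm_pure, SymPow.mk_perm S G hσ]
  rfl

theorem SymPow.dense_span_pure :
    Dense (Submodule.span ℝ (Set.range (SymPow.pure S G)) : Set (SymPow S G)) := by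
  have h := (Submodule.Quotient.mk_surjective (CPow.sym S G).ker).denseRange.dense_image
    (SymPow.mkL S G).continuous (CPow.dense_span_pure S (ι := ι))
  refine h.mono ?_
  rintro _ ⟨x, hx, rfl⟩
  have h2 := Submodule.mem_map_of_mem (f := (SymPow.mkL S G).toLinearMap) hx
  rw [Submodule.map_span, ← Set.range_comp] at h2
  exact h2

/-- The operator between symmetrized powers that symmetrizes and then renames the factors. -/
def SymPow.rho (e : ι ≃ κ) : SymPow S G →L[ℝ] SymPow S K :=
  SymPow.mkL S K ∘L CPow.reindex S e ∘L SymPow.symLift S G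

/-- `symLift` replaces a class by its average over `G`; if `F` is constant on the `G`-orbit of the
labelling, averaging has no effect. In this way a symmetric recipe on elementary tensors descends to
the quotient. -/
theorem SymPow.symLift_average {Z : Type*} [AddCommGroup Z] [Module ℝ Z] [TopologicalSpace Z]
    (F : CPow S ι →L[ℝ] Z) (v : ι → V) (h : ∀ σ ∈ G, F (CPow.pure S (v ∘ σ)) = F (CPow.pure S v)) :
    F (SymPow.symLift S G (SymPow.pure S G v)) = F (CPow.pure S v) := by
  have := Fintype.ofFinite ι
  have := Fintype.ofFinite G
  rw [← SymPow.mkL_pure, SymPow.symLift_mk, CPow.sym_apply, map_smul, map_sum]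
  simp only [CPow.perm_pure]
  rw [Finset.sum_congr rfl fun (σ : G) _ => h σ σ.2]
  simp only [Finset.sum_const, Finset.card_univ, ← Nat.card_eq_fintype_card]
  rw [← Nat.cast_smul_eq_nsmul ℝ, smul_smul, inv_mul_cancel₀, one_smul]
  exact_mod_cast Nat.card_pos.ne'

/-- When `e` conjugates `G` into `K`, the summands of the average all have the same class modulo
`K`. Without that condition `rho` yields a genuine average. -/
theorem SymPow.rho_pure (e : ι ≃ κ) (h : ∀ σ ∈ G, e.permCongr σ ∈ K) (v : ι → V) :
    SymPow.rho S G K e (SymPow.pure S G v) = SymPow.pure S K (v ∘ e.symm) := by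
  refine (SymPow.symLift_average S G (SymPow.mkL S K ∘L CPow.reindex S e) v ?_).trans ?_
  · intro σ hσ
    simp only [ContinuousLinearMap.comp_apply]
    rw [← CPow.perm_pure, CPow.reindex_perm, SymPow.mk_perm S K (h σ hσ)]
  · simp only [ContinuousLinearMap.comp_apply, CPow.reindex_pure, SymPow.mkL_pure]

theorem SymPow.tmul_pure (v : ι → V) (w : κ → V) :
    SymPow.tmul S G K (SymPow.pure S G v) (SymPow.pure S K w) =
      SymPow.pure S (prodPerm G K) (Sum.elim v w) := by
  rw [← SymPow.mkL_pure, ← SymPow.mkL_pure, ← SymPow.mkL_pure, ← CPow.tmul_pure]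
  rfl

/-- Continuity in each factor separately is enough, since the density arguments below vary one
factor at a time. -/
theorem SymPow.continuous_tmul_left (y : SymPow S K) :
    Continuous fun x : SymPow S G => SymPow.tmul S G K x y := by
  obtain ⟨y, rfl⟩ := Submodule.Quotient.mk_surjective _ y
  refine (CPow.sym S G).ker.isQuotientMap_mkQ.continuous_iff.2 ?_
  exact (SymPow.mkL S (prodPerm G K)).continuous.comp
    ((CPow.continuous_tmul S).comp (continuous_id.prodMk continuous_const))

theorem SymPow.continuous_tmul_right (x : SymPow S G) :
    Continuous fun y : SymPow S K => SymPow.tmul S G K x y := by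
  obtain ⟨x, rfl⟩ := Submodule.Quotient.mk_surjective _ x
  refine (CPow.sym S K).ker.isQuotientMap_mkQ.continuous_iff.2 ?_
  exact (SymPow.mkL S (prodPerm G K)).continuous.comp
    ((CPow.continuous_tmul S).comp (continuous_const.prodMk continuous_id))

end Powers

/-! ### Compatibility of tensor multiplication with renaming and symmetrization. -/

section RhoTmul

variable {ι κ ι' κ' : Type*} [Finite ι] [Finite κ] [Finite ι'] [Finite κ']

/-- Both sides are continuous in each factor, so density of elementary tensors is used twice: first
in `x` for fixed `y`, then in `y` for `x` an elementary tensor. -/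
theorem CPow.tmul_reindex (e : ι ≃ ι') (f : κ ≃ κ') (x : CPow S ι) (y : CPow S κ) :
    CPow.tmul S (CPow.reindex S e x) (CPow.reindex S f y) =
      CPow.reindex S (Equiv.sumCongr e f) (CPow.tmul S x y) := by
  have hc {ι κ : Type _} [Finite ι] [Finite κ] := CPow.continuous_tmul S (ι := ι) (κ := κ)
  let L (y : CPow S κ) : CPow S ι →L[ℝ] CPow S (ι ⊕ κ) :=
    ⟨(CPow.tmul S).flip y, hc.comp (continuous_id.prodMk continuous_const)⟩
  let R (x : CPow S ι) : CPow S κ →L[ℝ] CPow S (ι ⊕ κ) :=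
    ⟨CPow.tmul S x, hc.comp (continuous_const.prodMk continuous_id)⟩
  let L' (y : CPow S κ') : CPow S ι' →L[ℝ] CPow S (ι' ⊕ κ') :=
    ⟨(CPow.tmul S).flip y, (CPow.continuous_tmul S).comp (continuous_id.prodMk continuous_const)⟩
  let R' (x : CPow S ι') : CPow S κ' →L[ℝ] CPow S (ι' ⊕ κ') :=
    ⟨CPow.tmul S x, (CPow.continuous_tmul S).comp (continuous_const.prodMk continuous_id)⟩
  have h1 : ∀ y, L' (CPow.reindex S f y) ∘L CPow.reindex S e =
      CPow.reindex S (Equiv.sumCongr e f) ∘L L y := by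
    intro y
    refine CPow.ext_pure S fun v => ?_
    have h2 : R' (CPow.reindex S e (CPow.pure S v)) ∘L CPow.reindex S f =
        CPow.reindex S (Equiv.sumCongr e f) ∘L R (CPow.pure S v) := by
      refine CPow.ext_pure S fun w => ?_
      change CPow.tmul S (CPow.reindex S e (CPow.pure S v)) (CPow.reindex S f (CPow.pure S w)) =
        CPow.reindex S (Equiv.sumCongr e f) (CPow.tmul S (CPow.pure S v) (CPow.pure S w))
      simp only [CPow.reindex_pure, CPow.tmul_pure]
      congr 1
      funext z
      cases z <;> rfl
    exact DFunLike.congr_fun h2 y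
  exact DFunLike.congr_fun (h1 y) x

/-- Symmetrizing over `G × K` symmetrizes each factor (`CPow.sym_tmul`), so the tensor product of
two maps `rho` is again a `rho`. This is the source of all tensor products of operators. -/
theorem SymPow.rho_tmul (G : Subgroup (Equiv.Perm ι)) (K : Subgroup (Equiv.Perm κ))
    (G' : Subgroup (Equiv.Perm ι')) (K' : Subgroup (Equiv.Perm κ')) (e : ι ≃ ι') (f : κ ≃ κ')
    (x : SymPow S G) (y : SymPow S K) :
    SymPow.rho S (prodPerm G K) (prodPerm G' K') (Equiv.sumCongr e f) (SymPow.tmul S G K x y) =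
      SymPow.tmul S G' K' (SymPow.rho S G G' e x) (SymPow.rho S K K' f y) := by
  obtain ⟨x, rfl⟩ := Submodule.Quotient.mk_surjective _ x
  obtain ⟨y, rfl⟩ := Submodule.Quotient.mk_surjective _ y
  change SymPow.mkL S _ (CPow.reindex S _ (CPow.sym S (prodPerm G K) (CPow.tmul S x y))) =
    SymPow.mkL S _ (CPow.tmul S (CPow.reindex S e (CPow.sym S G x))
      (CPow.reindex S f (CPow.sym S K y)))
  rw [CPow.sym_tmul, CPow.tmul_reindex]

end RhoTmul

end Analysis

/-! ## Combinatorial operators -/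

section Operators

variable {V : Type*} [AddCommGroup V] [Module ℝ V] [TopologicalSpace V] {I : Type*}
variable (S : SymmetricCrossSeminorms V I)

open Classical in
/-- The elementary tensor `⨂ w x` in the component `a`. -/
def elemT (X : Shape) (a : X.idx) (w : X.vert a → V) : Hat S X :=
  Pi.single (M := fun a => SymPow S (X.sym a)) a (SymPow.pure S (X.sym a) w)

open Classical in
theorem elemT_same (X : Shape) (a : X.idx) (w : X.vert a → V) :
    elemT S X a w a = SymPow.pure S (X.sym a) w := 
  Pi.single_eq_same (M := fun a => SymPow S (X.sym a)) a _

open Classical in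
theorem elemT_ne (X : Shape) {a b : X.idx} (h : b ≠ a) (w : X.vert a → V) :
    elemT S X a w b = 0 := 
  Pi.single_eq_of_ne (M := fun a => SymPow S (X.sym a)) h _

theorem elemT_comp_perm (X : Shape) (a : X.idx) {σ : Equiv.Perm (X.vert a)} (h : σ ∈ X.sym a)
    (w : X.vert a → V) : elemT S X a (w ∘ σ) = elemT S X a w := by
  rw [elemT, SymPow.pure_comp_perm S _ h]
  rfl

theorem tens_elemT (X Y : Shape) (a : X.idx) (b : Y.idx) (v : X.vert a → V) (w : Y.vert b → V) :
    tens (elemT S X a v) (elemT S Y b w) = elemT S (X.prod Y) (a, b) (Sum.elim v w) := by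
  funext ⟨a', b'⟩
  change SymPow.tmul S (X.sym a') (Y.sym b') (elemT S X a v a') (elemT S Y b w b') = _
  by_cases h : (a', b') = (a, b)
  · obtain ⟨rfl, rfl⟩ := Prod.mk.inj h
    rw [elemT_same, elemT_same, elemT_same, SymPow.tmul_pure]
  · rw [elemT_ne S (X.prod Y) h]
    by_cases ha : a' = a
    · have hb : b' ≠ b := fun hb => h (by rw [ha, hb])
      rw [elemT_ne S _ hb, map_zero]
    · rw [elemT_ne S _ ha, map_zero, LinearMap.zero_apply]

open Classical in
theorem Hat.hasSum_single {X : Shape} (x : Hat S X) :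
    HasSum (fun a => (Pi.single a (x a) : Hat S X)) x := by
  refine Pi.hasSum.2 fun b => ?_
  have h : ∀ a, a ≠ b → (Pi.single a (x a) : Hat S X) b = 0 :=
    fun a hab => Pi.single_eq_of_ne hab.symm _
  simpa only [Pi.single_eq_same] using _root_.hasSum_single b h

-- An element is the unconditional sum of its components, and each component is a limit of
-- combinations of elementary tensors. Only components where `x` is nonzero enter, which lets the
-- lemma be applied inside a fixed degree.
open Classical in
theorem Hat.mem_of_isClosed {X : Shape} {s : Submodule ℝ (Hat S X)} (hs : IsClosed (s : Set (Hat S X)))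
    {x : Hat S X} (h : ∀ a, x a ≠ 0 → ∀ w, elemT S X a w ∈ s) : x ∈ s := by
  refine hs.mem_of_tendsto (Hat.hasSum_single S x) (Filter.Eventually.of_forall fun t => ?_)
  refine s.sum_mem fun a _ => ?_
  by_cases hx : x a = 0
  · rw [hx, Pi.single_zero]
    exact s.zero_mem
  · let L := ContinuousLinearMap.single ℝ (fun a => SymPow S (X.sym a)) a
    have hd := SymPow.dense_span_pure S (X.sym a)
    have hc : IsClosed (L ⁻¹' (s : Set (Hat S X))) := hs.preimage L.continuous
    have hsub : (Submodule.span ℝ (Set.range (SymPow.pure S (X.sym a))) :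
        Set (SymPow S (X.sym a))) ⊆ L ⁻¹' (s : Set (Hat S X)) := by
      change Submodule.span ℝ _ ≤ s.comap L.toLinearMap
      refine Submodule.span_le.2 ?_
      rintro _ ⟨w, rfl⟩
      exact h a hx w
    have := hc.closure_subset_iff.2 hsub (hd (x a))
    exact this

theorem Hat.ext_elemT {X : Shape} {Z : Type*} [AddCommGroup Z] [Module ℝ Z] [TopologicalSpace Z]
    [T2Space Z] {f g : Hat S X →L[ℝ] Z} (h : ∀ a w, f (elemT S X a w) = g (elemT S X a w)) :
    f = g := by
  ext x
  exact Hat.mem_of_isClosed S (s := LinearMap.eqLocus f.toLinearMap g.toLinearMap)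
    (isClosed_eq f.continuous g.continuous) fun a _ w => h a w

/-- Tensor multiplication by a fixed element on the right. -/
def tensRight {X Y : Shape} (y : Hat S Y) : Hat S X →L[ℝ] Hat S (X.prod Y) :=
  ⟨tens.flip y, continuous_pi fun a =>
    (SymPow.continuous_tmul_left S (X.sym a.1) (Y.sym a.2) (y a.2)).comp (continuous_apply a.1)⟩

/-- Tensor multiplication by a fixed element on the left. -/
def tensLeft {X Y : Shape} (x : Hat S X) : Hat S Y →L[ℝ] Hat S (X.prod Y) :=
  ⟨tens x, continuous_pi fun a =>
    (SymPow.continuous_tmul_right S (X.sym a.1) (Y.sym a.2) (x a.1)).comp (continuous_apply a.2)⟩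

theorem Hat.ext_tens {X Y : Shape} {Z : Type*} [AddCommGroup Z] [Module ℝ Z] [TopologicalSpace Z]
    [T2Space Z] {f g : Hat S (X.prod Y) →L[ℝ] Z}
    (h : ∀ a w b w', f (tens (elemT S X a w) (elemT S Y b w')) =
      g (tens (elemT S X a w) (elemT S Y b w'))) : f = g := by
  refine Hat.ext_elemT S ?_
  rintro ⟨a, b⟩ w
  have := h a (w ∘ Sum.inl) b (w ∘ Sum.inr)
  rwa [tens_elemT, Sum.elim_comp_inl_inr] at this

/-! ### Rows and operators -/

variable {S}

/-- The projection to a component. -/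
def projL (X : Shape) (a : X.idx) : Hat S X →L[ℝ] SymPow S (X.sym a) :=
  ContinuousLinearMap.proj (R := ℝ) (φ := fun a => SymPow S (X.sym a)) a

theorem projL_apply (X : Shape) (a : X.idx) (x : Hat S X) : projL X a x = x a := rfl

variable (S)

/-- The operators into one symmetrized power spanned by the renamings of the factors. -/
def combRow (X : Shape) {κ : Type*} [Finite κ] (K : Subgroup (Equiv.Perm κ)) :
    Submodule ℝ (Hat S X →L[ℝ] SymPow S K) :=
  Submodule.span ℝ (Set.range fun p : Σ a : X.idx, (X.vert a ≃ κ) =>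
    SymPow.rho S (X.sym p.1) K p.2 ∘L projL X p.1)

/-- The operators all of whose components are linear combinations of renamings of the factors. -/
def combOp (X Y : Shape) : Submodule ℝ (Hat S X →L[ℝ] Hat S Y) where
  carrier := {F | ∀ b, projL Y b ∘L F ∈ combRow S X (Y.sym b)}
  add_mem' := fun {F G} hF hG b => by
    have := (combRow S X (Y.sym b)).add_mem (hF b) (hG b)
    rwa [← ContinuousLinearMap.comp_add] at this
  zero_mem' := fun b => by
    rw [ContinuousLinearMap.comp_zero]
    exact Submodule.zero_mem _
  smul_mem' := fun c F hF b => by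
    have := (combRow S X (Y.sym b)).smul_mem c (hF b)
    rwa [← ContinuousLinearMap.comp_smul] at this

variable {S}

/-- A bijection `X.vert a ≃ κ` forces equal cardinalities, so a row reads only components of its own
degree. -/
theorem combRow_apply_eq_zero {X : Shape} {κ : Type*} [Finite κ] {K : Subgroup (Equiv.Perm κ)}
    {f : Hat S X →L[ℝ] SymPow S K} (hf : f ∈ combRow S X K) {x : Hat S X}
    (hx : ∀ a, Nat.card (X.vert a) = Nat.card κ → x a = 0) : f x = 0 := by
  induction hf using Submodule.span_induction with
  | mem f hf =>
    obtain ⟨⟨a, e⟩, rfl⟩ := hf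
    simp only [ContinuousLinearMap.comp_apply, projL_apply, hx a (Nat.card_congr e), map_zero]
  | zero => rfl
  | add f g _ _ hf hg => rw [add_apply, hf, hg, add_zero]
  | smul c f _ hf => rw [smul_apply, hf, smul_zero]

theorem combOp_apply_eq_zero {X Y : Shape} {F : Hat S X →L[ℝ] Hat S Y} (hF : F ∈ combOp S X Y)
    {x : Hat S X} (b : Y.idx) (hx : ∀ a, Nat.card (X.vert a) = Nat.card (Y.vert b) → x a = 0) :
    F x b = 0 :=
  combRow_apply_eq_zero (hF b) hx

theorem combOp_degreePart {X Y : Shape} {F : Hat S X →L[ℝ] Hat S Y} (hF : F ∈ combOp S X Y)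
    {n : ℕ} {x : Hat S X} (hx : x ∈ degreePart S X n) : F x ∈ degreePart S Y n :=
  fun b hb => combOp_apply_eq_zero hF b fun a ha => hx a (ha.trans_ne hb)

theorem tens_mem_degreePart {X Y : Shape} {p q : ℕ} {x : Hat S X} {y : Hat S Y}
    (hx : x ∈ degreePart S X p) (hy : y ∈ degreePart S Y q) :
    tens x y ∈ degreePart S (X.prod Y) (p + q) := by
  rintro ⟨a, b⟩ hab
  change SymPow.tmul S (X.sym a) (Y.sym b) (x a) (y b) = 0
  by_cases ha : Nat.card (X.vert a) = p
  · by_cases hb : Nat.card (Y.vert b) = q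
    · refine absurd ?_ hab
      rw [Nat.card_sum, ha, hb]
    · rw [hy b hb, map_zero]
  · rw [hx a ha, map_zero, LinearMap.zero_apply]

/-- The second map symmetrizes over `K` between the two renamings. Expanding this average gives the
renamings by `e`, then `σ⁻¹`, then `f`, with `σ` in `K`: a combination of maps `rho`, in general not
a single one. -/
theorem rho_comp_rho {ι κ l : Type*} [Finite ι] [Finite κ] [Finite l] (G : Subgroup (Equiv.Perm ι))
    (K : Subgroup (Equiv.Perm κ)) (H : Subgroup (Equiv.Perm l)) (e : ι ≃ κ) (f : κ ≃ l) :
    SymPow.rho S K H f ∘L SymPow.rho S G K e ∈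
      Submodule.span ℝ (Set.range fun e : ι ≃ l => SymPow.rho S G H e) := by
  have := Fintype.ofFinite κ
  have := Fintype.ofFinite K
  have h : SymPow.rho S K H f ∘L SymPow.rho S G K e =
      (Nat.card K : ℝ)⁻¹ • ∑ σ : K, SymPow.rho S G H
        ((e.trans (σ : Equiv.Perm κ).symm).trans f) := by
    ext x
    have hr : ∀ σ : Equiv.Perm κ, ∀ y : CPow S ι,
        CPow.reindex S f (CPow.perm S σ (CPow.reindex S e y)) =
          CPow.reindex S ((e.trans σ.symm).trans f) y := by
      intro σ y
      have : CPow.reindex S f ∘L CPow.perm S σ ∘L CPow.reindex S e =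
          CPow.reindex S ((e.trans σ.symm).trans f) :=
        CPow.ext_pure S fun v => by
          simp only [ContinuousLinearMap.comp_apply, CPow.perm_pure, CPow.reindex_pure]
          rfl
      exact DFunLike.congr_fun this y
    change SymPow.mkL S H (CPow.reindex S f (CPow.sym S K (CPow.reindex S e
      (SymPow.symLift S G x)))) = _
    rw [CPow.sym_apply, map_smul, map_smul, map_sum, map_sum]
    simp only [hr, smul_apply, sum_apply]
    rfl
  rw [h]
  exact Submodule.smul_mem _ _ (Submodule.sum_mem _ fun σ _ => Submodule.subset_span ⟨_, rfl⟩)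

theorem rho_comp_mem_combRow {X : Shape} {κ l : Type*} [Finite κ] [Finite l]
    {K : Subgroup (Equiv.Perm κ)} (H : Subgroup (Equiv.Perm l)) (f : κ ≃ l)
    {F : Hat S X →L[ℝ] SymPow S K} (hF : F ∈ combRow S X K) :
    SymPow.rho S K H f ∘L F ∈ combRow S X H := by
  induction hF using Submodule.span_induction with
  | mem F hF =>
    obtain ⟨⟨a, e⟩, rfl⟩ := hF
    rw [← ContinuousLinearMap.comp_assoc]
    dsimp only
    generalize hR : SymPow.rho S K H f ∘L SymPow.rho S (X.sym a) K e = R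
    have h : R ∈ _ := hR ▸ rho_comp_rho (X.sym a) K H e f
    clear hR
    induction h using Submodule.span_induction with
    | mem R hR =>
      obtain ⟨e', rfl⟩ := hR
      exact Submodule.subset_span ⟨⟨a, e'⟩, rfl⟩
    | zero => rw [ContinuousLinearMap.zero_comp]; exact Submodule.zero_mem _
    | add F G _ _ hF hG => rw [ContinuousLinearMap.add_comp]; exact Submodule.add_mem _ hF hG
    | smul c F _ hF => rw [ContinuousLinearMap.smul_comp]; exact Submodule.smul_mem _ _ hF
  | zero => rw [ContinuousLinearMap.comp_zero]; exact Submodule.zero_mem _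
  | add F G _ _ hF hG => rw [ContinuousLinearMap.comp_add]; exact Submodule.add_mem _ hF hG
  | smul c F _ hF => rw [ContinuousLinearMap.comp_smul]; exact Submodule.smul_mem _ _ hF

theorem combOp_comp {X Y Z : Shape} {G : Hat S Y →L[ℝ] Hat S Z} {F : Hat S X →L[ℝ] Hat S Y}
    (hG : G ∈ combOp S Y Z) (hF : F ∈ combOp S X Y) : G ∘L F ∈ combOp S X Z := by
  intro c
  rw [← ContinuousLinearMap.comp_assoc]
  generalize hR : projL Z c ∘L G = R
  have h : R ∈ combRow S Y (Z.sym c) := hR ▸ hG c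
  clear hR
  induction h using Submodule.span_induction with
  | mem R hR =>
    obtain ⟨⟨b, e⟩, rfl⟩ := hR
    rw [ContinuousLinearMap.comp_assoc]
    exact rho_comp_mem_combRow _ _ (hF b)
  | zero => rw [ContinuousLinearMap.zero_comp]; exact Submodule.zero_mem _
  | add F G _ _ hF hG => rw [ContinuousLinearMap.add_comp]; exact Submodule.add_mem _ hF hG
  | smul c F _ hF => rw [ContinuousLinearMap.smul_comp]; exact Submodule.smul_mem _ _ hF

/-- Both sides are bilinear in `f` and `g`, and for two single renamings the renaming of the
disjoint union along `Equiv.sumCongr` does it. -/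
theorem exists_combRow_tmul {X Y : Shape} {κ l : Type*} [Finite κ] [Finite l]
    {K : Subgroup (Equiv.Perm κ)} {H : Subgroup (Equiv.Perm l)}
    {f : Hat S X →L[ℝ] SymPow S K} {g : Hat S Y →L[ℝ] SymPow S H}
    (hf : f ∈ combRow S X K) (hg : g ∈ combRow S Y H) :
    ∃ h ∈ combRow S (X.prod Y) (prodPerm K H),
      ∀ x y, h (tens x y) = SymPow.tmul S K H (f x) (g y) := by
  induction hf using Submodule.span_induction with
  | mem f hf =>
    obtain ⟨⟨a, e⟩, rfl⟩ := hf
    induction hg using Submodule.span_induction with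
    | mem g hg =>
      obtain ⟨⟨b, e'⟩, rfl⟩ := hg
      exact ⟨_, Submodule.subset_span ⟨⟨(a, b), Equiv.sumCongr e e'⟩, rfl⟩,
        fun x y => SymPow.rho_tmul S _ _ _ _ e e' (x a) (y b)⟩
    | zero =>
      refine ⟨0, Submodule.zero_mem _, fun x y => ?_⟩
      rw [zero_apply, zero_apply, map_zero]
    | add g g' _ _ hg hg' =>
      obtain ⟨h, hh, h1⟩ := hg
      obtain ⟨h', hh', h1'⟩ := hg'
      refine ⟨h + h', Submodule.add_mem _ hh hh', fun x y => ?_⟩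
      rw [add_apply, add_apply, map_add, h1, h1']
    | smul c g _ hg =>
      obtain ⟨h, hh, h1⟩ := hg
      refine ⟨c • h, Submodule.smul_mem _ _ hh, fun x y => ?_⟩
      rw [smul_apply, smul_apply, map_smul, h1]
  | zero =>
    refine ⟨0, Submodule.zero_mem _, fun x y => ?_⟩
    rw [zero_apply, zero_apply, map_zero,
      LinearMap.zero_apply]
  | add g g' _ _ hg hg' =>
    obtain ⟨h, hh, h1⟩ := hg
    obtain ⟨h', hh', h1'⟩ := hg'
    refine ⟨h + h', Submodule.add_mem _ hh hh', fun x y => ?_⟩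
    rw [add_apply, add_apply, map_add, h1, h1',
      LinearMap.add_apply]
  | smul c g _ hg =>
    obtain ⟨h, hh, h1⟩ := hg
    refine ⟨c • h, Submodule.smul_mem _ _ hh, fun x y => ?_⟩
    rw [smul_apply, smul_apply, map_smul, h1,
      LinearMap.smul_apply]

theorem exists_combOp_of_rows {X Y : Shape} (f : ∀ b, Hat S X →L[ℝ] SymPow S (Y.sym b))
    (hf : ∀ b, f b ∈ combRow S X (Y.sym b)) : ∃ F ∈ combOp S X Y, ∀ x b, F x b = f b x :=
  ⟨ContinuousLinearMap.pi f, hf, fun _ _ => rfl⟩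

/-- Each component of `f ⊗̂ g` is the product of one row of `f` and one row of `g`; a map into a
topological product is continuous as soon as its components are. -/
theorem exists_tensorMap {X X' Y Y' : Shape} {f : Hat S X →L[ℝ] Hat S X'}
    {g : Hat S Y →L[ℝ] Hat S Y'} (hf : f ∈ combOp S X X') (hg : g ∈ combOp S Y Y') :
    ∃ F ∈ combOp S (X.prod Y) (X'.prod Y'), IsTensorMap f g F := by
  choose h hh h1 using fun b : (X'.prod Y').idx => exists_combRow_tmul (hf b.1) (hg b.2)
  obtain ⟨F, hF, hF'⟩ := exists_combOp_of_rows (Y := X'.prod Y') h hh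
  exact ⟨F, hF, fun x y => funext fun b => (hF' _ b).trans (h1 b x y)⟩

theorem id_mem_combOp (X : Shape) : ContinuousLinearMap.id ℝ (Hat S X) ∈ combOp S X X := by
  intro b
  refine Submodule.subset_span ⟨⟨b, Equiv.refl _⟩, ?_⟩
  have : SymPow.rho S (X.sym b) (X.sym b) (Equiv.refl _) = .id ℝ _ := by
    refine ContinuousLinearMap.ext_on (SymPow.dense_span_pure S _) ?_
    rintro _ ⟨v, rfl⟩
    rw [SymPow.rho_pure S _ _ _ fun σ h => h]
    rfl
  dsimp only
  rw [this]
  rfl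

/-- A relabelling of components and factors that respects the symmetries gives an operator. -/
theorem exists_combOp_relabel {X Y : Shape} (π : Y.idx → X.idx) (hπ : Function.Injective π)
    (e : ∀ b, X.vert (π b) ≃ Y.vert b)
    (he : ∀ b, ∀ σ ∈ X.sym (π b), (e b).permCongr σ ∈ Y.sym b) :
    ∃ F ∈ combOp S X Y, (∀ b w, F (elemT S X (π b) w) = elemT S Y b (w ∘ (e b).symm)) ∧
      ∀ a w, (∀ b, π b ≠ a) → F (elemT S X a w) = 0 := by
  obtain ⟨F, hF, hF'⟩ := exists_combOp_of_rows (S := S) (Y := Y)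
    (fun b => SymPow.rho S (X.sym (π b)) (Y.sym b) (e b) ∘L projL X (π b))
    (fun b => Submodule.subset_span ⟨⟨π b, e b⟩, rfl⟩)
  refine ⟨F, hF, fun b w => funext fun b' => ?_, fun a w ha => funext fun b' => ?_⟩
  · rw [hF', ContinuousLinearMap.comp_apply, projL_apply]
    by_cases h : b' = b
    · subst h
      rw [elemT_same, elemT_same, SymPow.rho_pure S _ _ _ (he b')]
    · rw [elemT_ne S _ h, elemT_ne S _ (hπ.ne h), map_zero]
  · rw [hF', ContinuousLinearMap.comp_apply, projL_apply, elemT_ne S _ (ha b'), map_zero]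
    rfl

/-! ### Operators defined on elementary tensors -/

variable (S)

/-- The functions of a labelling spanned by the relabelled elementary tensors. -/
def combFun (α : Type*) (Y : Shape) : Submodule ℝ ((α → V) → Hat S Y) :=
  Submodule.span ℝ (Set.range fun p : Σ b : Y.idx, (Y.vert b ≃ α) =>
    fun w => elemT S Y p.1 (w ∘ p.2))

variable {S}

/-- The extension lives on the unsymmetrized completed power, where renamed elementary tensors
depend continuously and linearly on the tensor; precomposing with `symLift` turns its components
into combinations of maps `rho`. -/
theorem exists_of_mem_combFun {ι : Type*} [Finite ι] {Y : Shape} (G : Subgroup (Equiv.Perm ι))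
    {g : (ι → V) → Hat S Y} (hg : g ∈ combFun S ι Y) :
    ∃ F : CPow S ι →L[ℝ] Hat S Y, (∀ v, F (CPow.pure S v) = g v) ∧
      ∀ b, projL Y b ∘L F ∘L SymPow.symLift S G ∈ Submodule.span ℝ
        (Set.range fun e : ι ≃ Y.vert b => SymPow.rho S G (Y.sym b) e) := by
  classical
  induction hg using Submodule.span_induction with
  | mem g hg =>
    obtain ⟨⟨b, e⟩, rfl⟩ := hg
    refine ⟨ContinuousLinearMap.single ℝ (fun b => SymPow S (Y.sym b)) b ∘L
      SymPow.mkL S (Y.sym b) ∘L CPow.reindex S e.symm, fun v => ?_, fun b' => ?_⟩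
    · simp only [ContinuousLinearMap.comp_apply, CPow.reindex_pure, SymPow.mkL_pure]
      simp only [elemT, ContinuousLinearMap.single_apply]
      rfl
    · by_cases h : b' = b
      · subst h
        refine Submodule.subset_span ⟨e.symm, ContinuousLinearMap.ext fun x => ?_⟩
        exact (Pi.single_eq_same (M := fun b => SymPow S (Y.sym b)) b' _).symm
      · convert Submodule.zero_mem _
        refine ContinuousLinearMap.ext fun x => ?_
        exact Pi.single_eq_of_ne (M := fun b => SymPow S (Y.sym b)) h _
  | zero =>
    refine ⟨0, fun _ => rfl, fun b => ?_⟩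
    rw [ContinuousLinearMap.zero_comp, ContinuousLinearMap.comp_zero]
    exact Submodule.zero_mem _
  | add g g' _ _ hg hg' =>
    obtain ⟨F, h1, h2⟩ := hg
    obtain ⟨F', h1', h2'⟩ := hg'
    refine ⟨F + F', fun v => ?_, fun b => ?_⟩
    · rw [add_apply, h1, h1']
      rfl
    · rw [ContinuousLinearMap.add_comp, ContinuousLinearMap.comp_add]
      exact Submodule.add_mem _ (h2 b) (h2' b)
  | smul c g _ hg =>
    obtain ⟨F, h1, h2⟩ := hg
    refine ⟨c • F, fun v => ?_, fun b => ?_⟩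
    · rw [smul_apply, h1]
      rfl
    · rw [ContinuousLinearMap.smul_comp, ContinuousLinearMap.comp_smul]
      exact Submodule.smul_mem _ _ (h2 b)

/-- A function on elementary tensors that respects symmetries and is a combination of
relabellings in each component extends to a continuous linear operator. -/
theorem exists_combOp {X Y : Shape} (hX : ∀ n, {a : X.idx | Nat.card (X.vert a) = n}.Finite)
    (g : ∀ a, (X.vert a → V) → Hat S Y) (hg : ∀ a, g a ∈ combFun S (X.vert a) Y)
    (hsym : ∀ a w, ∀ σ ∈ X.sym a, g a (w ∘ σ) = g a w) :
    ∃ F ∈ combOp S X Y, ∀ a w, F (elemT S X a w) = g a w := by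
  choose H h1 h2 using fun a => exists_of_mem_combFun (X.sym a) (hg a)
  -- Component `b` collects only sources with as many vertices as `b`. By `hX` there are finitely
  -- many of them, so the row is a finite sum.
  obtain ⟨F, hF, hF'⟩ := exists_combOp_of_rows (S := S) (X := X) (Y := Y)
    (fun b => ∑ a ∈ (hX (Nat.card (Y.vert b))).toFinset,
      (projL Y b ∘L H a ∘L SymPow.symLift S (X.sym a)) ∘L projL X a)
    (fun b => Submodule.sum_mem _ fun a _ => by
      have h := h2 a b
      generalize projL Y b ∘L H a ∘L SymPow.symLift S (X.sym a) = R at h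
      induction h using Submodule.span_induction with
      | mem R hR =>
        obtain ⟨e', rfl⟩ := hR
        exact Submodule.subset_span ⟨⟨a, e'⟩, rfl⟩
      | zero => rw [ContinuousLinearMap.zero_comp]; exact Submodule.zero_mem _
      | add F G _ _ hF hG => rw [ContinuousLinearMap.add_comp]; exact Submodule.add_mem _ hF hG
      | smul c F _ hF => rw [ContinuousLinearMap.smul_comp]; exact Submodule.smul_mem _ _ hF)
  -- The symmetry of `g` makes the average over `X.sym a` harmless.
  have hval : ∀ a w, H a (SymPow.symLift S (X.sym a) (SymPow.pure S (X.sym a) w)) = g a w := by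
    intro a w
    rw [SymPow.symLift_average S _ (H a) w fun σ hσ => by rw [h1, h1, hsym a w σ hσ], h1]
  refine ⟨F, hF, fun a w => funext fun b => ?_⟩
  rw [hF', sum_apply]
  by_cases hab : Nat.card (X.vert a) = Nat.card (Y.vert b)
  · rw [Finset.sum_eq_single a]
    · simp only [ContinuousLinearMap.comp_apply, projL_apply]
      rw [elemT_same, hval]
    · intro a' _ ha'
      rw [ContinuousLinearMap.comp_apply, projL_apply, elemT_ne S X ha', map_zero]
    · intro ha
      exact absurd (by simpa using hab) ha
  · rw [Finset.sum_eq_zero]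
    · rw [← hval]
      have h := h2 a b
      -- With different numbers of vertices there is no renaming at all, so the span is zero and `g
      -- a w` has no component at `b`.
      have he : (Set.range fun e : X.vert a ≃ Y.vert b => SymPow.rho S (X.sym a) (Y.sym b) e) = ∅ :=
        Set.range_eq_empty_iff.2 ⟨fun e => hab (Nat.card_congr e)⟩
      rw [he, Submodule.span_empty, Submodule.mem_bot] at h
      exact (DFunLike.congr_fun h (SymPow.pure S (X.sym a) w)).symm
    · intro a' ha'
      have : a' ≠ a := by
        rintro rfl
        exact hab (by simpa using ha')
      rw [ContinuousLinearMap.comp_apply, projL_apply, elemT_ne S X this, map_zero]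

end Operators

/-! ## Partial forests -/

/-- A forest structure on a subset of `α`, encoded as a relation on `α`; the subset consists of
the `x` with `r x x`. -/
@[ext]
structure PForest (α : Type) where
  r : α → α → Prop
  left : ∀ x y, r x y → r x x
  right : ∀ x y, r x y → r y y
  trans : ∀ x y z, r x y → r y z → r x z
  antisymm : ∀ x y, r x y → r y x → x = y
  comparable : ∀ x y z, r x z → r y z → r x y ∨ r y x

namespace PForest

variable {α β : Type}

instance [Finite α] : Finite (PForest α) :=
  Finite.of_injective (fun P : PForest α => P.r) fun _ _ => PForest.ext

instance [Finite α] : Fintype (PForest α) := Fintype.ofFinite _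

/-- The underlying set of a partial forest. -/
def Pt (P : PForest α) : Type := {x : α // P.r x x}

instance (P : PForest α) [Finite α] : Finite P.Pt := inferInstanceAs (Finite {x : α // P.r x x})

instance (P : PForest α) : PartialOrder P.Pt where
  le x y := P.r x.1 y.1
  le_refl x := x.2
  le_trans x y z := P.trans x.1 y.1 z.1
  le_antisymm x y h h' := Subtype.ext (P.antisymm x.1 y.1 h h')

instance (P : PForest α) : IsForest P.Pt where
  chain v x hx y hy _ := by
    have hx' : x ≤ v := le_of_lt hx
    have hy' : y ≤ v := le_of_lt hy
    exact P.comparable x.1 y.1 v.1 hx' hy'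

/-- The image of a forest under an injection. -/
def image {ι : Type} [PartialOrder ι] [IsForest ι] (f : ι → α) (hf : Function.Injective f) :
    PForest α where
  r x y := ∃ a b, a ≤ b ∧ f a = x ∧ f b = y
  left := by
    rintro _ _ ⟨a, b, -, rfl, rfl⟩
    exact ⟨a, a, le_rfl, rfl, rfl⟩
  right := by
    rintro _ _ ⟨a, b, -, rfl, rfl⟩
    exact ⟨b, b, le_rfl, rfl, rfl⟩
  trans := by
    rintro _ _ _ ⟨a, b, h, rfl, rfl⟩ ⟨c, d, h', hc, rfl⟩
    obtain rfl := hf hc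
    exact ⟨a, d, h.trans h', rfl, rfl⟩
  antisymm := by
    rintro _ _ ⟨a, b, h, rfl, rfl⟩ ⟨c, d, h', hc, hd⟩
    obtain rfl := hf hc
    obtain rfl := hf hd
    rw [le_antisymm h h']
  comparable := by
    rintro _ _ _ ⟨a, b, h, rfl, rfl⟩ ⟨c, d, h', rfl, hd⟩
    obtain rfl := hf hd
    rcases IsForest.comparable h h' with h | h
    · exact Or.inl ⟨a, c, h, rfl, rfl⟩
    · exact Or.inr ⟨c, a, h, rfl, rfl⟩

theorem image_r {ι : Type} [PartialOrder ι] [IsForest ι] {f : ι → α} (hf : Function.Injective f)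
    (a b : ι) : (image f hf).r (f a) (f b) ↔ a ≤ b := by
  constructor
  · rintro ⟨a', b', h, ha, hb⟩
    rwa [← hf ha, ← hf hb]
  · exact fun h => ⟨a, b, h, rfl, rfl⟩

theorem image_r_self {ι : Type} [PartialOrder ι] [IsForest ι] {f : ι → α}
    (hf : Function.Injective f) (x : α) : (image f hf).r x x ↔ x ∈ Set.range f := by
  constructor
  · rintro ⟨a, _, _, rfl, _⟩
    exact ⟨a, rfl⟩
  · rintro ⟨a, rfl⟩
    exact ⟨a, a, le_rfl, rfl, rfl⟩

/-- The image of a partial forest under an injection. -/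
def map (f : α → β) (hf : Function.Injective f) (P : PForest α) : PForest β where
  r x y := ∃ a b, P.r a b ∧ f a = x ∧ f b = y
  left := by
    rintro _ _ ⟨a, b, h, rfl, rfl⟩
    exact ⟨a, a, P.left _ _ h, rfl, rfl⟩
  right := by
    rintro _ _ ⟨a, b, h, rfl, rfl⟩
    exact ⟨b, b, P.right _ _ h, rfl, rfl⟩
  trans := by
    rintro _ _ _ ⟨a, b, h, rfl, rfl⟩ ⟨c, d, h', hc, rfl⟩
    obtain rfl := hf hc
    exact ⟨a, d, P.trans _ _ _ h h', rfl, rfl⟩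
  antisymm := by
    rintro _ _ ⟨a, b, h, rfl, rfl⟩ ⟨c, d, h', hc, hd⟩
    obtain rfl := hf hc
    obtain rfl := hf hd
    rw [P.antisymm _ _ h h']
  comparable := by
    rintro _ _ _ ⟨a, b, h, rfl, rfl⟩ ⟨c, d, h', rfl, hd⟩
    obtain rfl := hf hd
    rcases P.comparable _ _ _ h h' with h | h
    · exact Or.inl ⟨a, c, h, rfl, rfl⟩
    · exact Or.inr ⟨c, a, h, rfl, rfl⟩

theorem map_r {f : α → β} (hf : Function.Injective f) (P : PForest α) (a b : α) :
    (P.map f hf).r (f a) (f b) ↔ P.r a b := by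
  constructor
  · rintro ⟨a', b', h, ha, hb⟩
    rwa [← hf ha, ← hf hb]
  · exact fun h => ⟨a, b, h, rfl, rfl⟩

theorem map_injective {f : α → β} (hf : Function.Injective f) :
    Function.Injective (map f hf) := by
  intro P Q h
  ext x y
  rw [← map_r hf P, h, map_r]

theorem map_image {ι : Type} [PartialOrder ι] [IsForest ι] {f : ι → α} (hf : Function.Injective f)
    {g : α → β} (hg : Function.Injective g) :
    (image f hf).map g hg = image (g ∘ f) (hg.comp hf) := by
  ext x y
  constructor
  · rintro ⟨_, _, ⟨a, b, h, rfl, rfl⟩, rfl, rfl⟩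
    exact ⟨a, b, h, rfl, rfl⟩
  · rintro ⟨a, b, h, rfl, rfl⟩
    exact ⟨_, _, ⟨a, b, h, rfl, rfl⟩, rfl, rfl⟩

/-- The preimage of a partial forest under an injection. -/
def comap (f : α → β) (hf : Function.Injective f) (P : PForest β) : PForest α where
  r x y := P.r (f x) (f y)
  left _ _ := P.left _ _
  right _ _ := P.right _ _
  trans _ _ _ := P.trans _ _ _
  antisymm _ _ h h' := hf (P.antisymm _ _ h h')
  comparable _ _ _ := P.comparable _ _ _

theorem map_comap {f : α → β} (hf : Function.Injective f) {P : PForest β}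
    (h : ∀ x, P.r x x → x ∈ Set.range f) : (P.comap f hf).map f hf = P := by
  ext x y
  constructor
  · rintro ⟨a, b, h, rfl, rfl⟩
    exact h
  · intro hxy
    obtain ⟨a, rfl⟩ := h x (P.left _ _ hxy)
    obtain ⟨b, rfl⟩ := h y (P.right _ _ hxy)
    exact ⟨a, b, hxy, rfl, rfl⟩

/-- The induced forest on a subset. -/
def restrict (P : PForest α) (s : Set α) : PForest α where
  r x y := P.r x y ∧ x ∈ s ∧ y ∈ s
  left _ _ h := ⟨P.left _ _ h.1, h.2.1, h.2.1⟩
  right _ _ h := ⟨P.right _ _ h.1, h.2.2, h.2.2⟩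
  trans _ _ _ h h' := ⟨P.trans _ _ _ h.1 h'.1, h.2.1, h'.2.2⟩
  antisymm _ _ h h' := P.antisymm _ _ h.1 h'.1
  comparable _ _ _ h h' := (P.comparable _ _ _ h.1 h'.1).imp (fun k => ⟨k, h.2.1, h'.2.1⟩)
    (fun k => ⟨k, h'.2.1, h.2.1⟩)

/-- The union of two disjoint partial forests. -/
def union (P Q : PForest α) (h : ∀ x, P.r x x → ¬ Q.r x x) : PForest α where
  r x y := P.r x y ∨ Q.r x y
  left _ _ := Or.imp (P.left _ _) (Q.left _ _)
  right _ _ := Or.imp (P.right _ _) (Q.right _ _)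
  trans x y z := by
    rintro (h1 | h1) (h2 | h2)
    · exact Or.inl (P.trans _ _ _ h1 h2)
    · exact absurd (Q.left _ _ h2) (h _ (P.right _ _ h1))
    · exact absurd (Q.right _ _ h1) (h _ (P.left _ _ h2))
    · exact Or.inr (Q.trans _ _ _ h1 h2)
  antisymm x y := by
    rintro (h1 | h1) (h2 | h2)
    · exact P.antisymm _ _ h1 h2
    · exact absurd (Q.left _ _ h2) (h _ (P.right _ _ h1))
    · exact absurd (Q.right _ _ h1) (h _ (P.left _ _ h2))
    · exact Q.antisymm _ _ h1 h2
  comparable x y z := by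
    rintro (h1 | h1) (h2 | h2)
    · exact (P.comparable _ _ _ h1 h2).imp Or.inl Or.inl
    · exact absurd (Q.right _ _ h2) (h _ (P.right _ _ h1))
    · exact absurd (Q.right _ _ h1) (h _ (P.right _ _ h2))
    · exact (Q.comparable _ _ _ h1 h2).imp Or.inr Or.inr

/-- The partial forest without vertices. -/
def empty : PForest α := ⟨fun _ _ => False, by simp, by simp, by simp, by simp, by simp⟩

theorem eq_empty {P : PForest α} (h : ∀ x, ¬ P.r x x) : P = empty := by
  ext x y
  exact ⟨fun hxy => h x (P.left _ _ hxy), False.elim⟩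

end PForest

/-! ### Cuts and disjoint unions -/

/-- A ternary relation between partial forests. -/
def ForestRel : Type 1 := ∀ α : Type, PForest α → PForest α → PForest α → Prop

/-- `T` is made of its upper set `P` and the complementary lower set `Q`. -/
def Cut : ForestRel := fun _ P Q T =>
  (∀ x, T.r x x ↔ P.r x x ∨ Q.r x x) ∧ (∀ x, P.r x x → ¬ Q.r x x) ∧
  (∀ x y, P.r x y ↔ T.r x y ∧ P.r x x ∧ P.r y y) ∧
  (∀ x y, Q.r x y ↔ T.r x y ∧ Q.r x x ∧ Q.r y y) ∧ ∀ x y, T.r x y → P.r x x → P.r y y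

/-- `T` is the disjoint union of `P` and `Q`. -/
def DisjUnion : ForestRel := fun _ P Q T =>
  (∀ x, P.r x x → ¬ Q.r x x) ∧ ∀ x y, T.r x y ↔ P.r x y ∨ Q.r x y

/-- What is needed of a ternary relation for its structure constants to define an associative
product and a coassociative coproduct. -/
structure ForestRel.Good (C : ForestRel) : Prop where
  supp : ∀ {α : Type} {P Q T : PForest α}, C α P Q T → ∀ x, T.r x x ↔ P.r x x ∨ Q.r x x
  disj : ∀ {α : Type} {P Q T : PForest α}, C α P Q T → ∀ x, P.r x x → ¬ Q.r x x
  map_iff : ∀ {α β : Type} (f : α → β) (hf : Function.Injective f) (P Q T : PForest α),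
    C β (P.map f hf) (Q.map f hf) (T.map f hf) ↔ C α P Q T
  empty_left : ∀ {α : Type} (P T : PForest α), C α .empty P T ↔ P = T
  empty_right : ∀ {α : Type} (P T : PForest α), C α P .empty T ↔ P = T
  assoc : ∀ {α : Type} (P Q R T : PForest α),
    (∃ T', C α P Q T' ∧ C α T' R T) ↔ ∃ T', C α Q R T' ∧ C α P T' T
  unique_left : ∀ {α : Type} (P Q R T T' T'' : PForest α),
    C α P Q T' → C α T' R T → C α P Q T'' → C α T'' R T → T' = T''
  unique_right : ∀ {α : Type} (P Q R T T' T'' : PForest α),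
    C α Q R T' → C α P T' T → C α Q R T'' → C α P T'' T → T' = T''

theorem PForest.map_r_iff {α β : Type} {f : α → β} (hf : Function.Injective f)
    (P : PForest α) (x y : β) : (P.map f hf).r x y ↔ ∃ a b, P.r a b ∧ f a = x ∧ f b = y := Iff.rfl

/-- Each part of a cut carries the order induced from `T`, so it is determined by its support. -/
theorem cut_left_unique {α : Type} {P P' Q R T : PForest α} (h : Cut α P Q T)
    (h' : Cut α P' R T) (hp : ∀ x, P.r x x ↔ P'.r x x) : P = P' := by
  ext x y
  rw [h.2.2.1, h'.2.2.1, hp, hp]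

theorem cut_right_unique {α : Type} {P P' Q R T : PForest α} (h : Cut α P Q T)
    (h' : Cut α P' R T) (hp : ∀ x, Q.r x x ↔ R.r x x) : Q = R := by
  ext x y
  rw [h.2.2.2.1, h'.2.2.2.1, hp, hp]

/-- For associativity both sides say that `T` is layered into an upper part `P`, a middle part `Q`
and a lower part `R`. The intermediate forest is the restriction of `T` to two adjacent layers,
which also gives its uniqueness. -/
theorem cut_good : ForestRel.Good Cut where
  supp h := h.1
  disj h := h.2.1
  map_iff f hf P Q T := by
    constructor
    · rintro ⟨h1, h2, h3, h4, h5⟩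
      refine ⟨fun x => ?_, fun x => ?_, fun x y => ?_, fun x y => ?_, fun x y => ?_⟩
      · simpa only [PForest.map_r] using h1 (f x)
      · simpa only [PForest.map_r] using h2 (f x)
      · simpa only [PForest.map_r] using h3 (f x) (f y)
      · simpa only [PForest.map_r] using h4 (f x) (f y)
      · simpa only [PForest.map_r] using h5 (f x) (f y)
    · rintro ⟨h1, h2, h3, h4, h5⟩
      simp only [Cut, PForest.map_r_iff]
      refine ⟨?_, ?_, ?_, ?_, ?_⟩ <;> grind [Function.Injective]
  empty_left P T := by
    constructor
    · rintro ⟨h1, -, -, h4, -⟩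
      ext x y
      have hx := h1 x
      have hy := h1 y
      have := T.left x y
      have := T.right x y
      have := h4 x y
      simp only [PForest.empty] at *
      tauto
    · rintro rfl
      have := P.left
      have := P.right
      simp only [Cut, PForest.empty]
      refine ⟨?_, ?_, ?_, ?_, ?_⟩ <;> grind
  empty_right P T := by
    constructor
    · rintro ⟨h1, -, h4, -, -⟩
      ext x y
      have hx := h1 x
      have hy := h1 y
      have := T.left x y
      have := T.right x y
      have := h4 x y
      simp only [PForest.empty] at *
      tauto
    · rintro rfl
      have := P.left
      have := P.right
      simp only [Cut, PForest.empty]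
      refine ⟨?_, ?_, ?_, ?_, ?_⟩ <;> grind
  assoc P Q R T := by
    have := T.left
    have := T.right
    constructor
    · rintro ⟨T', h, h'⟩
      -- The two lower layers, with the order induced from `T`.
      refine ⟨T.restrict {x | Q.r x x ∨ R.r x x}, ?_⟩
      simp only [Cut, PForest.restrict, Set.mem_ofPred_eq] at *
      refine ⟨⟨?_, ?_, ?_, ?_, ?_⟩, ?_, ?_, ?_, ?_, ?_⟩ <;> grind
    · rintro ⟨T', h, h'⟩
      refine ⟨T.restrict {x | P.r x x ∨ Q.r x x}, ?_⟩
      simp only [Cut, PForest.restrict, Set.mem_ofPred_eq] at *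
      refine ⟨⟨?_, ?_, ?_, ?_, ?_⟩, ?_, ?_, ?_, ?_, ?_⟩ <;> grind
  unique_left P Q R T T' T'' h1 h2 h3 h4 := by
    refine cut_left_unique h2 h4 fun x => ?_
    rw [h1.1, h3.1]
  unique_right P Q R T T' T'' h1 h2 h3 h4 := by
    refine cut_right_unique h2 h4 fun x => ?_
    rw [h1.1, h3.1]

/-- A disjoint union is determined by its parts, and the intermediate forest in the associativity
law is the union of two of the three. -/
theorem union_good : ForestRel.Good DisjUnion where
  supp h x := h.2 x x
  disj h := h.1
  map_iff f hf P Q T := by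
    constructor
    · rintro ⟨h1, h2⟩
      refine ⟨fun x => ?_, fun x y => ?_⟩
      · simpa only [PForest.map_r] using h1 (f x)
      · simpa only [PForest.map_r] using h2 (f x) (f y)
    · rintro ⟨h1, h2⟩
      simp only [DisjUnion, PForest.map_r_iff]
      refine ⟨?_, ?_⟩ <;> grind [Function.Injective]
  empty_left P T := by
    simp only [DisjUnion, PForest.empty, PForest.ext_iff, funext_iff]
    grind
  empty_right P T := by
    simp only [DisjUnion, PForest.empty, PForest.ext_iff, funext_iff]
    grind
  assoc P Q R T := by
    constructor
    · rintro ⟨T', ⟨h1, h2⟩, h1', h2'⟩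
      have h : ∀ x, Q.r x x → ¬ R.r x x := by grind
      refine ⟨Q.union R h, ⟨h, fun _ _ => Iff.rfl⟩, ?_⟩
      simp only [DisjUnion, PForest.union]
      refine ⟨?_, ?_⟩ <;> grind
    · rintro ⟨T', ⟨h1, h2⟩, h1', h2'⟩
      have h : ∀ x, P.r x x → ¬ Q.r x x := by grind
      refine ⟨P.union Q h, ⟨h, fun _ _ => Iff.rfl⟩, ?_⟩
      simp only [DisjUnion, PForest.union]
      refine ⟨?_, ?_⟩ <;> grind
  unique_left P Q R T T' T'' h1 _ h3 _ := by
    ext x y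
    rw [h1.2, h3.2]
  unique_right P Q R T T' T'' h1 _ h3 _ := by
    ext x y
    rw [h1.2, h3.2]

/-- Compatibility of cuts with disjoint unions. -/
theorem union_cut_iff {α : Type} (X Y Z W : PForest α) (hXY : ∀ x, X.r x x → ¬ Y.r x x) :
    (∃ T, DisjUnion α X Y T ∧ Cut α Z W T) ↔
      ∃ X₁ X₂ Y₁ Y₂, Cut α X₁ X₂ X ∧ Cut α Y₁ Y₂ Y ∧ DisjUnion α X₁ Y₁ Z ∧ DisjUnion α X₂ Y₂ W := by
  have hXl := X.left
  have hXr := X.right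
  have hYl := Y.left
  have hYr := Y.right
  constructor
  · rintro ⟨T, h, h'⟩
    -- The four parts are the intersections of `X` and `Y` with `Z` and `W`. No relation of `T`
    -- joins `X` to `Y`, so `Z` is an upper set of `T` exactly when it is one in each of them.
    refine ⟨X.restrict {x | Z.r x x}, X.restrict {x | W.r x x}, Y.restrict {x | Z.r x x},
      Y.restrict {x | W.r x x}, ?_⟩
    simp only [Cut, DisjUnion, PForest.restrict, Set.mem_ofPred_eq] at *
    refine ⟨⟨?_, ?_, ?_, ?_, ?_⟩, ⟨?_, ?_, ?_, ?_, ?_⟩, ⟨?_, ?_⟩, ?_, ?_⟩ <;> grind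
  · rintro ⟨X₁, X₂, Y₁, Y₂, h1, h2, h3, h4⟩
    refine ⟨X.union Y hXY, ⟨hXY, fun _ _ => Iff.rfl⟩, ?_⟩
    simp only [Cut, DisjUnion, PForest.union] at *
    refine ⟨?_, ?_, ?_, ?_, ?_⟩ <;> grind

/-- The supports of the four parts are forced to be the pairwise intersections; with
`cut_left_unique` and `cut_right_unique` this determines the parts themselves. -/
theorem union_cut_supp {α : Type} {X Y Z W X₁ X₂ Y₁ Y₂ : PForest α}
    (hXY : ∀ x, X.r x x → ¬ Y.r x x) (h1 : Cut α X₁ X₂ X) (h2 : Cut α Y₁ Y₂ Y)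
    (h3 : DisjUnion α X₁ Y₁ Z) (h4 : DisjUnion α X₂ Y₂ W) (x : α) :
    (X₁.r x x ↔ X.r x x ∧ Z.r x x) ∧ (X₂.r x x ↔ X.r x x ∧ W.r x x) ∧
      (Y₁.r x x ↔ Y.r x x ∧ Z.r x x) ∧ (Y₂.r x x ↔ Y.r x x ∧ W.r x x) := by
  have h1x := h1.1 x
  have h2x := h2.1 x
  have h3x := h3.2 x x
  have h4x := h4.2 x x
  have hx := hXY x
  clear h1 h2 h3 h4 hXY
  grind

theorem union_cut_unique {α : Type} {X Y Z W X₁ X₂ Y₁ Y₂ X₁' X₂' Y₁' Y₂' : PForest α}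
    (hXY : ∀ x, X.r x x → ¬ Y.r x x)
    (h1 : Cut α X₁ X₂ X) (h2 : Cut α Y₁ Y₂ Y) (h3 : DisjUnion α X₁ Y₁ Z)
    (h4 : DisjUnion α X₂ Y₂ W) (h1' : Cut α X₁' X₂' X) (h2' : Cut α Y₁' Y₂' Y)
    (h3' : DisjUnion α X₁' Y₁' Z) (h4' : DisjUnion α X₂' Y₂' W) :
    X₁ = X₁' ∧ X₂ = X₂' ∧ Y₁ = Y₁' ∧ Y₂ = Y₂' := by
  have k := union_cut_supp hXY h1 h2 h3 h4
  have k' := union_cut_supp hXY h1' h2' h3' h4'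
  exact ⟨cut_left_unique h1 h1' fun x => (k x).1.trans (k' x).1.symm,
    cut_right_unique h1 h1' fun x => (k x).2.1.trans (k' x).2.1.symm,
    cut_left_unique h2 h2' fun x => (k x).2.2.1.trans (k' x).2.2.1.symm,
    cut_right_unique h2 h2' fun x => (k x).2.2.2.trans (k' x).2.2.2.symm⟩

/-- In the Grossman-Larson reading `Z` and `W` are the given factors, and the disjointness of `X`
and `Y` has to be recovered from theirs. -/
theorem union_cut_disj {α : Type} {X Y Z W X₁ X₂ Y₁ Y₂ : PForest α}
    (hZW : ∀ x, Z.r x x → ¬ W.r x x)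
    (h1 : Cut α X₁ X₂ X) (h2 : Cut α Y₁ Y₂ Y) (h3 : DisjUnion α X₁ Y₁ Z) (h4 : DisjUnion α X₂ Y₂ W) :
    ∀ x, X.r x x → ¬ Y.r x x := by
  intro x
  have h1x := h1.1 x
  have h2x := h2.1 x
  have h3x := h3.2 x x
  have h4x := h4.2 x x
  have h3d := h3.1 x
  have h4d := h4.1 x
  have hx := hZW x
  clear h1 h2 h3 h4 hZW
  grind

/-! ## Labelled partial forests -/

theorem RTree.eq_of_iso {t u : RTree} (e : t.Vertex ≃o u.Vertex) : t = u := by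
  rw [← Quotient.out_eq t, ← Quotient.out_eq u]
  exact Quotient.sound ⟨e⟩

/-- Every such tree is the class of an order on `Fin n`, and there are finitely many of these. -/
theorem finite_setOf_card_treeShape (n : ℕ) :
    {t : treeShape.idx | Nat.card (treeShape.vert t) = n}.Finite := by
  have : Finite (PartialOrder (Fin n)) :=
    Finite.of_injective (fun o : PartialOrder (Fin n) => o.le) fun o o' h =>
      PartialOrder.ext fun x y => iff_of_eq (congrFun (congrFun h x) y)
  refine (Set.finite_range fun o : {o : PartialOrder (Fin n) // @IsForest (Fin n) o} =>
    (Quotient.mk TreeRep.setoid ⟨n, o.1, o.2⟩ : RTree)).subset ?_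
  intro t ht
  have hd : (Quotient.out t).deg = n := by
    rw [← ht]
    exact (Nat.card_fin _).symm
  generalize hT : Quotient.out t = T at hd
  obtain ⟨d, o, h⟩ := T
  dsimp only at hd
  subst hd
  refine ⟨⟨o, h⟩, ?_⟩
  dsimp only
  rw [← hT]
  exact Quotient.out_eq t

theorem finite_setOf_card_prod {X Y : Shape} (hX : ∀ n, {a : X.idx | Nat.card (X.vert a) = n}.Finite)
    (hY : ∀ n, {a : Y.idx | Nat.card (Y.vert a) = n}.Finite) (n : ℕ) :
    {a : (X.prod Y).idx | Nat.card ((X.prod Y).vert a) = n}.Finite := by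
  refine (((Set.finite_Iic n).biUnion fun i _ => hX i).prod
    ((Set.finite_Iic n).biUnion fun i _ => hY i)).subset ?_
  rintro ⟨a, b⟩ hab
  have h : Nat.card (X.vert a) + Nat.card (Y.vert b) = n := Nat.card_sum.symm.trans hab
  refine ⟨Set.mem_biUnion (x := Nat.card (X.vert a)) ?_ rfl,
    Set.mem_biUnion (x := Nat.card (Y.vert b)) ?_ rfl⟩
  · exact (Nat.le_add_right _ _).trans h.le
  · exact (Nat.le_add_left _ _).trans h.le

section Lab

variable {V : Type*} [AddCommGroup V] [Module ℝ V] [TopologicalSpace V] {I : Type*}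
variable (S : SymmetricCrossSeminorms V I)

theorem labelled_eq {ι : Type} [Finite ι] [PartialOrder ι] [IsForest ι] (v : ι → V) :
    labelled S v = elemT S treeShape (treeOf ι) (v ∘ (treeIso ι).symm) := rfl

/-- Isomorphic trees are equal as classes, so `e` becomes an automorphism of one tree, and such
automorphisms act trivially on the symmetrized power. -/
theorem elemT_comp_iso {t u : RTree} (e : t.Vertex ≃o u.Vertex) (w : u.Vertex → V) :
    elemT S treeShape t (w ∘ e) = elemT S treeShape u w := by
  obtain rfl := RTree.eq_of_iso e
  exact elemT_comp_perm S treeShape t (σ := e.toEquiv) (fun a b => e.le_iff_le) w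

/-- This is the independence of all choices: a labelled tree depends only on its isomorphism class.
-/
theorem labelled_comp_iso {ι κ : Type} [Finite ι] [PartialOrder ι] [IsForest ι]
    [Finite κ] [PartialOrder κ] [IsForest κ] (e : ι ≃o κ) (v : κ → V) :
    labelled S (v ∘ e) = labelled S v := by
  rw [labelled_eq, labelled_eq,
    ← elemT_comp_iso S (((treeIso ι).symm.trans e).trans (treeIso κ))]
  congr 1
  funext x
  simp

/-- The labelled tree given by a partial forest. -/
def lab {α : Type} [Finite α] (P : PForest α) (v : α → V) : HatTr S :=
  labelled S (ι := P.Pt) fun x => v x.1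

/-- It moves a tree into an ambient vertex set, so that all trees occurring in an identity share the
labelling `v` and only orders on subsets are compared. -/
theorem labelled_eq_lab {ι α : Type} [Finite ι] [PartialOrder ι] [IsForest ι] [Finite α]
    (f : ι → α) (hf : Function.Injective f) (v : α → V) :
    labelled S (fun x => v (f x)) = lab S (PForest.image f hf) v := by
  let g : ι → (PForest.image f hf).Pt := fun a => ⟨f a, a, a, le_rfl, rfl, rfl⟩
  have hg : Function.Bijective g := by
    refine ⟨fun a b h => hf (congrArg Subtype.val h), ?_⟩
    rintro ⟨x, hx⟩
    obtain ⟨a, rfl⟩ := (PForest.image_r_self hf x).1 hx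
    exact ⟨a, rfl⟩
  let e : ι ≃o (PForest.image f hf).Pt :=
    { toEquiv := Equiv.ofBijective g hg
      map_rel_iff' := fun {a b} => PForest.image_r hf a b }
  exact labelled_comp_iso S e fun x => v x.1

theorem image_val {α : Type} (P : PForest α) :
    PForest.image (ι := P.Pt) (fun x => x.1) Subtype.val_injective = P := by
  ext x y
  constructor
  · rintro ⟨a, b, h, rfl, rfl⟩
    exact h
  · exact fun h => ⟨(⟨x, P.left _ _ h⟩ : P.Pt), (⟨y, P.right _ _ h⟩ : P.Pt), h, rfl, rfl⟩

theorem lab_comp {α β : Type} [Finite α] [Finite β] (f : α → β) (hf : Function.Injective f)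
    (P : PForest α) (v : β → V) : lab S P (fun x => v (f x)) = lab S (P.map f hf) v := by
  have h := PForest.map_image (ι := P.Pt) (f := fun x => x.1) Subtype.val_injective hf
  rw [image_val] at h
  rw [h]
  exact labelled_eq_lab S (ι := P.Pt) (fun x => f x.1) (hf.comp Subtype.val_injective) v

theorem elemT_eq_lab {α : Type} [Finite α] (t : RTree) (f : t.Vertex → α)
    (hf : Function.Injective f) (v : α → V) :
    elemT S treeShape t (fun x => v (f x)) = lab S (PForest.image f hf) v := by
  rw [← labelled_eq_lab, labelled_eq, ← elemT_comp_iso S (treeIso t.Vertex)]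
  congr 1
  funext x
  simp

/-- Every labelled partial forest is an elementary tensor, pulled back along an embedding. -/
theorem exists_image_eq {α : Type} [Finite α] (P : PForest α) :
    ∃ (t : RTree) (f : t.Vertex → α) (hf : Function.Injective f), PForest.image f hf = P := by
  have hf : Function.Injective fun x => ((treeIso P.Pt).symm x).1 :=
    Subtype.val_injective.comp (treeIso P.Pt).symm.injective
  refine ⟨treeOf P.Pt, _, hf, ?_⟩
  ext x y
  constructor
  · rintro ⟨a, b, h, rfl, rfl⟩
    exact (treeIso P.Pt).symm.le_iff_le.2 h
  · intro h
    refine ⟨treeIso P.Pt ⟨x, P.left _ _ h⟩, treeIso P.Pt ⟨y, P.right _ _ h⟩, ?_,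
      congrArg Subtype.val ((treeIso P.Pt).symm_apply_apply _),
      congrArg Subtype.val ((treeIso P.Pt).symm_apply_apply _)⟩
    exact (treeIso P.Pt).le_iff_le.2 h

/-- Full support means that every `v x` is used exactly once, so the labelled tree is a renaming of
the elementary tensor of `v`. -/
theorem lab_mem_combFun {α : Type} [Finite α] {P : PForest α} (hP : ∀ x, P.r x x) :
    lab S P ∈ combFun S α treeShape := by
  obtain ⟨t, f, hf, rfl⟩ := exists_image_eq P
  have hb : Function.Bijective f := ⟨hf, fun x => (PForest.image_r_self hf x).1 (hP x)⟩
  refine Submodule.subset_span ⟨⟨t, Equiv.ofBijective f hb⟩, funext fun v => ?_⟩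
  exact elemT_eq_lab S t f hf v

theorem tens_lab_eq {α : Type} [Finite α] (t s : RTree) (f : t.Vertex → α) (g : s.Vertex → α)
    (hf : Function.Injective f) (hg : Function.Injective g) (v : α → V) :
    tens (lab S (PForest.image f hf) v) (lab S (PForest.image g hg) v) =
      elemT S (treeShape.prod treeShape) (t, s) (fun x => v (Sum.elim f g x)) := by
  rw [← elemT_eq_lab, ← elemT_eq_lab, tens_elemT]
  congr 1
  funext x
  cases x <;> rfl

theorem sumElim_injective {α : Type} {t s : RTree} {f : t.Vertex → α} {g : s.Vertex → α}
    {hf : Function.Injective f} {hg : Function.Injective g}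
    (h : ∀ x, (PForest.image f hf).r x x → ¬ (PForest.image g hg).r x x) :
    Function.Injective (Sum.elim f g) := by
  refine hf.sumElim hg fun a b hab => ?_
  refine h (f a) ((PForest.image_r_self hf _).2 ⟨a, rfl⟩) ?_
  exact (PForest.image_r_self hg _).2 ⟨b, hab.symm⟩

theorem tens_lab_mem_combFun {α : Type} [Finite α] {P Q : PForest α}
    (h : ∀ x, P.r x x ∨ Q.r x x) (hd : ∀ x, P.r x x → ¬ Q.r x x) :
    (fun v => tens (lab S P v) (lab S Q v)) ∈ combFun S α (treeShape.prod treeShape) := by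
  obtain ⟨t, f, hf, rfl⟩ := exists_image_eq P
  obtain ⟨s, g, hg, rfl⟩ := exists_image_eq Q
  have hb : Function.Bijective (Sum.elim f g) := by
    refine ⟨sumElim_injective hd, fun x => ?_⟩
    rcases h x with h | h
    · obtain ⟨a, rfl⟩ := (PForest.image_r_self hf x).1 h
      exact ⟨Sum.inl a, rfl⟩
    · obtain ⟨a, rfl⟩ := (PForest.image_r_self hg x).1 h
      exact ⟨Sum.inr a, rfl⟩
  refine Submodule.subset_span ⟨⟨(t, s), Equiv.ofBijective _ hb⟩, funext fun v => ?_⟩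
  exact (tens_lab_eq S t s f g hf hg v).symm

/-! ### Products and coproducts from ternary relations -/

open Classical in
/-- The indicator of a proposition. -/
def ind (p : Prop) : ℝ := if p then 1 else 0

theorem ind_pos {p : Prop} (h : p) : ind p = 1 := if_pos h

theorem ind_neg {p : Prop} (h : ¬ p) : ind p = 0 := if_neg h

theorem ind_congr {p q : Prop} (h : p ↔ q) : ind p = ind q := by rw [propext h]

theorem ind_and (p q : Prop) : ind (p ∧ q) = ind p * ind q := by
  by_cases hp : p <;> by_cases hq : q <;> simp [ind, hp, hq]

-- It permits using a formula only for terms whose coefficient does not vanish.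
variable {S} in
theorem ind_smul_congr {M : Type*} [AddCommGroup M] [Module ℝ M] {p : Prop} {x y : M}
    (h : p → x = y) : ind p • x = ind p • y := by
  by_cases hp : p
  · rw [h hp]
  · rw [ind_neg hp, zero_smul, zero_smul]

/-- The sum of all `T` with `C P Q T`. -/
def prodSum (C : ForestRel) {α : Type} [Finite α] (P Q : PForest α) (v : α → V) : HatTr S :=
  ∑ T : PForest α, ind (C α P Q T) • lab S T v

/-- The sum of all `P ⊗ Q` with `C P Q T`. -/
def coprodSum (C : ForestRel) {α : Type} [Finite α] (T : PForest α) (v : α → V) :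
    Hat S (treeShape.prod treeShape) :=
  ∑ p : PForest α × PForest α, ind (C α p.1 p.2 T) • tens (lab S p.1 v) (lab S p.2 v)

variable {C : ForestRel} (hC : C.Good)
include hC

/-- A contributing `T` is supported on `P` and `Q`, hence inside the range of `f`, and is the image
of its own preimage; all other terms vanish. -/
theorem prodSum_comp {α β : Type} [Finite α] [Finite β] (f : α → β) (hf : Function.Injective f)
    (P Q : PForest α) (v : β → V) :
    prodSum S C P Q (fun x => v (f x)) = prodSum S C (P.map f hf) (Q.map f hf) v := by
  refine Finset.sum_of_injOn (PForest.map f hf) (PForest.map_injective hf).injOn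
    (fun _ _ => Finset.mem_coe.2 (Finset.mem_univ _)) ?_ ?_
  · intro T _ hT
    rw [ind_neg, zero_smul]
    intro h
    refine hT ⟨T.comap f hf, by simp, PForest.map_comap hf fun x hx => ?_⟩
    rcases (hC.supp h x).1 hx with ⟨a, _, _, rfl, _⟩ | ⟨a, _, _, rfl, _⟩ <;> exact ⟨a, rfl⟩
  · intro T _
    rw [hC.map_iff, lab_comp S f hf]

theorem coprodSum_comp {α β : Type} [Finite α] [Finite β] (f : α → β) (hf : Function.Injective f)
    (T : PForest α) (v : β → V) :
    coprodSum S C T (fun x => v (f x)) = coprodSum S C (T.map f hf) v := by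
  refine Finset.sum_of_injOn (Prod.map (PForest.map f hf) (PForest.map f hf))
    ((PForest.map_injective hf).prodMap (PForest.map_injective hf)).injOn
    (fun _ _ => Finset.mem_coe.2 (Finset.mem_univ _)) ?_ ?_
  · rintro ⟨P, Q⟩ _ hPQ
    rw [ind_neg, zero_smul]
    intro h
    refine hPQ ⟨(P.comap f hf, Q.comap f hf), by simp, Prod.ext (PForest.map_comap hf fun x hx => ?_)
      (PForest.map_comap hf fun x hx => ?_)⟩
    · obtain ⟨a, _, _, rfl, _⟩ := (hC.supp h x).2 (Or.inl hx)
      exact ⟨a, rfl⟩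
    · obtain ⟨a, _, _, rfl, _⟩ := (hC.supp h x).2 (Or.inr hx)
      exact ⟨a, rfl⟩
  · rintro ⟨P, Q⟩ _
    simp only [Prod.map, hC.map_iff, lab_comp S f hf]

/-- The product is prescribed on the disjoint union of the vertex sets of two trees. Since `prodSum`
is natural under injections, the formula passes to any two disjoint forests in a common set. -/
theorem exists_mul : ∃ F ∈ combOp S (treeShape.prod treeShape) treeShape,
    ∀ (α : Type) [Finite α] (P Q : PForest α) (v : α → V), (∀ x, P.r x x → ¬ Q.r x x) →
      F (tens (lab S P v) (lab S Q v)) = prodSum S C P Q v := by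
  obtain ⟨F, hF, hF'⟩ := exists_combOp (S := S) (X := treeShape.prod treeShape) (Y := treeShape)
    (finite_setOf_card_prod finite_setOf_card_treeShape finite_setOf_card_treeShape)
    (fun a => prodSum S C (PForest.image Sum.inl Sum.inl_injective)
      (PForest.image (Sum.inr : a.2.Vertex → a.1.Vertex ⊕ a.2.Vertex) Sum.inr_injective))
    (fun a => by
      have : prodSum S C (PForest.image Sum.inl Sum.inl_injective)
          (PForest.image (Sum.inr : a.2.Vertex → a.1.Vertex ⊕ a.2.Vertex) Sum.inr_injective) =
          ∑ T, ind (C _ (PForest.image Sum.inl Sum.inl_injective)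
          (PForest.image (Sum.inr : a.2.Vertex → a.1.Vertex ⊕ a.2.Vertex) Sum.inr_injective) T) •
          lab S T := by
        funext v
        simp [prodSum]
      rw [this]
      refine Submodule.sum_mem _ fun T _ => ?_
      by_cases h : C _ (PForest.image Sum.inl Sum.inl_injective)
        (PForest.image (Sum.inr : a.2.Vertex → a.1.Vertex ⊕ a.2.Vertex) Sum.inr_injective) T
      -- A contributing `T` contains the vertices of both trees, hence has full support.
      · refine Submodule.smul_mem _ _ (lab_mem_combFun S fun x => (hC.supp h x).2 ?_)
        rw [PForest.image_r_self, PForest.image_r_self]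
        cases x <;> simp
      · rw [ind_neg h, zero_smul]
        exact Submodule.zero_mem _)
    (by
      rintro ⟨t, s⟩ w σ ⟨⟨σ₁, σ₂⟩, ⟨h₁, h₂⟩, rfl⟩
      refine (prodSum_comp S hC _ (Equiv.injective _) _ _ _).trans ?_
      -- Composing an embedding with a tree automorphism does not change the image forest, so the
      -- prescription respects symmetries.
      have key : ∀ {u : RTree} {f g : u.Vertex → t.Vertex ⊕ s.Vertex} {hf : Function.Injective f}
          {hg : Function.Injective g} (τ : Equiv.Perm u.Vertex), τ ∈ u.SG → g = f ∘ τ →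
          PForest.image g hg = PForest.image f hf := by
        rintro u f _ hf hg τ hτ rfl
        ext x y
        constructor
        · rintro ⟨a, b, h, rfl, rfl⟩
          exact ⟨τ a, τ b, (hτ a b).2 h, rfl, rfl⟩
        · rintro ⟨a, b, h, rfl, rfl⟩
          refine ⟨τ.symm a, τ.symm b, (hτ _ _).1 ?_, by simp, by simp⟩
          simpa using h
      rw [PForest.map_image, PForest.map_image]
      exact congrArg₂ (fun P Q => prodSum S C P Q w) (key σ₁ h₁ rfl) (key σ₂ h₂ rfl))
  refine ⟨F, hF, fun α _ P Q v hPQ => ?_⟩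
  obtain ⟨t, f, hf, rfl⟩ := exists_image_eq P
  obtain ⟨s, g, hg, rfl⟩ := exists_image_eq Q
  -- Disjointness of the supports is what makes `Sum.elim f g` injective.
  rw [tens_lab_eq, hF', prodSum_comp S hC _ (sumElim_injective hPQ), PForest.map_image,
    PForest.map_image]
  rfl

theorem exists_comul : ∃ F ∈ combOp S treeShape (treeShape.prod treeShape),
    ∀ (α : Type) [Finite α] (T : PForest α) (v : α → V), F (lab S T v) = coprodSum S C T v := by
  obtain ⟨F, hF, hF'⟩ := exists_combOp (S := S) (X := treeShape) (Y := treeShape.prod treeShape)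
    finite_setOf_card_treeShape
    (fun t => coprodSum S C (PForest.image (id : t.Vertex → t.Vertex) Function.injective_id))
    (fun t => by
      have : coprodSum S C (PForest.image (id : t.Vertex → t.Vertex) Function.injective_id) =
          ∑ p : PForest t.Vertex × PForest t.Vertex, ind (C _ p.1 p.2
            (PForest.image (id : t.Vertex → t.Vertex) Function.injective_id)) •
          fun v => tens (lab S p.1 v) (lab S p.2 v) := by
        funext v
        simp [coprodSum]
      rw [this]
      refine Submodule.sum_mem _ fun p _ => ?_
      by_cases h : C _ p.1 p.2 (PForest.image (id : t.Vertex → t.Vertex) Function.injective_id)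
      · refine Submodule.smul_mem _ _ (tens_lab_mem_combFun S (fun x => (hC.supp h x).1 ?_)
          (hC.disj h))
        rw [PForest.image_r_self]
        simp
      · rw [ind_neg h, zero_smul]
        exact Submodule.zero_mem _)
    (by
      intro t w σ hσ
      refine (coprodSum_comp S hC _ (Equiv.injective _) _ _).trans ?_
      congr 1
      ext x y
      constructor
      · rintro ⟨_, _, ⟨a, b, h, rfl, rfl⟩, rfl, rfl⟩
        exact ⟨σ a, σ b, (hσ a b).2 h, rfl, rfl⟩
      · rintro ⟨a, b, h, rfl, rfl⟩
        refine ⟨_, _, ⟨σ.symm a, σ.symm b, (hσ _ _).1 ?_, rfl, rfl⟩, by simp, by simp⟩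
        simpa using h)
  refine ⟨F, hF, fun α _ T v => ?_⟩
  obtain ⟨t, f, hf, rfl⟩ := exists_image_eq T
  rw [← elemT_eq_lab, hF', coprodSum_comp S hC _ hf, PForest.map_image]
  rfl

end Lab

/-! ## Unit and counit -/

section Units

variable {V : Type*} [AddCommGroup V] [Module ℝ V] [TopologicalSpace V] {I : Type*}
variable (S : SymmetricCrossSeminorms V I)

/-- The empty tensor power is `ℝ`, and by `cross_zero` its seminorm is the absolute value, so the
identification is continuous and extends to the completion. -/
theorem exists_emptyPower_functional (ι : Type*) [Finite ι] [IsEmpty ι] :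
    ∃ F : CPow S ι →L[ℝ] ℝ, ∀ v, F (CPow.pure S v) = 1 := by
  let E : TPow S ι ≃ₗ[ℝ] ℝ := PiTensorProduct.isEmptyEquiv (R := ℝ) (s := fun _ : ι => V) ι
  have hE : ∀ v, E (TPow.pure S v) = 1 := PiTensorProduct.isEmptyEquiv_apply_tprod ι
  let L : TPow S ι →L[ℝ] ℝ :=
    { toLinearMap := E.toLinearMap
      cont := by
        refine (TPow.withSeminorms S ι).continuous_of_isBounded (norm_withSeminorms ℝ ℝ) _ ?_
        intro _
        -- There is only one family of indices on an empty set, hence only one seminorm to compare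
        -- with.
        refine ⟨{isEmptyElim}, 1, fun a => ?_⟩
        simp only [Finset.sup_singleton, one_smul]
        have ha : E a • TPow.pure S (isEmptyElim : ι → V) = a := by
          refine E.injective ?_
          rw [map_smul, hE, smul_eq_mul, mul_one]
        have h1 : TPow.family S ι isEmptyElim (TPow.pure S (isEmptyElim : ι → V)) = 1 := by
          refine (S.seminorm_eq (Equiv.equivOfIsEmpty ι (Fin 0)) _ _).trans ?_
          refine Eq.trans (congrArg _ (PiTensorProduct.reindex_tprod _ _)) ?_
          exact S.cross_zero _ _
        have h2 : TPow.family S ι isEmptyElim a = ‖E a‖ := by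
          rw [← ha, map_smul_eq_mul, h1, ha, mul_one]
        exact h2.ge }
  let e : TPow S ι →L[ℝ] CPow S ι :=
    { toFun := fun a => (a : CPow S ι)
      map_add' := UniformSpace.Completion.coe_add
      map_smul' := fun r a => UniformSpace.Completion.coe_smul r a
      cont := UniformSpace.Completion.continuous_coe _ }
  refine ⟨L.extend e, fun v => ?_⟩
  refine (L.extend_eq UniformSpace.Completion.denseRange_coe
    (UniformSpace.Completion.isUniformInducing_coe _) (TPow.pure S v)).trans (hE v)

theorem exists_unit (t : RTree) (w : t.Vertex → V) :
    ∃ F : ℝ →L[ℝ] HatTr S, ∀ c, F c = c • elemT S treeShape t w := by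
  classical
  refine ⟨⟨LinearMap.toSpanSingleton ℝ _ (elemT S treeShape t w), ?_⟩,
    fun c => LinearMap.toSpanSingleton_apply ℝ _ _ _⟩
  -- Continuity in the scalar is taken from the uncompleted power, where scalar multiplication is
  -- jointly continuous, and carried to the completion and to the quotient.
  have h0 : Continuous fun c : ℝ => c • TPow.pure S w := by fun_prop
  have h1 : Continuous fun c : ℝ => (↑(c • TPow.pure S w) : CPow S t.Vertex) :=
    (UniformSpace.Completion.continuous_coe _).comp h0
  have h2 : Continuous fun c : ℝ => c • elemT S treeShape t w := by
    refine continuous_pi fun s => ?_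
    by_cases hs : s = t
    · subst hs
      refine ((SymPow.mkL S s.SG).continuous.comp h1).congr fun c => ?_
      rw [Pi.smul_apply, elemT_same, ← SymPow.mkL_pure, ← map_smul]
      exact congrArg _ (UniformSpace.Completion.coe_smul c _)
    · refine continuous_const (y := 0) |>.congr fun c => ?_
      rw [Pi.smul_apply, elemT_ne S treeShape hs, smul_zero]
  exact h2

/-- The tree that consists of the root only. -/
def rootTree : RTree := treeOf PEmpty.{1}

instance : IsEmpty rootTree.Vertex := (treeIso PEmpty).symm.toEquiv.isEmpty

theorem eq_rootTree (t : RTree) [IsEmpty t.Vertex] : t = rootTree :=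
  RTree.eq_of_iso
    { toEquiv := Equiv.equivOfIsEmpty t.Vertex rootTree.Vertex
      map_rel_iff' := fun {a} => isEmptyElim a }

theorem image_eq_empty_iff {ι α : Type} [PartialOrder ι] [IsForest ι] {f : ι → α}
    (hf : Function.Injective f) : PForest.image f hf = .empty ↔ IsEmpty ι := by
  constructor
  · intro h
    refine ⟨fun a => ?_⟩
    have := (PForest.image_r hf a a).2 le_rfl
    rw [h] at this
    exact this
  · intro h
    refine PForest.eq_empty fun x hx => ?_
    obtain ⟨a, -⟩ := (PForest.image_r_self hf x).1 hx
    exact h.elim a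

theorem exists_counit : ∃ F : HatTr S →L[ℝ] ℝ, ∀ (α : Type) [Finite α] (P : PForest α) (v : α → V),
    F (lab S P v) = ind (P = .empty) := by
  obtain ⟨F, hF⟩ := exists_emptyPower_functional S rootTree.Vertex
  refine ⟨F ∘L SymPow.symLift S rootTree.SG ∘L projL treeShape rootTree, fun α _ P v => ?_⟩
  obtain ⟨t, f, hf, rfl⟩ := exists_image_eq P
  rw [← elemT_eq_lab, ind_congr (image_eq_empty_iff hf)]
  change F (SymPow.symLift S rootTree.SG (elemT S treeShape t (fun x => v (f x)) rootTree)) = _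
  by_cases ht : IsEmpty t.Vertex
  · obtain rfl := eq_rootTree t
    rw [elemT_same, ind_pos ht, SymPow.symLift_average, hF]
    intro σ _
    rw [hF, hF]
  · have hne : rootTree ≠ t := by
      rintro rfl
      exact ht inferInstance
    rw [elemT_ne S treeShape hne, ind_neg ht, map_zero, map_zero]

end Units

/-! ## Operations given by ternary relations -/

section Ops

variable {V : Type*} [AddCommGroup V] [Module ℝ V] [TopologicalSpace V] {I : Type*}
variable {S : SymmetricCrossSeminorms V I}

theorem HatTr.ext_lab {Z : Type*} [AddCommGroup Z] [Module ℝ Z] [TopologicalSpace Z]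
    [T2Space Z] {f g : HatTr S →L[ℝ] Z}
    (h : ∀ (α : Type) [Finite α] (P : PForest α) (v : α → V), f (lab S P v) = g (lab S P v)) :
    f = g := by
  refine Hat.ext_elemT S fun t w => ?_
  have := elemT_eq_lab S t id Function.injective_id w
  change f (elemT S treeShape t fun x => w (id x)) = g (elemT S treeShape t fun x => w (id x))
  rw [this]
  exact h _ _ _

/-- The two trees can be placed on the disjoint union of their vertex sets. Hence it suffices to
know products of forests with disjoint supports. -/
theorem HatTr.ext_tens_lab {Z : Type*} [AddCommGroup Z] [Module ℝ Z] [TopologicalSpace Z]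
    [T2Space Z] {f g : Hat S (treeShape.prod treeShape) →L[ℝ] Z}
    (h : ∀ (α : Type) [Finite α] (P Q : PForest α) (v : α → V), (∀ x, P.r x x → ¬ Q.r x x) →
      f (tens (lab S P v) (lab S Q v)) = g (tens (lab S P v) (lab S Q v))) : f = g := by
  refine Hat.ext_elemT S ?_
  rintro ⟨t, s⟩ w
  have := tens_lab_eq S t s Sum.inl Sum.inr Sum.inl_injective Sum.inr_injective w
  rw [Sum.elim_inl_inr] at this
  change f (elemT S (treeShape.prod treeShape) (t, s) fun x => w x) =
    g (elemT S (treeShape.prod treeShape) (t, s) fun x => w x)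
  rw [show (fun x => w x) = fun x => w (id x) from rfl, ← this]
  refine h _ _ _ _ fun x => ?_
  rw [PForest.image_r_self, PForest.image_r_self]
  rintro ⟨a, rfl⟩ ⟨b, hb⟩
  cases hb

theorem HatTr.ext_tens_tens_lab {Z : Type*} [AddCommGroup Z] [Module ℝ Z] [TopologicalSpace Z]
    [T2Space Z] {f g : Hat S ((treeShape.prod treeShape).prod treeShape) →L[ℝ] Z}
    (h : ∀ (α : Type) [Finite α] (P Q R : PForest α) (v : α → V), (∀ x, P.r x x → ¬ Q.r x x) →
      (∀ x, P.r x x → ¬ R.r x x) → (∀ x, Q.r x x → ¬ R.r x x) →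
      f (tens (tens (lab S P v) (lab S Q v)) (lab S R v)) =
        g (tens (tens (lab S P v) (lab S Q v)) (lab S R v))) : f = g := by
  refine Hat.ext_tens S ?_
  rintro ⟨t, s⟩ w u w'
  have h1 := tens_lab_eq S t s (Sum.inl ∘ Sum.inl) (Sum.inl ∘ Sum.inr)
    (Sum.inl_injective.comp Sum.inl_injective)
    (Sum.inl_injective.comp Sum.inr_injective) (Sum.elim w w' : (t.Vertex ⊕ s.Vertex) ⊕ u.Vertex → V)
  have h2 := elemT_eq_lab S u (Sum.inr : _ → (t.Vertex ⊕ s.Vertex) ⊕ u.Vertex) Sum.inr_injective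
    (Sum.elim w w')
  have h3 : (fun x => (Sum.elim w w' : (t.Vertex ⊕ s.Vertex) ⊕ u.Vertex → V)
      (Sum.elim (Sum.inl ∘ Sum.inl) (Sum.inl ∘ Sum.inr) x)) = w := by
    funext x
    cases x <;> rfl
  rw [h3] at h1
  have h4 : (fun x => (Sum.elim w w' : (t.Vertex ⊕ s.Vertex) ⊕ u.Vertex → V) (Sum.inr x)) = w' := rfl
  rw [h4] at h2
  rw [← h1, h2]
  refine h _ _ _ _ _ ?_ ?_ ?_ <;>
  · intro x
    rw [PForest.image_r_self, PForest.image_r_self]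
    rintro ⟨a, rfl⟩ ⟨b, hb⟩
    simp at hb

/-- The operations whose structure constants are given by the ternary relation `M` for the product
and `D` for the coproduct. -/
structure IsForestOps (M D : ForestRel) (A : HopfOps S treeShape) : Prop where
  mul_mem : A.mul ∈ combOp S (treeShape.prod treeShape) treeShape
  comul_mem : A.comul ∈ combOp S treeShape (treeShape.prod treeShape)
  mul_lab : ∀ (α : Type) [Finite α] (P Q : PForest α) (v : α → V), (∀ x, P.r x x → ¬ Q.r x x) →
    A.mul (tens (lab S P v) (lab S Q v)) = prodSum S M P Q v
  comul_lab : ∀ (α : Type) [Finite α] (T : PForest α) (v : α → V),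
    A.comul (lab S T v) = coprodSum S D T v
  unit_apply : ∀ (c : ℝ) (α : Type) [Finite α] (v : α → V), A.unit c = c • lab S .empty v
  counit_lab : ∀ (α : Type) [Finite α] (P : PForest α) (v : α → V),
    A.counit (lab S P v) = ind (P = .empty)

variable (S) in
theorem exists_isForestOps {M D : ForestRel} (hM : M.Good) (hD : D.Good) :
    ∃ A : HopfOps S treeShape, IsForestOps M D A := by
  obtain ⟨m, hm, hm'⟩ := exists_mul S hM
  obtain ⟨d, hd, hd'⟩ := exists_comul S hD
  obtain ⟨u, hu⟩ := exists_unit S rootTree isEmptyElim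
  obtain ⟨ε, hε⟩ := exists_counit S
  refine ⟨⟨m, u, d, ε⟩, hm, hd, hm', hd', fun c α _ v => ?_, hε⟩
  refine (hu c).trans (congrArg _ ?_)
  have hf : Function.Injective (isEmptyElim : rootTree.Vertex → α) := fun x => isEmptyElim x
  rw [← (image_eq_empty_iff hf).2 inferInstance, ← elemT_eq_lab]
  congr 1
  funext x
  exact isEmptyElim x

end Ops

/-! ## The structural isomorphisms of completed tensor products -/

section Structural

variable {V : Type*} [AddCommGroup V] [Module ℝ V] [TopologicalSpace V] {I : Type*}
variable {S : SymmetricCrossSeminorms V I}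

theorem sumCongr_mem_prodPerm {ι κ : Type*} {G : Subgroup (Equiv.Perm ι)}
    {K : Subgroup (Equiv.Perm κ)} {σ : Equiv.Perm ι} {τ : Equiv.Perm κ} (hσ : σ ∈ G) (hτ : τ ∈ K) :
    Equiv.Perm.sumCongr σ τ ∈ prodPerm G K :=
  ⟨(σ, τ), ⟨hσ, hτ⟩, rfl⟩

/-- For fixed other arguments both sides are continuous linear in one argument, so the elementary
tensors are replaced by arbitrary elements one slot at a time. -/
theorem isAssociator_of_elemT {X Y Z : Shape}
    {F : Hat S ((X.prod Y).prod Z) →L[ℝ] Hat S (X.prod (Y.prod Z))}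
    (h : ∀ a u b v c w, F (tens (tens (elemT S X a u) (elemT S Y b v)) (elemT S Z c w)) =
      tens (elemT S X a u) (tens (elemT S Y b v) (elemT S Z c w))) : IsAssociator F := by
  have h1 : ∀ a u b v z, F (tens (tens (elemT S X a u) (elemT S Y b v)) z) =
      tens (elemT S X a u) (tens (elemT S Y b v) z) := fun a u b v z =>
    DFunLike.congr_fun (Hat.ext_elemT S (f := F ∘L tensLeft S (tens (elemT S X a u) (elemT S Y b v)))
      (g := tensLeft S (elemT S X a u) ∘L tensLeft S (elemT S Y b v)) fun c w => h a u b v c w) z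
  have h2 : ∀ a u y z, F (tens (tens (elemT S X a u) y) z) =
      tens (elemT S X a u) (tens y z) := fun a u y z =>
    DFunLike.congr_fun (Hat.ext_elemT S (f := F ∘L tensRight S z ∘L tensLeft S (elemT S X a u))
      (g := tensLeft S (elemT S X a u) ∘L tensRight S z) fun b v => h1 a u b v z) y
  exact fun x y z =>
    DFunLike.congr_fun (Hat.ext_elemT S (f := F ∘L tensRight S z ∘L tensRight S y)
      (g := tensRight S (tens y z)) fun a u => h2 a u y z) x

theorem isMiddleSwap_of_elemT {X Y Z W : Shape}
    {F : Hat S ((X.prod Y).prod (Z.prod W)) →L[ℝ] Hat S ((X.prod Z).prod (Y.prod W))}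
    (h : ∀ a u b v c w d k, F (tens (tens (elemT S X a u) (elemT S Y b v))
      (tens (elemT S Z c w) (elemT S W d k))) =
      tens (tens (elemT S X a u) (elemT S Z c w)) (tens (elemT S Y b v) (elemT S W d k))) :
    IsMiddleSwap F := by
  have h1 : ∀ a u b v c w k, F (tens (tens (elemT S X a u) (elemT S Y b v))
      (tens (elemT S Z c w) k)) =
      tens (tens (elemT S X a u) (elemT S Z c w)) (tens (elemT S Y b v) k) := fun a u b v c w k =>
    DFunLike.congr_fun (Hat.ext_elemT S
      (f := F ∘L tensLeft S (tens (elemT S X a u) (elemT S Y b v)) ∘L tensLeft S (elemT S Z c w))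
      (g := tensLeft S (tens (elemT S X a u) (elemT S Z c w)) ∘L tensLeft S (elemT S Y b v))
      fun d k => h a u b v c w d k) k
  have h2 : ∀ a u b v w k, F (tens (tens (elemT S X a u) (elemT S Y b v)) (tens w k)) =
      tens (tens (elemT S X a u) w) (tens (elemT S Y b v) k) := fun a u b v w k =>
    DFunLike.congr_fun (Hat.ext_elemT S
      (f := F ∘L tensLeft S (tens (elemT S X a u) (elemT S Y b v)) ∘L tensRight S k)
      (g := tensRight S (tens (elemT S Y b v) k) ∘L tensLeft S (elemT S X a u))
      fun c w => h1 a u b v c w k) w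
  have h3 : ∀ a u v w k, F (tens (tens (elemT S X a u) v) (tens w k)) =
      tens (tens (elemT S X a u) w) (tens v k) := fun a u v w k =>
    DFunLike.congr_fun (Hat.ext_elemT S
      (f := F ∘L tensRight S (tens w k) ∘L tensLeft S (elemT S X a u))
      (g := tensLeft S (tens (elemT S X a u) w) ∘L tensRight S k)
      fun b v => h2 a u b v w k) v
  exact fun u v w k =>
    DFunLike.congr_fun (Hat.ext_elemT S
      (f := F ∘L tensRight S (tens w k) ∘L tensRight S v)
      (g := tensRight S (tens v k) ∘L tensRight S w)
      fun a u => h3 a u v w k) u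

variable (S) in
theorem exists_associator (X Y Z : Shape) :
    ∃ F ∈ combOp S ((X.prod Y).prod Z) (X.prod (Y.prod Z)), IsAssociator F := by
  obtain ⟨F, hF, hF', -⟩ := exists_combOp_relabel (S := S) (X := (X.prod Y).prod Z)
    (Y := X.prod (Y.prod Z)) (fun b => ((b.1, b.2.1), b.2.2))
    (by
      rintro ⟨a, b, c⟩ ⟨a', b', c'⟩ h
      simp only [Prod.mk.injEq] at h ⊢
      exact ⟨h.1.1, h.1.2, h.2⟩)
    (fun b => Equiv.sumAssoc _ _ _)
    (by
      rintro ⟨a, b, c⟩ σ ⟨⟨_, σ₃⟩, ⟨⟨⟨σ₁, σ₂⟩, ⟨h₁, h₂⟩, rfl⟩, h₃⟩, rfl⟩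
      convert sumCongr_mem_prodPerm h₁ (sumCongr_mem_prodPerm h₂ h₃)
      ext x
      rcases x with x | x | x <;> rfl)
  refine ⟨F, hF, isAssociator_of_elemT fun a u b v c w => ?_⟩
  simp only [tens_elemT]
  refine (hF' (a, b, c) _).trans ?_
  congr 1
  funext x
  rcases x with x | x | x <;> rfl

variable (S) in
theorem exists_middleSwap (X Y Z W : Shape) :
    ∃ F ∈ combOp S ((X.prod Y).prod (Z.prod W)) ((X.prod Z).prod (Y.prod W)), IsMiddleSwap F := by
  obtain ⟨F, hF, hF', -⟩ := exists_combOp_relabel (S := S) (X := (X.prod Y).prod (Z.prod W))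
    (Y := (X.prod Z).prod (Y.prod W)) (fun b => ((b.1.1, b.2.1), (b.1.2, b.2.2)))
    (by
      rintro ⟨⟨a, b⟩, c, d⟩ ⟨⟨a', b'⟩, c', d'⟩ h
      simp only [Prod.mk.injEq] at h ⊢
      exact ⟨⟨h.1.1, h.2.1⟩, h.1.2, h.2.2⟩)
    (fun b => Equiv.sumSumSumComm _ _ _ _)
    (by
      rintro ⟨⟨a, b⟩, c, d⟩ σ ⟨⟨_, _⟩, ⟨⟨⟨σ₁, σ₂⟩, ⟨h₁, h₂⟩, rfl⟩, ⟨σ₃, σ₄⟩, ⟨h₃, h₄⟩, rfl⟩, rfl⟩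
      convert sumCongr_mem_prodPerm (sumCongr_mem_prodPerm h₁ h₃) (sumCongr_mem_prodPerm h₂ h₄)
      ext x
      rcases x with (x | x) | x | x <;> rfl)
  refine ⟨F, hF, isMiddleSwap_of_elemT fun a u b v c w d k => ?_⟩
  simp only [tens_elemT]
  refine (hF' ((a, c), (b, d)) _).trans ?_
  congr 1
  funext x
  rcases x with (x | x) | x | x <;> rfl

end Structural

/-! ## The bialgebra axioms -/

section Bialgebra

/-- With at most one solution, a sum of indicators is an indicator. Equality of structure constants
then reduces to an equivalence of existence statements. -/
theorem sum_ind {A : Type*} [Fintype A] {p : A → Prop} (hp : ∀ a a', p a → p a' → a = a') :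
    ∑ a, ind (p a) = ind (∃ a, p a) := by
  by_cases hex : ∃ a, p a
  · obtain ⟨a, ha⟩ := hex
    rw [ind_pos ⟨a, ha⟩, Finset.sum_eq_single a, ind_pos ha]
    · exact fun b _ hb => ind_neg fun hb' => hb (hp b a hb' ha)
    · exact fun h => absurd (Finset.mem_univ _) h
  · rw [ind_neg hex]
    exact Finset.sum_eq_zero fun a _ => ind_neg fun ha => hex ⟨a, ha⟩

theorem sum_ind_congr {A B : Type*} [Fintype A] [Fintype B] {p : A → Prop} {q : B → Prop}
    (hp : ∀ a a', p a → p a' → a = a') (hq : ∀ b b', q b → q b' → b = b')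
    (h : (∃ a, p a) ↔ ∃ b, q b) : ∑ a, ind (p a) = ∑ b, ind (q b) := by
  rw [sum_ind hp, sum_ind hq, propext h]

theorem sum_rotate {A B C M : Type*} [Fintype A] [Fintype B] [Fintype C] [AddCommMonoid M]
    (f : A → B → C → M) : ∑ a, ∑ b, ∑ c, f a b c = ∑ b, ∑ c, ∑ a, f a b c := by
  rw [Finset.sum_comm]
  exact Finset.sum_congr rfl fun _ _ => Finset.sum_comm

/-- Read for the product, these are the coefficients of `T` in a triple product; read for the
coproduct, those of `P ⊗ Q ⊗ R` in an iterated coproduct of `T`. One identity serves both axioms. -/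
theorem ForestRel.Good.sum_assoc {C : ForestRel} (hC : C.Good) {α : Type} [Finite α]
    (P Q R T : PForest α) : ∑ T', ind (C α P Q T') * ind (C α T' R T) =
      ∑ T', ind (C α Q R T') * ind (C α P T' T) := by
  simp only [← ind_and]
  exact sum_ind_congr (fun _ _ h h' => hC.unique_left P Q R T _ _ h.1 h.2 h'.1 h'.2)
    (fun _ _ h h' => hC.unique_right P Q R T _ _ h.1 h.2 h'.1 h'.2) (hC.assoc P Q R T)

/-- The compatibility of a product with a coproduct. -/
structure ForestRel.Compatible (M D : ForestRel) : Prop where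
  exists_iff : ∀ {α : Type} (P Q A B : PForest α), (∀ x, P.r x x → ¬ Q.r x x) →
    ((∃ T, M α P Q T ∧ D α A B T) ↔ ∃ P₁ P₂ Q₁ Q₂, D α P₁ P₂ P ∧ D α Q₁ Q₂ Q ∧
      M α P₁ Q₁ A ∧ M α P₂ Q₂ B)
  unique : ∀ {α : Type} {P Q A B T T' : PForest α}, M α P Q T → D α A B T → M α P Q T' →
    D α A B T' → T = T'
  unique' : ∀ {α : Type} {P Q A B P₁ P₂ Q₁ Q₂ P₁' P₂' Q₁' Q₂' : PForest α},
    (∀ x, P.r x x → ¬ Q.r x x) → D α P₁ P₂ P → D α Q₁ Q₂ Q → M α P₁ Q₁ A → M α P₂ Q₂ B →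
      D α P₁' P₂' P → D α Q₁' Q₂' Q → M α P₁' Q₁' A → M α P₂' Q₂' B →
        P₁ = P₁' ∧ P₂ = P₂' ∧ Q₁ = Q₁' ∧ Q₂ = Q₂'

theorem DisjUnion.unique {α : Type} {P Q T T' : PForest α} (h : DisjUnion α P Q T)
    (h' : DisjUnion α P Q T') : T = T' := by
  ext x y
  rw [h.2, h'.2]

theorem compatible_union_cut : ForestRel.Compatible DisjUnion Cut where
  exists_iff P Q A B := union_cut_iff P Q A B
  unique h _ h' _ := h.unique h'
  unique' hPQ h1 h2 h3 h4 h1' h2' h3' h4' := union_cut_unique hPQ h1 h2 h3 h4 h1' h2' h3' h4'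

/-- The four parts form a square whose rows and columns play symmetric roles. Transposing it
exchanges cuts with unions, so `union_cut_iff` also proves this case. -/
theorem compatible_cut_union : ForestRel.Compatible Cut DisjUnion where
  exists_iff P Q A B hPQ := by
    constructor
    · rintro ⟨T, h, h'⟩
      obtain ⟨A₁, A₂, B₁, B₂, h1, h2, h3, h4⟩ := (union_cut_iff A B P Q h'.1).1 ⟨T, h', h⟩
      exact ⟨A₁, B₁, A₂, B₂, h3, h4, h1, h2⟩
    · rintro ⟨A₁, B₁, A₂, B₂, h3, h4, h1, h2⟩
      obtain ⟨T, h, h'⟩ := (union_cut_iff A B P Q (union_cut_disj hPQ h1 h2 h3 h4)).2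
        ⟨A₁, A₂, B₁, B₂, h1, h2, h3, h4⟩
      exact ⟨T, h', h⟩
  unique _ h _ h' := h.unique h'
  unique' hPQ h3 h4 h1 h2 h3' h4' h1' h2' := by
    obtain ⟨k1, k2, k3, k4⟩ := union_cut_unique (union_cut_disj hPQ h1 h2 h3 h4)
      h1 h2 h3 h4 h1' h2' h3' h4'
    exact ⟨k1, k3, k2, k4⟩

/-- The two sides are the coefficients of `A ⊗ B` in the coproduct of a product and in the product
of the coproducts. -/
theorem ForestRel.Compatible.sum_eq {M D : ForestRel} (h : M.Compatible D) {α : Type} [Finite α]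
    {P Q : PForest α} (hPQ : ∀ x, P.r x x → ¬ Q.r x x) (A B : PForest α) :
    ∑ T, ind (M α P Q T) * ind (D α A B T) =
      ∑ p : PForest α × PForest α, ∑ q : PForest α × PForest α,
        ind (D α p.1 p.2 P) * ind (D α q.1 q.2 Q) * (ind (M α p.1 q.1 A) * ind (M α p.2 q.2 B)) := by
  simp only [← ind_and]
  rw [← Fintype.sum_prod_type (f := fun pq : (PForest α × PForest α) × (PForest α × PForest α) =>
    ind ((D α pq.1.1 pq.1.2 P ∧ D α pq.2.1 pq.2.2 Q) ∧
      M α pq.1.1 pq.2.1 A ∧ M α pq.1.2 pq.2.2 B))]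
  refine sum_ind_congr (fun _ _ k k' => h.unique k.1 k.2 k'.1 k'.2) ?_
    ((h.exists_iff P Q A B hPQ).trans ?_)
  · rintro ⟨⟨p₁, p₂⟩, q₁, q₂⟩ ⟨⟨p₁', p₂'⟩, q₁', q₂'⟩ ⟨⟨k1, k2⟩, k3, k4⟩ ⟨⟨k1', k2'⟩, k3', k4'⟩
    obtain ⟨rfl, rfl, rfl, rfl⟩ := h.unique' hPQ k1 k2 k3 k4 k1' k2' k3' k4'
    rfl
  · constructor
    · rintro ⟨P₁, P₂, Q₁, Q₂, k1, k2, k3, k4⟩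
      exact ⟨⟨⟨P₁, P₂⟩, Q₁, Q₂⟩, ⟨k1, k2⟩, k3, k4⟩
    · rintro ⟨⟨⟨P₁, P₂⟩, Q₁, Q₂⟩, ⟨k1, k2⟩, k3, k4⟩
      exact ⟨P₁, P₂, Q₁, Q₂, k1, k2, k3, k4⟩

variable {V : Type*} [AddCommGroup V] [Module ℝ V] [TopologicalSpace V] {I : Type*}
variable {S : SymmetricCrossSeminorms V I} {M D : ForestRel} {A : HopfOps S treeShape}

namespace IsForestOps

theorem assoc_lab (hA : IsForestOps M D A) (hM : M.Good) {α : Type} [Finite α] (P Q R : PForest α)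
    (v : α → V) (hPQ : ∀ x, P.r x x → ¬ Q.r x x) (hPR : ∀ x, P.r x x → ¬ R.r x x)
    (hQR : ∀ x, Q.r x x → ¬ R.r x x) :
    A.mul (tens (A.mul (tens (lab S P v) (lab S Q v))) (lab S R v)) =
      A.mul (tens (lab S P v) (A.mul (tens (lab S Q v) (lab S R v)))) := by
  rw [hA.mul_lab _ P Q v hPQ, hA.mul_lab _ Q R v hQR]
  -- The product formula requires disjoint supports. This holds for each term with nonzero
  -- coefficient, because there `T'` is supported on `P` and `Q`.
  have h1 : ∀ T', ind (M α P Q T') • A.mul (tens (lab S T' v) (lab S R v)) =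
      ind (M α P Q T') • prodSum S M T' R v := fun T' => ind_smul_congr fun h =>
    hA.mul_lab _ _ _ _ fun x hx => ((hM.supp h x).1 hx).elim (hPR x) (hQR x)
  have h2 : ∀ T', ind (M α Q R T') • A.mul (tens (lab S P v) (lab S T' v)) =
      ind (M α Q R T') • prodSum S M P T' v := fun T' => ind_smul_congr fun h =>
    hA.mul_lab _ _ _ _ fun x hx hx' => ((hM.supp h x).1 hx').elim (hPQ x hx) (hPR x hx)
  rw [prodSum, prodSum, map_sum, map_sum, LinearMap.sum_apply, map_sum, map_sum]
  simp only [map_smul, LinearMap.smul_apply, h1, h2]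
  simp only [prodSum, Finset.smul_sum, smul_smul]
  rw [Finset.sum_comm]
  conv_rhs => rw [Finset.sum_comm]
  simp only [← Finset.sum_smul, hM.sum_assoc]

theorem coassoc_lab (hA : IsForestOps M D A) (hD : D.Good)
    {α₀ : Hat S ((treeShape.prod treeShape).prod treeShape) →L[ℝ]
      Hat S (treeShape.prod (treeShape.prod treeShape))}
    {Δl : Hat S (treeShape.prod treeShape) →L[ℝ] Hat S ((treeShape.prod treeShape).prod treeShape)}
    {Δr : Hat S (treeShape.prod treeShape) →L[ℝ] Hat S (treeShape.prod (treeShape.prod treeShape))}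
    (hα : IsAssociator α₀) (hl : IsTensorMap A.comul (.id ℝ _) Δl)
    (hr : IsTensorMap (.id ℝ _) A.comul Δr) {α : Type} [Finite α] (T : PForest α) (v : α → V) :
    α₀ (Δl (A.comul (lab S T v))) = Δr (A.comul (lab S T v)) := by
  rw [hA.comul_lab, coprodSum]
  simp only [map_sum, map_smul, hl _ _, hr _ _, ContinuousLinearMap.id_apply, hA.comul_lab,
    coprodSum, LinearMap.sum_apply, LinearMap.smul_apply, hα _ _ _, Finset.smul_sum, smul_smul]
  simp only [Fintype.sum_prod_type]
  -- The coefficient of `P ⊗ Q ⊗ R` counts the intermediate forests `T'`.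
  calc _ = ∑ P, ∑ Q, ∑ R, (∑ T', ind (D α P Q T') * ind (D α T' R T)) •
        tens (lab S P v) (tens (lab S Q v) (lab S R v)) := by
        simp only [Finset.sum_smul]
        rw [Finset.sum_congr rfl fun _ _ => sum_rotate _, sum_rotate]
        exact Finset.sum_congr rfl fun _ _ => Finset.sum_congr rfl fun _ _ =>
          Finset.sum_comm.trans (by simp only [mul_comm])
    _ = _ := by
        simp only [hD.sum_assoc, Finset.sum_smul]
        refine Finset.sum_congr rfl fun _ _ => ?_
        rw [← sum_rotate]
        refine Finset.sum_congr rfl fun _ _ => Finset.sum_congr rfl fun _ _ =>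
          Finset.sum_congr rfl fun _ _ => ?_
        rw [mul_comm]

theorem comul_mul_lab (hA : IsForestOps M D A) (hD : D.Good) (h : M.Compatible D)
    {ΔΔ : Hat S (treeShape.prod treeShape) →L[ℝ]
      Hat S ((treeShape.prod treeShape).prod (treeShape.prod treeShape))}
    {τ : Hat S ((treeShape.prod treeShape).prod (treeShape.prod treeShape)) →L[ℝ]
      Hat S ((treeShape.prod treeShape).prod (treeShape.prod treeShape))}
    {mm : Hat S ((treeShape.prod treeShape).prod (treeShape.prod treeShape)) →L[ℝ]
      Hat S (treeShape.prod treeShape)}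
    (hΔ : IsTensorMap A.comul A.comul ΔΔ) (hτ : IsMiddleSwap τ) (hm : IsTensorMap A.mul A.mul mm)
    {α : Type} [Finite α] (P Q : PForest α) (v : α → V) (hPQ : ∀ x, P.r x x → ¬ Q.r x x) :
    A.comul (A.mul (tens (lab S P v) (lab S Q v))) =
      mm (τ (ΔΔ (tens (lab S P v) (lab S Q v)))) := by
  have hL : A.comul (A.mul (tens (lab S P v) (lab S Q v))) =
      ∑ p : PForest α × PForest α, (∑ T, ind (M α P Q T) * ind (D α p.1 p.2 T)) •
        tens (lab S p.1 v) (lab S p.2 v) := by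
    rw [hA.mul_lab _ P Q v hPQ, prodSum]
    simp only [map_sum, map_smul, hA.comul_lab, coprodSum, Finset.smul_sum, smul_smul,
      Finset.sum_smul]
    exact Finset.sum_comm
  rw [hL, hΔ, hA.comul_lab, hA.comul_lab]
  -- For nonzero coefficients the parts of `P` and of `Q` lie inside `P` and `Q`, so they are
  -- disjoint and can be multiplied.
  have h1 : ∀ p q : PForest α × PForest α,
      (ind (D α p.1 p.2 P) * ind (D α q.1 q.2 Q)) •
        tens (A.mul (tens (lab S p.1 v) (lab S q.1 v))) (A.mul (tens (lab S p.2 v) (lab S q.2 v))) =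
      (ind (D α p.1 p.2 P) * ind (D α q.1 q.2 Q)) •
        tens (prodSum S M p.1 q.1 v) (prodSum S M p.2 q.2 v) := by
    intro p q
    rw [← ind_and]
    refine ind_smul_congr fun hpq => ?_
    rw [hA.mul_lab, hA.mul_lab]
    · exact fun x hx hx' => hPQ x ((hD.supp hpq.1 x).2 (Or.inr hx))
        ((hD.supp hpq.2 x).2 (Or.inr hx'))
    · exact fun x hx hx' => hPQ x ((hD.supp hpq.1 x).2 (Or.inl hx))
        ((hD.supp hpq.2 x).2 (Or.inl hx'))
  have hR : mm (τ (tens (coprodSum S D P v) (coprodSum S D Q v))) =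
      ∑ p : PForest α × PForest α, ∑ q : PForest α × PForest α,
        (ind (D α p.1 p.2 P) * ind (D α q.1 q.2 Q)) •
          tens (prodSum S M p.1 q.1 v) (prodSum S M p.2 q.2 v) := by
    simp only [← h1]
    simp only [coprodSum, map_sum, map_smul, LinearMap.sum_apply, LinearMap.smul_apply,
      hτ _ _ _ _, hm _ _, Finset.smul_sum, smul_smul]
    rw [Finset.sum_comm]
    simp only [mul_comm]
  rw [hR]
  simp only [h.sum_eq hPQ, Finset.sum_smul]
  refine (sum_rotate _).trans ?_
  refine Finset.sum_congr rfl fun p _ => Finset.sum_congr rfl fun q _ => ?_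
  simp only [prodSum, map_sum, map_smul, LinearMap.sum_apply, LinearMap.smul_apply,
    Finset.smul_sum, smul_smul]
  rw [Fintype.sum_prod_type, Finset.sum_comm]
  simp only [mul_assoc, mul_comm (ind (M α p.1 q.1 _))]

end IsForestOps

end Bialgebra

/-! ### From identities of labelled forests to the bialgebra axioms. -/

section Bialgebra

variable {V : Type*} [AddCommGroup V] [Module ℝ V] [TopologicalSpace V] {I : Type*}
variable {S : SymmetricCrossSeminorms V I} {M D : ForestRel} {A : HopfOps S treeShape}

theorem ForestRel.Good.empty_iff {C : ForestRel} (hC : C.Good) {α : Type} (P Q : PForest α) :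
    C α P Q .empty ↔ P = .empty ∧ Q = .empty := by
  constructor
  · intro h
    exact ⟨PForest.eq_empty fun x hx => (hC.supp h x).2 (Or.inl hx),
      PForest.eq_empty fun x hx => (hC.supp h x).2 (Or.inr hx)⟩
  · rintro ⟨rfl, rfl⟩
    exact (hC.empty_left _ _).2 rfl

/-- The operator keeps the components whose first tree is the root alone, identifying `∅ ⊔ v(b)`
with `v(b)`. On elementary tensors this is `ε ⊗̂ id`. -/
theorem exists_counit_tens_left (hε : ∀ (α : Type) [Finite α] (P : PForest α) (v : α → V),
    A.counit (lab S P v) = ind (P = .empty)) :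
    ∃ F ∈ combOp S (treeShape.prod treeShape) treeShape,
      ∀ x y, F (tens x y) = A.counit x • y := by
  obtain ⟨F, hF, hF', hF0⟩ := exists_combOp_relabel (S := S) (X := treeShape.prod treeShape)
    (Y := treeShape) (fun b => (rootTree, b)) (fun b b' h => (Prod.mk.inj h).2)
    (fun b => Equiv.emptySum rootTree.Vertex _)
    (by
      rintro b σ ⟨⟨σ₁, σ₂⟩, ⟨h₁, h₂⟩, rfl⟩
      have : (Equiv.emptySum rootTree.Vertex b.Vertex).permCongr (Equiv.Perm.sumCongr σ₁ σ₂) = σ₂ :=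
        Equiv.ext fun x => rfl
      exact this ▸ h₂)
  have h1 : ∀ a u b w, F (tens (elemT S treeShape a u) (elemT S treeShape b w)) =
      A.counit (elemT S treeShape a u) • elemT S treeShape b w := by
    intro a u b w
    have hu := elemT_eq_lab S a id Function.injective_id u
    change elemT S treeShape a u = _ at hu
    rw [tens_elemT, hu, hε, ind_congr (image_eq_empty_iff _)]
    by_cases ha : IsEmpty a.Vertex
    · obtain rfl := eq_rootTree a
      rw [hF' b, ind_pos ha, one_smul]
      rfl
    · rw [ind_neg ha, zero_smul]
      refine hF0 _ _ fun b' hb' => ha ?_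
      rw [← (Prod.mk.inj hb').1]
      infer_instance
  have h2 : ∀ x b w, F (tens x (elemT S treeShape b w)) =
      A.counit x • elemT S treeShape b w := by
    intro x b w
    -- The scalar multiples of a fixed elementary tensor form a continuous map `u`, so both sides
    -- are continuous in `x`.
    obtain ⟨u, hu⟩ := exists_unit S b w
    rw [← hu]
    exact DFunLike.congr_fun (Hat.ext_elemT S (f := F ∘L tensRight S (elemT S treeShape b w))
      (g := u ∘L A.counit) fun a v => (h1 a v b w).trans (hu _).symm) x
  refine ⟨F, hF, fun x y => ?_⟩
  exact DFunLike.congr_fun (Hat.ext_elemT S (f := F ∘L tensLeft S x)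
    (g := A.counit x • ContinuousLinearMap.id ℝ (HatTr S)) fun b w => h2 x b w) y

theorem exists_counit_tens_right (hε : ∀ (α : Type) [Finite α] (P : PForest α) (v : α → V),
    A.counit (lab S P v) = ind (P = .empty)) :
    ∃ F ∈ combOp S (treeShape.prod treeShape) treeShape,
      ∀ x y, F (tens x y) = A.counit y • x := by
  obtain ⟨F, hF, hF', hF0⟩ := exists_combOp_relabel (S := S) (X := treeShape.prod treeShape)
    (Y := treeShape) (fun b => (b, rootTree)) (fun b b' h => (Prod.mk.inj h).1)
    (fun b => Equiv.sumEmpty _ rootTree.Vertex)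
    (by
      rintro b σ ⟨⟨σ₁, σ₂⟩, ⟨h₁, h₂⟩, rfl⟩
      have : (Equiv.sumEmpty b.Vertex rootTree.Vertex).permCongr (Equiv.Perm.sumCongr σ₁ σ₂) = σ₁ :=
        Equiv.ext fun x => rfl
      exact this ▸ h₁)
  have h1 : ∀ a u b w, F (tens (elemT S treeShape a u) (elemT S treeShape b w)) =
      A.counit (elemT S treeShape b w) • elemT S treeShape a u := by
    intro a u b w
    have hw := elemT_eq_lab S b id Function.injective_id w
    change elemT S treeShape b w = _ at hw
    rw [tens_elemT, hw, hε, ind_congr (image_eq_empty_iff _)]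
    by_cases hb : IsEmpty b.Vertex
    · obtain rfl := eq_rootTree b
      rw [hF' a, ind_pos hb, one_smul]
      rfl
    · rw [ind_neg hb, zero_smul]
      refine hF0 _ _ fun b' hb' => hb ?_
      rw [← (Prod.mk.inj hb').2]
      infer_instance
  have h2 : ∀ a u y, F (tens (elemT S treeShape a u) y) =
      A.counit y • elemT S treeShape a u := by
    intro a u y
    obtain ⟨c, hc⟩ := exists_unit S a u
    rw [← hc]
    exact DFunLike.congr_fun (Hat.ext_elemT S (f := F ∘L tensLeft S (elemT S treeShape a u))
      (g := c ∘L A.counit) fun b w => (h1 a u b w).trans (hc _).symm) y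
  refine ⟨F, hF, fun x y => ?_⟩
  exact DFunLike.congr_fun (Hat.ext_elemT S (f := F ∘L tensRight S y)
    (g := A.counit y • ContinuousLinearMap.id ℝ (HatTr S)) fun a u => h2 a u y) x

theorem IsForestOps.isTopologicalBialgebra (hA : IsForestOps M D A) (hM : M.Good) (hD : D.Good)
    (h : M.Compatible D) : IsTopologicalBialgebra A where
  assoc := by
    obtain ⟨α, -, hα⟩ := exists_associator S treeShape treeShape treeShape
    obtain ⟨ml, -, hl⟩ := exists_tensorMap hA.mul_mem (id_mem_combOp (S := S) treeShape)
    obtain ⟨mr, -, hr⟩ := exists_tensorMap (id_mem_combOp (S := S) treeShape) hA.mul_mem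
    refine ⟨α, ml, mr, hα, hl, hr, HatTr.ext_tens_tens_lab ?_⟩
    intro β _ P Q R v hPQ hPR hQR
    simp only [ContinuousLinearMap.comp_apply]
    rw [hl, hα, hr]
    exact hA.assoc_lab hM P Q R v hPQ hPR hQR
  one_mul x := by
    refine DFunLike.congr_fun (HatTr.ext_lab (f := A.mul ∘L tensLeft S (A.unit 1))
      (g := .id ℝ _) fun α _ P v => ?_) x
    change A.mul (tens (A.unit 1) (lab S P v)) = lab S P v
    rw [hA.unit_apply 1 α v, one_smul, hA.mul_lab α .empty P v (fun x hx => False.elim hx),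
      prodSum, Finset.sum_eq_single P]
    · rw [ind_pos ((hM.empty_left P P).2 rfl), one_smul]
    · intro T _ hT
      rw [ind_neg fun k => hT ((hM.empty_left P T).1 k).symm, zero_smul]
    · exact fun k => absurd (Finset.mem_univ _) k
  mul_one x := by
    refine DFunLike.congr_fun (HatTr.ext_lab (f := A.mul ∘L tensRight S (A.unit 1))
      (g := .id ℝ _) fun α _ P v => ?_) x
    change A.mul (tens (lab S P v) (A.unit 1)) = lab S P v
    rw [hA.unit_apply 1 α v, one_smul, hA.mul_lab α P .empty v (fun x _ hx => False.elim hx),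
      prodSum, Finset.sum_eq_single P]
    · rw [ind_pos ((hM.empty_right P P).2 rfl), one_smul]
    · intro T _ hT
      rw [ind_neg fun k => hT ((hM.empty_right P T).1 k).symm, zero_smul]
    · exact fun k => absurd (Finset.mem_univ _) k
  coassoc := by
    obtain ⟨α, -, hα⟩ := exists_associator S treeShape treeShape treeShape
    obtain ⟨Δl, -, hl⟩ := exists_tensorMap hA.comul_mem (id_mem_combOp (S := S) treeShape)
    obtain ⟨Δr, -, hr⟩ := exists_tensorMap (id_mem_combOp (S := S) treeShape) hA.comul_mem
    exact ⟨α, Δl, Δr, hα, hl, hr, HatTr.ext_lab fun β _ T v =>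
      hA.coassoc_lab hD hα hl hr T v⟩
  counit_comul := by
    obtain ⟨F, -, hF⟩ := exists_counit_tens_left hA.counit_lab
    refine ⟨F, hF, HatTr.ext_lab fun α _ T v => ?_⟩
    simp only [ContinuousLinearMap.comp_apply, hA.comul_lab, coprodSum, map_sum, map_smul, hF,
      hA.counit_lab, smul_smul, ← ind_and]
    rw [Finset.sum_eq_single (.empty, T), ind_pos ⟨(hD.empty_left T T).2 rfl, rfl⟩, one_smul]
    · rfl
    · rintro ⟨P, Q⟩ _ hPQ
      rw [ind_neg, zero_smul]
      rintro ⟨k, rfl⟩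
      exact hPQ (Prod.ext rfl ((hD.empty_left Q T).1 k))
    · exact fun k => absurd (Finset.mem_univ _) k
  comul_counit := by
    obtain ⟨F, -, hF⟩ := exists_counit_tens_right hA.counit_lab
    refine ⟨F, hF, HatTr.ext_lab fun α _ T v => ?_⟩
    simp only [ContinuousLinearMap.comp_apply, hA.comul_lab, coprodSum, map_sum, map_smul, hF,
      hA.counit_lab, smul_smul, ← ind_and]
    rw [Finset.sum_eq_single (T, .empty), ind_pos ⟨(hD.empty_right T T).2 rfl, rfl⟩, one_smul]
    · rfl
    · rintro ⟨P, Q⟩ _ hPQ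
      rw [ind_neg, zero_smul]
      rintro ⟨k, hQ⟩
      dsimp only at k hQ
      subst hQ
      exact hPQ (Prod.ext ((hD.empty_right P T).1 k) rfl)
    · exact fun k => absurd (Finset.mem_univ _) k
  comul_mul := by
    obtain ⟨ΔΔ, -, hΔ⟩ := exists_tensorMap hA.comul_mem hA.comul_mem
    obtain ⟨τ, -, hτ⟩ := exists_middleSwap S treeShape treeShape treeShape treeShape
    obtain ⟨mm, -, hm⟩ := exists_tensorMap hA.mul_mem hA.mul_mem
    exact ⟨ΔΔ, τ, mm, hΔ, hτ, hm, HatTr.ext_tens_lab fun α _ P Q v hPQ =>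
      hA.comul_mul_lab hD h hΔ hτ hm P Q v hPQ⟩
  comul_one := by
    rw [hA.unit_apply 1 PEmpty PEmpty.elim, one_smul, hA.comul_lab, coprodSum,
      Finset.sum_eq_single (.empty, .empty), ind_pos ((hD.empty_iff _ _).2 ⟨rfl, rfl⟩), one_smul]
    · rintro ⟨P, Q⟩ _ hPQ
      rw [ind_neg, zero_smul]
      intro k
      obtain ⟨rfl, rfl⟩ := (hD.empty_iff P Q).1 k
      exact hPQ rfl
    · exact fun k => absurd (Finset.mem_univ _) k
  counit_mul x y := by
    have key : ∀ (α : Type) [Finite α] (P Q : PForest α) (v : α → V),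
        (∀ x, P.r x x → ¬ Q.r x x) → A.counit (A.mul (tens (lab S P v) (lab S Q v))) =
          A.counit (lab S P v) * A.counit (lab S Q v) := by
      intro α _ P Q v hPQ
      rw [hA.mul_lab _ _ _ _ hPQ, hA.counit_lab, hA.counit_lab, prodSum]
      simp only [map_sum, map_smul, hA.counit_lab, smul_eq_mul, ← ind_and]
      rw [← ind_congr (hM.empty_iff P Q), Finset.sum_eq_single .empty]
      · exact ind_congr (and_iff_left rfl)
      · exact fun T _ hT => ind_neg fun k => hT k.2
      · exact fun k => absurd (Finset.mem_univ _) k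
    -- With `F = ε ⊗̂ id`, the composite `ε ∘ F` is a continuous form of `ε ⊗ ε`, to which the
    -- density argument applies.
    obtain ⟨F, -, hF⟩ := exists_counit_tens_left hA.counit_lab
    have h1 : A.counit ∘L A.mul = A.counit ∘L F := HatTr.ext_tens_lab fun α _ P Q v hPQ => by
      simp only [ContinuousLinearMap.comp_apply]
      rw [key α P Q v hPQ, hF, map_smul, smul_eq_mul]
    have h2 := DFunLike.congr_fun h1 (tens x y)
    simp only [ContinuousLinearMap.comp_apply] at h2
    rw [h2, hF, map_smul, smul_eq_mul]
  counit_one := by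
    rw [hA.unit_apply 1 PEmpty PEmpty.elim, one_smul, hA.counit_lab, ind_pos rfl]

end Bialgebra

/-! ## The grading -/

section Grading

variable {V : Type*} [AddCommGroup V] [Module ℝ V] [TopologicalSpace V] {I : Type*}
variable {S : SymmetricCrossSeminorms V I} {M D : ForestRel} {A : HopfOps S treeShape}

theorem elemT_mem_degreePart (X : Shape) (a : X.idx) (w : X.vert a → V) :
    elemT S X a w ∈ degreePart S X (Nat.card (X.vert a)) := by
  intro b hb
  refine elemT_ne S X ?_ w
  rintro rfl
  exact hb rfl

-- This regroups the product over all indices by the number of vertices; the inverse reads each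
-- component from the piece of its own degree.
variable (S) in
open Classical in
theorem exists_decomposition (X : Shape) :
    ∃ e : Hat S X ≃L[ℝ] (∀ n, degreePart S X n), ∀ n (x : degreePart S X n),
      e x = Pi.single n x := by
  have hmem : ∀ (x : Hat S X) n, (fun a => if Nat.card (X.vert a) = n then x a else 0) ∈
      degreePart S X n := fun x n a ha => if_neg ha
  let e : Hat S X ≃L[ℝ] (∀ n, degreePart S X n) :=
    { toFun := fun x n => ⟨_, hmem x n⟩
      map_add' := fun x y => by
        funext n
        refine Subtype.ext (funext fun a => ?_)
        change (if _ then x a + y a else 0) = (if _ then x a else 0) + if _ then y a else 0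
        split_ifs <;> simp
      map_smul' := fun c x => by
        funext n
        refine Subtype.ext (funext fun a => ?_)
        change (if _ then c • x a else 0) = c • if _ then x a else 0
        split_ifs <;> simp
      invFun := fun y a => (y (Nat.card (X.vert a))).1 a
      left_inv := fun x => funext fun a => if_pos rfl
      right_inv := fun y => by
        funext n
        refine Subtype.ext (funext fun a => ?_)
        change (if Nat.card (X.vert a) = n then (y (Nat.card (X.vert a))).1 a else 0) = (y n).1 a
        split_ifs with h
        · rw [h]
        · exact ((y n).2 a h).symm
      continuous_toFun := by
        refine continuous_pi fun n => Continuous.subtype_mk (continuous_pi fun a => ?_) _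
        split_ifs
        · exact continuous_apply a
        · exact continuous_const
      continuous_invFun := continuous_pi fun a =>
        (continuous_apply a).comp (continuous_subtype_val.comp (continuous_apply _)) }
  refine ⟨e, fun n x => funext fun m => Subtype.ext (funext fun a => ?_)⟩
  change (if Nat.card (X.vert a) = m then x.1 a else 0) = _
  by_cases hmn : m = n
  · subst hmn
    rw [Pi.single_eq_same]
    split_ifs with h
    · rfl
    · exact (x.2 a h).symm
  · rw [Pi.single_eq_of_ne hmn]
    split_ifs with h
    · exact x.2 a (h.trans_ne hmn)
    · rfl

/-- A supremum of closed subspaces need not be closed, so `z` is first split into the finitely many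
pieces whose first factor has degree `p`; each piece lies in one of the closed spans. -/
theorem degreePart_prod_le (X Y : Shape) (n : ℕ) : degreePart S (X.prod Y) n ≤
    ⨆ (p : ℕ) (q : ℕ) (_ : p + q = n), (Submodule.span ℝ {z | ∃ x ∈ degreePart S X p,
      ∃ y ∈ degreePart S Y q, tens x y = z}).topologicalClosure := by
  classical
  intro z hz
  have hsum : z = ∑ p ∈ Finset.range (n + 1),
      (fun a => if Nat.card (X.vert a.1) = p then z a else 0 : Hat S (X.prod Y)) := by
    funext a
    rw [Finset.sum_apply]
    by_cases ha : Nat.card (X.vert a.1) ∈ Finset.range (n + 1)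
    · rw [Finset.sum_eq_single_of_mem _ ha fun p _ hp => if_neg hp.symm, if_pos rfl]
    · have h1 : z a = 0 := by
        refine hz a fun h => ha ?_
        rw [Nat.card_sum] at h
        exact Finset.mem_range.2 (Nat.lt_succ_of_le ((Nat.le_add_right _ _).trans h.le))
      simp [h1]
  rw [hsum]
  refine Submodule.sum_mem _ fun p hp => ?_
  have hpn : p + (n - p) = n := Nat.add_sub_cancel' (Nat.le_of_lt_succ (Finset.mem_range.1 hp))
  refine Submodule.mem_iSup_of_mem p (Submodule.mem_iSup_of_mem (n - p)
    (Submodule.mem_iSup_of_mem hpn ?_))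
  refine Hat.mem_of_isClosed S (Submodule.isClosed_topologicalClosure _) ?_
  rintro ⟨a, b⟩ hab w
  have ha : Nat.card (X.vert a) = p := by
    by_contra h
    exact hab (if_neg h)
  have hb : Nat.card (Y.vert b) = n - p := by
    by_contra h
    refine hab ?_
    rw [if_pos ha]
    refine hz (a, b) fun h' => h ?_
    rw [Nat.card_sum] at h'
    dsimp only at h'
    omega
  refine Submodule.le_topologicalClosure _ (Submodule.subset_span ?_)
  refine ⟨elemT S X a (w ∘ Sum.inl), ha ▸ elemT_mem_degreePart X a _,
    elemT S Y b (w ∘ Sum.inr), hb ▸ elemT_mem_degreePart Y b _, ?_⟩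
  rw [tens_elemT, Sum.elim_comp_inl_inr]

theorem IsForestOps.counit_elemT (hA : IsForestOps M D A) (t : RTree) (w : t.Vertex → V) :
    A.counit (elemT S treeShape t w) = ind (IsEmpty t.Vertex) := by
  have hw := elemT_eq_lab S t id Function.injective_id w
  change elemT S treeShape t w = _ at hw
  rw [hw, hA.counit_lab, ind_congr (image_eq_empty_iff _)]

theorem IsForestOps.unit_eq_elemT (hA : IsForestOps M D A) (c : ℝ) (w : rootTree.Vertex → V) :
    A.unit c = c • elemT S treeShape rootTree w := by
  have hw := elemT_eq_lab S rootTree id Function.injective_id w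
  change elemT S treeShape rootTree w = _ at hw
  rw [hw, hA.unit_apply c rootTree.Vertex w, (image_eq_empty_iff _).2 inferInstance]

theorem IsForestOps.unit_counit_elemT (hA : IsForestOps M D A) (t : RTree) (w : t.Vertex → V) :
    (A.unit ∘L A.counit) (elemT S treeShape t w) =
      ind (IsEmpty t.Vertex) • elemT S treeShape t w := by
  rw [ContinuousLinearMap.comp_apply, hA.counit_elemT]
  by_cases ht : IsEmpty t.Vertex
  · obtain rfl := eq_rootTree t
    exact hA.unit_eq_elemT _ _
  · rw [ind_neg ht, zero_smul, map_zero]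

/-- On elementary tensors `η ∘ ε` is the projection to the root tree, a recipe that respects all
symmetries. -/
theorem IsForestOps.unit_counit_mem (hA : IsForestOps M D A) :
    A.unit ∘L A.counit ∈ combOp S treeShape treeShape := by
  obtain ⟨F, hF, hF'⟩ := exists_combOp (S := S) (X := treeShape) (Y := treeShape)
    finite_setOf_card_treeShape
    (fun t w => ind (IsEmpty t.Vertex) • elemT S treeShape t w)
    (fun t => by
      refine Submodule.smul_mem (combFun S t.Vertex treeShape) (ind (IsEmpty t.Vertex))
        (x := elemT S treeShape t) ?_
      exact Submodule.subset_span ⟨⟨t, Equiv.refl _⟩, rfl⟩)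
    (fun t w σ hσ => by rw [elemT_comp_perm S treeShape t hσ])
  have : A.unit ∘L A.counit = F := Hat.ext_elemT S fun t w => by
    rw [hF', hA.unit_counit_elemT]
  exact this ▸ hF

/-- This is connectedness: the only tree of degree 0 is the root, and there `η ∘ ε` is the identity.
-/
theorem IsForestOps.unit_counit_apply (hA : IsForestOps M D A) (x : HatTr S) {t : RTree}
    (ht : Nat.card t.Vertex = 0) : (A.unit ∘L A.counit) x t = x t := by
  have hte : IsEmpty t.Vertex := (Nat.card_eq_zero.1 ht).resolve_right fun h => h.not_finite inferInstance
  refine DFunLike.congr_fun (Hat.ext_elemT S (f := projL treeShape t ∘L (A.unit ∘L A.counit))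
    (g := projL treeShape t) fun s w => ?_) x
  rw [ContinuousLinearMap.comp_apply, hA.unit_counit_elemT, map_smul]
  by_cases hs : IsEmpty s.Vertex
  · rw [ind_pos hs, one_smul]
  · rw [ind_neg hs, zero_smul]
    refine (elemT_ne S treeShape ?_ w).symm
    rintro rfl
    exact hs hte

theorem IsForestOps.isTopologicalGradedBialgebra (hA : IsForestOps M D A) (hM : M.Good)
    (hD : D.Good) (h : M.Compatible D) :
    IsTopologicalGradedBialgebra (degreePart S treeShape) A where
  toIsTopologicalBialgebra := hA.isTopologicalBialgebra hM hD h
  decomposition := by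
    obtain ⟨e, he⟩ := exists_decomposition S treeShape
    refine ⟨e, fun n x => ?_⟩
    convert he n x
  mul_mem p q x hx y hy := combOp_degreePart hA.mul_mem (tens_mem_degreePart hx hy)
  one_mem := by
    rw [hA.unit_eq_elemT 1 isEmptyElim, one_smul]
    have := elemT_mem_degreePart (S := S) treeShape rootTree isEmptyElim
    rwa [show Nat.card (treeShape.vert rootTree) = 0 from
      Nat.card_eq_zero.2 (Or.inl inferInstance)] at this
  comul_mem n x hx := degreePart_prod_le treeShape treeShape n (combOp_degreePart hA.comul_mem hx)
  counit_eq_zero n hn x hx := by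
    refine Hat.mem_of_isClosed S (s := LinearMap.ker A.counit.toLinearMap)
      A.counit.isClosed_ker fun t ht w => ?_
    change A.counit (elemT S treeShape t w) = 0
    rw [hA.counit_elemT, ind_neg]
    intro hte
    refine ht (hx t ?_)
    rw [Nat.card_eq_zero.2 (Or.inl hte)]
    exact hn.symm

end Grading

/-! ## The antipode -/

section Geometric

variable {E : Type*} [AddCommGroup E] [Module ℝ E] (m : E →ₗ[ℝ] E →ₗ[ℝ] E) (u p : E)

/-- The powers of an element for a bilinear product with a given unit. -/
def bilinPow : ℕ → E
  | 0 => u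
  | k + 1 => m (bilinPow k) p

/-- The partial sums of the geometric series of `u + p`. -/
def geomSum (N : ℕ) : E := ∑ k ∈ Finset.range N, (-1 : ℝ) ^ k • bilinPow m u p k

variable {m u p}

/-- Powers grow by multiplication on the right; associativity and the units give the same for the
left, as the two-sided inverse requires. -/
theorem bilinPow_succ' (hassoc : ∀ a b c, m (m a b) c = m a (m b c)) (hl : ∀ a, m u a = a)
    (hr : ∀ a, m a u = a) (k : ℕ) : m p (bilinPow m u p k) = bilinPow m u p (k + 1) := by
  induction k with
  | zero => rw [bilinPow, bilinPow, bilinPow, hl, hr]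
  | succ k ih =>
    rw [bilinPow, ← hassoc, ih]
    rfl

theorem geomSum_telescope (N : ℕ) :
    ∑ k ∈ Finset.range N, ((-1 : ℝ) ^ k • bilinPow m u p k +
      (-1 : ℝ) ^ k • bilinPow m u p (k + 1)) = u - (-1 : ℝ) ^ N • bilinPow m u p N := by
  have : ∀ k, (-1 : ℝ) ^ k • bilinPow m u p k + (-1 : ℝ) ^ k • bilinPow m u p (k + 1) =
      (-1 : ℝ) ^ k • bilinPow m u p k - (-1 : ℝ) ^ (k + 1) • bilinPow m u p (k + 1) := by
    intro k
    rw [pow_succ, mul_neg_one, neg_smul, sub_neg_eq_add]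
  simp only [this]
  rw [Finset.sum_range_sub' (fun k => (-1 : ℝ) ^ k • bilinPow m u p k), pow_zero, one_smul]
  rfl

/-- Writing `i = u + (i - u)` makes the product telescope up to the power of order `N`, the error
that later vanishes in low degrees. -/
theorem geomSum_mul (hr : ∀ a, m a u = a) (i : E) (N : ℕ) :
    m (geomSum m u (i - u) N) i = u - (-1 : ℝ) ^ N • bilinPow m u (i - u) N := by
  have h : m (geomSum m u (i - u) N) i = m (geomSum m u (i - u) N) (u + (i - u)) := by
    rw [add_sub_cancel]
  rw [h, map_add, hr, ← geomSum_telescope, Finset.sum_add_distrib]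
  simp only [geomSum, map_sum, LinearMap.sum_apply, map_smul, LinearMap.smul_apply]
  rfl

theorem mul_geomSum (hassoc : ∀ a b c, m (m a b) c = m a (m b c)) (hl : ∀ a, m u a = a)
    (hr : ∀ a, m a u = a) (i : E) (N : ℕ) :
    m i (geomSum m u (i - u) N) = u - (-1 : ℝ) ^ N • bilinPow m u (i - u) N := by
  have h : m i (geomSum m u (i - u) N) = m (u + (i - u)) (geomSum m u (i - u) N) := by
    rw [add_sub_cancel]
  rw [h, map_add, LinearMap.add_apply, hl, ← geomSum_telescope, Finset.sum_add_distrib]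
  simp only [geomSum, map_sum, map_smul, bilinPow_succ' hassoc hl hr]

end Geometric

/-! ### Convolution of combinatorial operators and the inverse of the identity. -/

section Antipode

variable {V : Type*} [AddCommGroup V] [Module ℝ V] [TopologicalSpace V] {I : Type*}
variable {S : SymmetricCrossSeminorms V I} {X : Shape} {A : HopfOps S X}

theorem IsTensorMap.unique {X X' Y Y' : Shape} {f : Hat S X →L[ℝ] Hat S X'}
    {g : Hat S Y →L[ℝ] Hat S Y'} {F G : Hat S (X.prod Y) →L[ℝ] Hat S (X'.prod Y')}
    (hF : IsTensorMap f g F) (hG : IsTensorMap f g G) : F = G :=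
  Hat.ext_tens S fun _ _ _ _ => (hF _ _).trans (hG _ _).symm

theorem IsTensorMap.comp {X X' X'' Y Y' Y'' : Shape} {f : Hat S X →L[ℝ] Hat S X'}
    {g : Hat S Y →L[ℝ] Hat S Y'} {F : Hat S (X.prod Y) →L[ℝ] Hat S (X'.prod Y')}
    {f' : Hat S X' →L[ℝ] Hat S X''} {g' : Hat S Y' →L[ℝ] Hat S Y''}
    {F' : Hat S (X'.prod Y') →L[ℝ] Hat S (X''.prod Y'')}
    (hF' : IsTensorMap f' g' F') (hF : IsTensorMap f g F) :
    IsTensorMap (f' ∘L f) (g' ∘L g) (F' ∘L F) := fun x y => by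
  simp only [ContinuousLinearMap.comp_apply]
  rw [hF, hF']

/-- The type of combinatorial operators. -/
def CombOp (S : SymmetricCrossSeminorms V I) (X Y : Shape) : Type _ := combOp S X Y

namespace CombOp

variable {Y : Shape}

instance : AddCommGroup (CombOp S X Y) := inferInstanceAs (AddCommGroup (combOp S X Y))

instance : Module ℝ (CombOp S X Y) := inferInstanceAs (Module ℝ (combOp S X Y))

/-- The underlying operator. -/
def val (f : CombOp S X Y) : Hat S X →L[ℝ] Hat S Y := Subtype.val (p := (· ∈ combOp S X Y)) f

theorem val_mem (f : CombOp S X Y) : f.val ∈ combOp S X Y :=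
  Subtype.property (p := (· ∈ combOp S X Y)) f

/-- A combinatorial operator as an element of the type of these. -/
def mk (f : Hat S X →L[ℝ] Hat S Y) (hf : f ∈ combOp S X Y) : CombOp S X Y :=
  Subtype.mk (p := (· ∈ combOp S X Y)) f hf

theorem ext {f g : CombOp S X Y} (h : f.val = g.val) : f = g :=
  Subtype.ext (p := (· ∈ combOp S X Y)) h

end CombOp

/-- The tensor product of two combinatorial operators. -/
def tensorOp {X X' Y Y' : Shape} (f : CombOp S X X') (g : CombOp S Y Y') :
    CombOp S (X.prod Y) (X'.prod Y') :=
  .mk (exists_tensorMap f.val_mem g.val_mem).choose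
    (exists_tensorMap f.val_mem g.val_mem).choose_spec.1

theorem isTensorMap_tensorOp {X X' Y Y' : Shape} (f : CombOp S X X') (g : CombOp S Y Y') :
    IsTensorMap f.val g.val (tensorOp f g).val :=
  (exists_tensorMap f.val_mem g.val_mem).choose_spec.2

theorem Hat.ext_tens_tens {X Y W : Shape} {Z : Type*} [AddCommGroup Z] [Module ℝ Z]
    [TopologicalSpace Z] [T2Space Z] {f g : Hat S ((X.prod Y).prod W) →L[ℝ] Z}
    (h : ∀ x y z, f (tens (tens x y) z) = g (tens (tens x y) z)) : f = g :=
  Hat.ext_tens S fun a w c w' => by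
    have := h (elemT S X a.1 (w ∘ Sum.inl)) (elemT S Y a.2 (w ∘ Sum.inr)) (elemT S W c w')
    rwa [tens_elemT, Sum.elim_comp_inl_inr] at this

theorem IsAssociator.unique {X Y Z : Shape}
    {α β : Hat S ((X.prod Y).prod Z) →L[ℝ] Hat S (X.prod (Y.prod Z))}
    (hα : IsAssociator α) (hβ : IsAssociator β) : α = β :=
  Hat.ext_tens_tens fun x y z => (hα x y z).trans (hβ x y z).symm

theorem IsAssociator.naturality {X Y Z : Shape}
    {α : Hat S ((X.prod Y).prod Z) →L[ℝ] Hat S (X.prod (Y.prod Z))} (hα : IsAssociator α)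
    (f : CombOp S X X) (g : CombOp S Y Y) (h : CombOp S Z Z) :
    α ∘L (tensorOp (tensorOp f g) h).val = (tensorOp f (tensorOp g h)).val ∘L α :=
  Hat.ext_tens_tens fun x y z => by
    simp only [ContinuousLinearMap.comp_apply]
    rw [hα, isTensorMap_tensorOp, isTensorMap_tensorOp, isTensorMap_tensorOp, isTensorMap_tensorOp,
      hα]

/-- A topological bialgebra whose operations are combinatorial and which is connected. -/
structure IsConnectedCombinatorial (A : HopfOps S X) : Prop where
  bialgebra : IsTopologicalBialgebra A
  mul_mem : A.mul ∈ combOp S (X.prod X) X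
  comul_mem : A.comul ∈ combOp S X (X.prod X)
  unit_counit_mem : A.unit ∘L A.counit ∈ combOp S X X
  unit_counit_apply : ∀ x a, Nat.card (X.vert a) = 0 → (A.unit ∘L A.counit) x a = x a

namespace IsConnectedCombinatorial

variable (hA : IsConnectedCombinatorial A)

/-- The convolution product of operators. -/
def conv : CombOp S X X →ₗ[ℝ] CombOp S X X →ₗ[ℝ] CombOp S X X :=
  LinearMap.mk₂ ℝ (fun f g => .mk (A.mul ∘L (tensorOp f g).val ∘L A.comul)
      (combOp_comp hA.mul_mem (combOp_comp (tensorOp f g).val_mem hA.comul_mem)))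
    (fun f f' g => CombOp.ext (by
      have : (tensorOp (f + f') g).val = (tensorOp f g).val + (tensorOp f' g).val :=
        (isTensorMap_tensorOp _ _).unique fun x y => by
          rw [add_apply, isTensorMap_tensorOp, isTensorMap_tensorOp]
          exact (LinearMap.map_add₂ tens _ _ _).symm
      simp only [this, ContinuousLinearMap.add_comp, ContinuousLinearMap.comp_add]
      rfl))
    (fun c f g => CombOp.ext (by
      have : (tensorOp (c • f) g).val = c • (tensorOp f g).val :=
        (isTensorMap_tensorOp _ _).unique fun x y => by
          rw [smul_apply, isTensorMap_tensorOp]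
          exact (LinearMap.map_smul₂ tens _ _ _).symm
      simp only [this, ContinuousLinearMap.smul_comp, ContinuousLinearMap.comp_smul]
      rfl))
    (fun f g g' => CombOp.ext (by
      have : (tensorOp f (g + g')).val = (tensorOp f g).val + (tensorOp f g').val :=
        (isTensorMap_tensorOp _ _).unique fun x y => by
          rw [add_apply, isTensorMap_tensorOp, isTensorMap_tensorOp]
          exact (map_add (tens _) _ _).symm
      simp only [this, ContinuousLinearMap.add_comp, ContinuousLinearMap.comp_add]
      rfl))
    (fun c f g => CombOp.ext (by
      have : (tensorOp f (c • g)).val = c • (tensorOp f g).val :=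
        (isTensorMap_tensorOp _ _).unique fun x y => by
          rw [smul_apply, isTensorMap_tensorOp]
          exact (map_smul (tens _) _ _).symm
      simp only [this, ContinuousLinearMap.smul_comp, ContinuousLinearMap.comp_smul]
      rfl))

theorem conv_val (f g : CombOp S X X) :
    (hA.conv f g).val = A.mul ∘L (tensorOp f g).val ∘L A.comul := rfl

-- By uniqueness of tensor maps, `(f * g) ⊗̂ h` is `(m ⊗̂ id) ∘ ((f ⊗̂ g) ⊗̂ h) ∘ (Δ ⊗̂ id)`, and
-- likewise on the other side. Associativity, naturality of the associator and coassociativity then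
-- carry one side to the other.
set_option maxHeartbeats 1000000 in
theorem conv_assoc (f g h : CombOp S X X) :
    hA.conv (hA.conv f g) h = hA.conv f (hA.conv g h) := by
  obtain ⟨α, ml, mr, hα, hml, hmr, hm⟩ := hA.bialgebra.assoc
  obtain ⟨α', Δl, Δr, hα', hΔl, hΔr, hΔ⟩ := hA.bialgebra.coassoc
  -- The two axioms provide associators independently; they agree by density.
  obtain rfl := hα.unique hα'
  have hl : (tensorOp (hA.conv f g) h).val = ml ∘L (tensorOp (tensorOp f g) h).val ∘L Δl :=
    (isTensorMap_tensorOp _ _).unique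
      (hml.comp ((isTensorMap_tensorOp (tensorOp f g) h).comp hΔl))
  have hr : (tensorOp f (hA.conv g h)).val = mr ∘L (tensorOp f (tensorOp g h)).val ∘L Δr :=
    (isTensorMap_tensorOp _ _).unique
      (hmr.comp ((isTensorMap_tensorOp f (tensorOp g h)).comp hΔr))
  refine CombOp.ext (ContinuousLinearMap.ext fun x => ?_)
  change A.mul ((tensorOp (hA.conv f g) h).val (A.comul x)) =
    A.mul ((tensorOp f (hA.conv g h)).val (A.comul x))
  rw [hl, hr]
  have e1 := DFunLike.congr_fun hm ((tensorOp (tensorOp f g) h).val (Δl (A.comul x)))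
  have e2 := DFunLike.congr_fun hΔ x
  have e3 := DFunLike.congr_fun (hα.naturality f g h) (Δl (A.comul x))
  refine e1.trans ((congrArg (fun z => A.mul (mr z)) e3).trans ?_)
  exact congrArg (fun z => A.mul (mr ((tensorOp f (tensorOp g h)).val z))) e2

/-- The unit of the convolution product. -/
def convUnit : CombOp S X X := .mk (A.unit ∘L A.counit) hA.unit_counit_mem

/-- The identity as a combinatorial operator. -/
def idOp : CombOp S X X := .mk (.id ℝ _) (id_mem_combOp X)

/-- The product of `f(x)` with `η(ε(y))` is `f` applied to `ε(y) x`, and the counit axiom finishes.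
-/
theorem conv_unit (f : CombOp S X X) : hA.conv f hA.convUnit = f := by
  obtain ⟨ε, hε, hε'⟩ := hA.bialgebra.comul_counit
  have h : A.mul ∘L (tensorOp f hA.convUnit).val = f.val ∘L ε := Hat.ext_tens S fun a w b w' => by
    simp only [ContinuousLinearMap.comp_apply]
    rw [isTensorMap_tensorOp, hε, map_smul]
    have hu : hA.convUnit.val (elemT S X b w') = A.counit (elemT S X b w') • A.unit 1 := by
      change A.unit (A.counit _) = _
      rw [← map_smul, smul_eq_mul, mul_one]
    rw [hu, map_smul, map_smul, hA.bialgebra.mul_one]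
  refine CombOp.ext ?_
  rw [conv_val, ← ContinuousLinearMap.comp_assoc, h, ContinuousLinearMap.comp_assoc, hε',
    ContinuousLinearMap.comp_id]

theorem unit_conv (f : CombOp S X X) : hA.conv hA.convUnit f = f := by
  obtain ⟨ε, hε, hε'⟩ := hA.bialgebra.counit_comul
  have h : A.mul ∘L (tensorOp hA.convUnit f).val = f.val ∘L ε := Hat.ext_tens S fun a w b w' => by
    simp only [ContinuousLinearMap.comp_apply]
    rw [isTensorMap_tensorOp, hε, map_smul]
    have hu : hA.convUnit.val (elemT S X a w) = A.counit (elemT S X a w) • A.unit 1 := by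
      change A.unit (A.counit _) = _
      rw [← map_smul, smul_eq_mul, mul_one]
    rw [hu, map_smul, LinearMap.smul_apply, map_smul, hA.bialgebra.one_mul]
  refine CombOp.ext ?_
  rw [conv_val, ← ContinuousLinearMap.comp_assoc, h, ContinuousLinearMap.comp_assoc, hε',
    ContinuousLinearMap.comp_id]

/-- An operator that vanishes in all degrees below `N`. -/
def Vanishes (N : ℕ) (f : CombOp S X X) : Prop :=
  ∀ x b, Nat.card (X.vert b) < N → f.val x b = 0

/-- The product preserves degree, and a pair of total degree below `m + n` has first degree below
`m` or second degree below `n`. -/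
theorem vanishes_conv {m n : ℕ} {f g : CombOp S X X} (hf : Vanishes m f) (hg : Vanishes n g) :
    Vanishes (m + n) (hA.conv f g) := by
  intro x b hb
  refine combOp_apply_eq_zero hA.mul_mem b fun a ha => ?_
  have h : projL (X.prod X) a ∘L (tensorOp f g).val = 0 := Hat.ext_tens S fun c w d w' => by
    rw [ContinuousLinearMap.comp_apply, isTensorMap_tensorOp]
    change SymPow.tmul S (X.sym a.1) (X.sym a.2) (f.val _ a.1) (g.val _ a.2) = 0
    have hcard : Nat.card (X.vert a.1) + Nat.card (X.vert a.2) < m + n := by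
      rw [← Nat.card_sum]
      exact ha.trans_lt hb
    by_cases h1 : Nat.card (X.vert a.1) < m
    · rw [hf _ _ h1, map_zero, LinearMap.zero_apply]
    · rw [hg _ a.2 (by omega), map_zero]
  exact DFunLike.congr_fun h (A.comul x)

/-- The convolution powers of the difference of the identity and the convolution unit. -/
def pow (k : ℕ) : CombOp S X X := bilinPow hA.conv hA.convUnit (idOp - hA.convUnit) k

theorem vanishes_pow (k : ℕ) : Vanishes k (hA.pow k) := by
  induction k with
  | zero => exact fun x b hb => absurd hb (Nat.not_lt_zero _)
  | succ k ih =>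
    refine hA.vanishes_conv ih fun x b hb => ?_
    change x b - (A.unit ∘L A.counit) x b = 0
    rw [hA.unit_counit_apply x b (Nat.lt_one_iff.1 hb), sub_self]

/-- The partial sums of the geometric series for the convolution inverse of the identity. -/
def partialInverse (N : ℕ) : CombOp S X X := geomSum hA.conv hA.convUnit (idOp - hA.convUnit) N

theorem partialInverse_succ (N : ℕ) :
    hA.partialInverse (N + 1) = hA.partialInverse N + (-1 : ℝ) ^ N • hA.pow N :=
  Finset.sum_range_succ _ _

theorem partialInverse_conv (N : ℕ) :
    hA.conv (hA.partialInverse N) idOp = hA.convUnit - (-1 : ℝ) ^ N • hA.pow N :=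
  geomSum_mul (E := CombOp S X X) (m := hA.conv) (u := hA.convUnit) hA.conv_unit idOp N

theorem conv_partialInverse (N : ℕ) :
    hA.conv idOp (hA.partialInverse N) = hA.convUnit - (-1 : ℝ) ^ N • hA.pow N :=
  mul_geomSum (E := CombOp S X X) (m := hA.conv) (u := hA.convUnit) hA.conv_assoc hA.unit_conv
    hA.conv_unit idOp N

/-- In degree `d` the powers beyond the `d`-th vanish, so the partial sums are constant from `N = d
+ 1` on. -/
theorem partialInverse_apply_eq {N : ℕ} {b : X.idx} (hb : Nat.card (X.vert b) < N) (x : Hat S X) :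
    (hA.partialInverse N).val x b = (hA.partialInverse (Nat.card (X.vert b) + 1)).val x b := by
  obtain ⟨m, rfl⟩ := Nat.exists_eq_add_of_le (Nat.succ_le_of_lt hb)
  induction m with
  | zero => rfl
  | succ m ih =>
    rw [← ih (by omega), ← Nat.add_assoc, partialInverse_succ]
    change _ + (-1 : ℝ) ^ _ • (hA.pow _).val x b = _
    rw [hA.vanishes_pow _ x b (by omega), smul_zero, add_zero]
    rfl

-- The antipode is the degreewise stable value of the partial sums. Its rows are combinatorial, so
-- its tensor products with the identity exist.
include hA in
theorem exists_antipode : ∃ s, IsAntipode A s := by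
  obtain ⟨s, hs, hs'⟩ := exists_combOp_of_rows (S := S) (X := X) (Y := X)
    -- The bound `degree + 1` includes every power from 0 up to the degree of `b`, which are all
    -- that can contribute.
    (fun b => projL X b ∘L (hA.partialInverse (Nat.card (X.vert b) + 1)).val)
    (fun b => (hA.partialInverse (Nat.card (X.vert b) + 1)).val_mem b)
  let s' : CombOp S X X := .mk s hs
  have hvan : ∀ N, Vanishes N (s' - hA.partialInverse N) := by
    intro N x b hb
    change s x b - (hA.partialInverse N).val x b = 0
    rw [hs', hA.partialInverse_apply_eq hb]
    exact sub_self _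
  have hpow : ∀ N x b, Nat.card (X.vert b) < N →
      (hA.convUnit - (-1 : ℝ) ^ N • hA.pow N).val x b = hA.convUnit.val x b := by
    intro N x b hb
    change _ - (-1 : ℝ) ^ N • (hA.pow N).val x b = _
    rw [hA.vanishes_pow N x b hb, smul_zero, sub_zero]
    rfl
  have hid : Vanishes 0 (idOp : CombOp S X X) := fun x b hb => absurd hb (Nat.not_lt_zero _)
  have hl : hA.conv s' idOp = hA.convUnit := by
    refine CombOp.ext (ContinuousLinearMap.ext fun x => funext fun b => ?_)
    -- For this `N`, both the difference of `s` from its partial sum and the error of the geometric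
    -- series vanish at `b`.
    set N := Nat.card (X.vert b) + 1 with hN
    have h1 := hA.vanishes_conv (hvan N) hid x b (by omega)
    have h2 : hA.conv (s' - hA.partialInverse N) idOp =
        hA.conv s' idOp - hA.conv (hA.partialInverse N) idOp := by
      rw [map_sub, LinearMap.sub_apply]
    rw [h2, partialInverse_conv] at h1
    rw [← hpow N x b (by omega)]
    exact sub_eq_zero.1 h1
  have hr : hA.conv idOp s' = hA.convUnit := by
    refine CombOp.ext (ContinuousLinearMap.ext fun x => funext fun b => ?_)
    set N := Nat.card (X.vert b) + 1 with hN
    have h1 := hA.vanishes_conv hid (hvan N) x b (by omega)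
    have h2 : hA.conv idOp (s' - hA.partialInverse N) =
        hA.conv idOp s' - hA.conv idOp (hA.partialInverse N) := (hA.conv idOp).map_sub _ _
    rw [h2, conv_partialInverse] at h1
    rw [← hpow N x b (by omega)]
    exact sub_eq_zero.1 h1
  exact ⟨s, (tensorOp s' idOp).val, (tensorOp idOp s').val, isTensorMap_tensorOp _ _,
    isTensorMap_tensorOp _ _, congrArg CombOp.val hl, congrArg CombOp.val hr⟩

end IsConnectedCombinatorial

theorem IsForestOps.isTopologicalHopfAlgebra {A : HopfOps S treeShape} {M D : ForestRel}
    (hA : IsForestOps M D A) (hM : M.Good) (hD : D.Good) (h : ForestRel.Compatible M D) :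
    IsTopologicalHopfAlgebra A where
  toIsTopologicalBialgebra := hA.isTopologicalBialgebra hM hD h
  antipode := IsConnectedCombinatorial.exists_antipode
    { bialgebra := hA.isTopologicalBialgebra hM hD h
      mul_mem := hA.mul_mem
      comul_mem := hA.comul_mem
      unit_counit_mem := hA.unit_counit_mem
      unit_counit_apply := fun x _ ht => hA.unit_counit_apply x ht }

end Antipode

/-! ## The sums over graftings, branches and cuts -/

section Combinatorics

/-- It turns a sum over combinatorial data (grafting maps, sets of branches, cuts) into one over all
forests, provided that the data parametrize the solutions of the relation bijectively. -/
theorem finsum_eq_sum_ind {D E Z : Type*} [Fintype E] [AddCommGroup Z] [Module ℝ Z]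
    (p : E → Prop) (g : D → E) (hg : Function.Injective g) (h : ∀ e, p e ↔ e ∈ Set.range g)
    (F : E → Z) : ∑ᶠ d, F (g d) = ∑ e, ind (p e) • F e := by
  have := Finite.of_injective g hg
  have := Fintype.ofFinite D
  rw [finsum_eq_sum_of_fintype]
  refine Finset.sum_of_injOn g hg.injOn (fun _ _ => Finset.mem_coe.2 (Finset.mem_univ _)) ?_ ?_
  · intro e _ he
    rw [ind_neg, zero_smul]
    rw [h]
    rintro ⟨d, rfl⟩
    exact he ⟨d, Finset.mem_coe.2 (Finset.mem_univ _), rfl⟩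
  · intro d _
    rw [ind_pos ((h _).2 ⟨d, rfl⟩), one_smul]

theorem exists_rootChild_le {ι : Type} [PartialOrder ι] [Finite ι] (x : ι) : ∃ c : RootChild ι, c.1 ≤ x := by
  obtain ⟨c, hc, hc'⟩ := (Set.toFinite (Set.univ : Set ι)).exists_le_minimal (Set.mem_univ x)
  exact ⟨⟨c, fun y hy => hc'.2 (Set.mem_univ y) hy⟩, hc⟩

theorem image_inl_r {ι κ : Type} [PartialOrder ι] [IsForest ι] (a b : ι ⊕ κ) :
    (PForest.image (Sum.inl : ι → ι ⊕ κ) Sum.inl_injective).r a b ↔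
      ∃ x y, x ≤ y ∧ .inl x = a ∧ .inl y = b := Iff.rfl

theorem image_inr_r {ι κ : Type} [PartialOrder κ] [IsForest κ] (a b : ι ⊕ κ) :
    (PForest.image (Sum.inr : κ → ι ⊕ κ) Sum.inr_injective).r a b ↔
      ∃ x y, x ≤ y ∧ .inr x = a ∧ .inr y = b := Iff.rfl

variable {ι κ : Type} [PartialOrder ι] [IsForest ι] [PartialOrder κ]

theorem rootChild_unique {c c' : RootChild ι} {x : ι} (h : c.1 ≤ x) (h' : c'.1 ≤ x) : c = c' := by
  rcases IsForest.comparable h h' with k | k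
  · exact Subtype.ext (le_antisymm k (c'.2 k))
  · exact Subtype.ext (le_antisymm (c.2 k) k)

/-- A child `c` of the root lies above no other child, so the vertices of `κ` below it are exactly
those up to `d c`; they determine `d c`. -/
theorem graft_le_rootChild (d : RootChild ι → WithBot κ) (x : κ) (c : RootChild ι) :
    Graft.le d (.inr x) (.inl c.1) ↔ (x : WithBot κ) ≤ d c := by
  constructor
  · rintro ⟨c', h, hx⟩
    rwa [rootChild_unique (le_refl c.1) h]
  · exact fun h => ⟨c, le_rfl, h⟩

variable [IsForest κ]

/-- The grafted tree as a forest on `ι ⊕ κ`. -/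
def graftForest (d : RootChild ι → WithBot κ) : PForest (ι ⊕ κ) :=
  PForest.image (ι := Graft d) (fun x => x) fun _ _ h => h

theorem graftForest_r (d : RootChild ι → WithBot κ) (x y : ι ⊕ κ) :
    (graftForest d).r x y ↔ Graft.le d x y :=
  PForest.image_r (ι := Graft d) (f := fun x => x) (fun _ _ h => h) x y

theorem graftForest_injective :
    Function.Injective (graftForest : (RootChild ι → WithBot κ) → PForest (ι ⊕ κ)) := by
  intro d d' h
  funext c
  have key : ∀ x : κ, (x : WithBot κ) ≤ d c ↔ (x : WithBot κ) ≤ d' c := fun x => by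
    rw [← graft_le_rootChild, ← graftForest_r, h, graftForest_r, graft_le_rootChild]
  refine le_antisymm ?_ ?_
  · cases hd : d c with
    | bot => exact bot_le
    | coe x => exact (key x).1 hd.ge
  · cases hd : d' c with
    | bot => exact bot_le
    | coe x => exact (key x).2 hd.ge

theorem cut_graftForest (d : RootChild ι → WithBot κ) :
    Cut (ι ⊕ κ) (PForest.image Sum.inl Sum.inl_injective) (PForest.image Sum.inr Sum.inr_injective)
      (graftForest d) := by
  simp only [Cut, graftForest_r, image_inl_r, image_inr_r]
  refine ⟨?_, ?_, ?_, ?_, ?_⟩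
  · rintro (a | x) <;> simp [Graft.le]
  · rintro (a | x) <;> simp
  · rintro (a | x) (b | y) <;> simp [Graft.le]
  · rintro (a | x) (b | y) <;> simp [Graft.le]
  · rintro (a | x) (b | y) <;> simp [Graft.le]

/-- The vertices of `κ` below `c` form a finite chain closed downwards in `κ`. Its greatest element
is the grafting point, and if the chain is empty the grafting point is the root. -/
theorem exists_withBot_le_iff {T : PForest (ι ⊕ κ)} [Finite κ]
    (hT : Cut (ι ⊕ κ) (PForest.image Sum.inl Sum.inl_injective)
      (PForest.image Sum.inr Sum.inr_injective) T) (c : ι) :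
    ∃ y : WithBot κ, ∀ x : κ, (x : WithBot κ) ≤ y ↔ T.r (.inr x) (.inl c) := by
  have hr : ∀ x y : κ, x ≤ y ↔ T.r (.inr x) (.inr y) := fun x y => by
    rw [← PForest.image_r (Sum.inr_injective : Function.Injective (Sum.inr : κ → ι ⊕ κ)), hT.2.2.2.1,
      PForest.image_r, PForest.image_r]
    simp
  rcases Set.eq_empty_or_nonempty {x : κ | T.r (.inr x) (.inl c)} with h | h
  · refine ⟨⊥, fun x => ⟨fun hx => absurd hx (by simp), fun hx => ?_⟩⟩
    have : x ∈ {x : κ | T.r (.inr x) (.inl c)} := hx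
    simp [h] at this
  · obtain ⟨y, hy⟩ := (Set.toFinite _).exists_maximal h
    refine ⟨y, fun x => ?_⟩
    rw [WithBot.coe_le_coe]
    refine ⟨fun hx => T.trans _ _ _ ((hr _ _).1 hx) hy.1, fun hx => ?_⟩
    rcases T.comparable _ _ _ hx hy.1 with k | k
    · exact (hr _ _).2 k
    · exact hy.2 hx ((hr _ _).2 k)

theorem cut_iff_mem_range_graftForest [Finite ι] [Finite κ] (T : PForest (ι ⊕ κ)) :
    Cut (ι ⊕ κ) (PForest.image Sum.inl Sum.inl_injective) (PForest.image Sum.inr Sum.inr_injective)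
      T ↔ T ∈ Set.range (graftForest : (RootChild ι → WithBot κ) → _) := by
  constructor
  · intro hT
    choose d hd using fun c : RootChild ι => exists_withBot_le_iff hT c.1
    refine ⟨d, ?_⟩
    have hl : ∀ a b : ι, T.r (.inl a) (.inl b) ↔ a ≤ b := fun a b => by
      rw [← PForest.image_r (Sum.inl_injective : Function.Injective (Sum.inl : ι → ι ⊕ κ)),
        hT.2.2.1, PForest.image_r, PForest.image_r]
      simp
    have hr : ∀ x y : κ, T.r (.inr x) (.inr y) ↔ x ≤ y := fun x y => by
      rw [← PForest.image_r (Sum.inr_injective : Function.Injective (Sum.inr : κ → ι ⊕ κ)),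
        hT.2.2.2.1, PForest.image_r, PForest.image_r]
      simp
    have hlr : ∀ (a : ι) (y : κ), ¬ T.r (.inl a) (.inr y) := fun a y h => by
      have := hT.2.2.2.2 _ _ h ⟨a, a, le_rfl, rfl, rfl⟩
      simp [image_inl_r] at this
    ext (a | x) (b | y) <;> rw [graftForest_r] <;> simp only [Graft.le]
    · exact (hl a b).symm
    · simp [hlr]
    · simp only [hd]
      constructor
      · rintro ⟨c, hc, hx⟩
        exact T.trans _ _ _ hx ((hl _ _).2 hc)
      · intro h
        obtain ⟨c, hc⟩ := exists_rootChild_le b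
        refine ⟨c, hc, ?_⟩
        -- Both `x` and `c` lie below `b`, so they are comparable, and `c` cannot lie below `x`
        -- because the copy of `ι` is an upper set.
        rcases T.comparable _ _ _ h ((hl _ _).2 hc) with k | k
        · exact k
        · exact absurd k (hlr _ _)
    · exact (hr x y).symm
  · rintro ⟨d, rfl⟩
    exact cut_graftForest d

/-- When everything is grafted to the root, no vertex of `κ` comes to lie below a vertex of `ι`. -/
theorem disjUnion_iff_eq_graftForest [Finite ι] (T : PForest (ι ⊕ κ)) :
    DisjUnion (ι ⊕ κ) (PForest.image Sum.inl Sum.inl_injective)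
      (PForest.image Sum.inr Sum.inr_injective) T ↔
        graftForest (fun _ : RootChild ι => (⊥ : WithBot κ)) = T := by
  have hd : ∀ x, (PForest.image (Sum.inl : ι → ι ⊕ κ) Sum.inl_injective).r x x →
      ¬ (PForest.image (Sum.inr : κ → ι ⊕ κ) Sum.inr_injective).r x x := by
    simp only [image_inl_r, image_inr_r]
    rintro (a | x) <;> simp
  have key : ∀ x y, Graft.le (fun _ : RootChild ι => (⊥ : WithBot κ)) x y ↔
      (PForest.image (Sum.inl : ι → ι ⊕ κ) Sum.inl_injective).r x y ∨
        (PForest.image (Sum.inr : κ → ι ⊕ κ) Sum.inr_injective).r x y := by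
    simp only [image_inl_r, image_inr_r]
    rintro (a | x) (b | y) <;> simp [Graft.le]
  constructor
  · rintro ⟨-, h⟩
    ext x y
    rw [graftForest_r, h, key]
  · rintro rfl
    exact ⟨hd, fun x y => by rw [graftForest_r, key]⟩

theorem branch_injective (J : Set (RootChild ι)) :
    Function.Injective fun x : (Σ c : J, Branch c.1) => x.2.1 := by
  rintro ⟨c, x⟩ ⟨c', x'⟩ (h : x.1 = x'.1)
  obtain rfl : c = c' := Subtype.ext (rootChild_unique x.2 (h ▸ x'.2))
  rw [Subtype.ext h]

/-- The union of the branches at the elements of `J` as a forest on `ι`. -/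
def branchForest (J : Set (RootChild ι)) : PForest ι :=
  PForest.image (fun x : (Σ c : J, Branch c.1) => x.2.1) (branch_injective J)

theorem branchForest_r (J : Set (RootChild ι)) (a b : ι) :
    (branchForest J).r a b ↔ a ≤ b ∧ ∃ c ∈ J, c.1 ≤ a := by
  constructor
  · rintro ⟨⟨c, x⟩, ⟨c', x'⟩, h, rfl, rfl⟩
    cases h with
    | fiber _ _ _ h => exact ⟨h, c.1, c.2, x.2⟩
  · rintro ⟨h, c, hc, hca⟩
    exact ⟨⟨⟨c, hc⟩, a, hca⟩, ⟨⟨c, hc⟩, b, hca.trans h⟩, Sigma.mk_le_mk_iff.2 h, rfl, rfl⟩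

theorem branchForest_rootChild (J : Set (RootChild ι)) (c : RootChild ι) :
    (branchForest J).r c.1 c.1 ↔ c ∈ J := by
  rw [branchForest_r]
  constructor
  · rintro ⟨-, c', hc', h⟩
    rwa [rootChild_unique (le_refl c.1) h]
  · exact fun h => ⟨le_rfl, c, h, le_rfl⟩

theorem branchForest_injective :
    Function.Injective (branchForest : Set (RootChild ι) → PForest ι) := fun J J' h =>
  Set.ext fun c => by rw [← branchForest_rootChild, h, branchForest_rootChild]

theorem image_id_r (a b : ι) :
    (PForest.image (id : ι → ι) Function.injective_id).r a b ↔ a ≤ b :=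
  PForest.image_r Function.injective_id a b

/-- Every vertex lies above one child of the root and belongs to the same part as that child. A
splitting is therefore the choice of the set `J` of children in the first part. -/
theorem disjUnion_iff_mem_range_branchForest [Finite ι] (p : PForest ι × PForest ι) :
    DisjUnion ι p.1 p.2 (PForest.image id Function.injective_id) ↔
      p ∈ Set.range fun J : Set (RootChild ι) => (branchForest J, branchForest Jᶜ) := by
  obtain ⟨P, Q⟩ := p
  simp only [DisjUnion, image_id_r, Set.mem_range, Prod.mk.injEq]
  constructor
  · rintro ⟨hd, h⟩
    have hPQ : ∀ c : RootChild ι, ¬ P.r c.1 c.1 ↔ Q.r c.1 c.1 := fun c =>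
      ⟨fun hc => ((h c.1 c.1).1 le_rfl).resolve_left hc, fun hc hc' => hd _ hc' hc⟩
    -- The relation `c ≤ x` belongs to one of the two disjoint parts, which then contains both ends.
    have hP : ∀ (c : RootChild ι) (x : ι), c.1 ≤ x → (P.r x x ↔ P.r c.1 c.1) := by
      intro c x hcx
      rcases (h _ _).1 hcx with k | k
      · exact iff_of_true (P.right _ _ k) (P.left _ _ k)
      · exact iff_of_false (fun hx => hd _ hx (Q.right _ _ k)) (fun hx => hd _ hx (Q.left _ _ k))
    have hQ : ∀ (c : RootChild ι) (x : ι), c.1 ≤ x → (Q.r x x ↔ Q.r c.1 c.1) := by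
      intro c x hcx
      rcases (h _ _).1 hcx with k | k
      · exact iff_of_false (fun hx => hd _ (P.right _ _ k) hx) (fun hx => hd _ (P.left _ _ k) hx)
      · exact iff_of_true (Q.right _ _ k) (Q.left _ _ k)
    refine ⟨{c | P.r c.1 c.1}, ?_, ?_⟩
    · ext a b
      rw [branchForest_r]
      constructor
      · rintro ⟨hab, c, hc, hca⟩
        refine ((h _ _).1 hab).resolve_right fun k => hd a ((hP c a hca).2 hc) (Q.left _ _ k)
      · intro hab
        obtain ⟨c, hc⟩ := exists_rootChild_le a
        exact ⟨(h _ _).2 (Or.inl hab), c, (hP c a hc).1 (P.left _ _ hab), hc⟩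
    · ext a b
      rw [branchForest_r]
      constructor
      · rintro ⟨hab, c, hc, hca⟩
        exact ((h _ _).1 hab).resolve_left fun k =>
          hd a (P.left _ _ k) ((hQ c a hca).2 ((hPQ c).1 hc))
      · intro hab
        obtain ⟨c, hc⟩ := exists_rootChild_le a
        exact ⟨(h _ _).2 (Or.inr hab), c, (hPQ c).2 ((hQ c a hc).1 (Q.left _ _ hab)), hc⟩
  · rintro ⟨J, rfl, rfl⟩
    simp only [branchForest_r]
    refine ⟨?_, fun x y => ?_⟩
    · rintro x ⟨-, c, hc, hcx⟩ ⟨-, c', hc', hcx'⟩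
      exact hc' (rootChild_unique hcx hcx' ▸ hc)
    · rw [← and_or_left]
      refine ⟨fun h => ⟨h, ?_⟩, And.left⟩
      obtain ⟨c, hc⟩ := exists_rootChild_le x
      by_cases hJ : c ∈ J
      · exact Or.inl ⟨c, hJ, hc⟩
      · exact Or.inr ⟨c, hJ, hc⟩

theorem image_val_r {p : ι → Prop} (a b : ι) :
    (PForest.image (Subtype.val : {x // p x} → ι) Subtype.val_injective).r a b ↔
      a ≤ b ∧ p a ∧ p b := by
  constructor
  · rintro ⟨x, y, h, rfl, rfl⟩
    exact ⟨h, x.2, y.2⟩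
  · rintro ⟨h, ha, hb⟩
    exact ⟨⟨a, ha⟩, ⟨b, hb⟩, h, rfl, rfl⟩

/-- The parts of `ι` above and not above an element of `C`, as forests on `ι`. -/
def cutForest (C : AdmissibleCut ι) : PForest ι × PForest ι :=
  (PForest.image (ι := CutOff C.1) Subtype.val Subtype.val_injective,
    PForest.image (ι := Remain C.1) Subtype.val Subtype.val_injective)

/-- An antichain is recovered from the upper set that it generates, as the set of its minimal
elements. -/
theorem cutForest_injective : Function.Injective (cutForest : AdmissibleCut ι → _) := by
  have key : ∀ C C' : AdmissibleCut ι, cutForest C = cutForest C' → C.1 ⊆ C'.1 := by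
    intro C C' h w hw
    have hup : ∀ x, (∃ w ∈ C.1, w ≤ x) ↔ ∃ w ∈ C'.1, w ≤ x := fun x => by
      have := (congrFun (congrFun (congrArg (fun p => p.1.r) h) x) x)
      simpa [cutForest, image_val_r] using this
    obtain ⟨w', hw', hle⟩ := (hup w).1 ⟨w, hw, le_rfl⟩
    obtain ⟨w'', hw'', hle'⟩ := (hup w').2 ⟨w', hw', le_rfl⟩
    obtain rfl := C.2.eq hw'' hw (hle'.trans hle)
    rwa [le_antisymm hle' hle]
  exact fun C C' h => Subtype.ext ((key C C' h).antisymm (key C' C h.symm))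

theorem cut_iff_mem_range_cutForest [Finite ι] (p : PForest ι × PForest ι) :
    Cut ι p.1 p.2 (PForest.image id Function.injective_id) ↔
      p ∈ Set.range (cutForest : AdmissibleCut ι → _) := by
  obtain ⟨P, Q⟩ := p
  simp only [Cut, image_id_r, Set.mem_range]
  constructor
  · rintro ⟨h1, h2, h3, h4, h5⟩
    -- The cut consists of the minimal elements of the upper part; by finiteness they generate it.
    refine ⟨⟨{x | Minimal (fun x => P.r x x) x}, fun x hx y hy hne hle =>
      hne (hle.antisymm (hy.2 hx.1 hle))⟩, ?_⟩
    have hup : ∀ x, (∃ w ∈ {x | Minimal (fun x => P.r x x) x}, w ≤ x) ↔ P.r x x := by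
      intro x
      constructor
      · rintro ⟨w, hw, hle⟩
        exact h5 _ _ hle hw.1
      · intro hx
        obtain ⟨w, hle, hw⟩ := (Set.toFinite {x | P.r x x}).exists_le_minimal hx
        exact ⟨w, hw, hle⟩
    have hQ : ∀ x, ¬ P.r x x ↔ Q.r x x := fun x =>
      ⟨fun hx => ((h1 x).1 le_rfl).resolve_left hx, fun hx hx' => h2 _ hx' hx⟩
    refine Prod.ext ?_ ?_
    · ext a b
      rw [h3, cutForest, image_val_r, hup, hup]
    · ext a b
      rw [h4, cutForest, image_val_r, hup, hup, hQ, hQ]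
  · rintro ⟨C, h⟩
    obtain ⟨rfl, rfl⟩ := Prod.mk.inj h
    simp only [image_val_r]
    refine ⟨fun x => ?_, fun x hx hx' => hx'.2.1 hx.2.1, fun x y => ?_, fun x y => ?_, ?_⟩
    · have := em (∃ w ∈ C.1, w ≤ x)
      simp only [le_refl, true_and, and_self, true_iff]
      exact this
    · simp
    · simp
    · rintro x y hxy ⟨-, ⟨w, hw, hle⟩, -⟩
      exact ⟨le_rfl, ⟨w, hw, hle.trans hxy⟩, ⟨w, hw, hle.trans hxy⟩⟩

end Combinatorics

/-! ### The defining sums of both algebras as sums over forests. -/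

section Sums

variable {V : Type*} [AddCommGroup V] [Module ℝ V] [TopologicalSpace V] {I : Type*}
variable (S : SymmetricCrossSeminorms V I)
variable {ι κ : Type} [Finite ι] [PartialOrder ι] [IsForest ι]
  [Finite κ] [PartialOrder κ] [IsForest κ]

theorem labelled_graft (d : RootChild ι → WithBot κ) (v : ι ⊕ κ → V) :
    labelled S (ι := Graft d) v = lab S (graftForest d) v :=
  labelled_eq_lab S (ι := Graft d) (fun x => x) (fun _ _ h => h) v

theorem finsum_labelled_graft (v : ι ⊕ κ → V) :
    ∑ᶠ d : RootChild ι → WithBot κ, labelled S (ι := Graft d) v =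
      prodSum S Cut (PForest.image Sum.inl Sum.inl_injective)
        (PForest.image Sum.inr Sum.inr_injective) v := by
  simp only [labelled_graft]
  exact finsum_eq_sum_ind _ _ graftForest_injective cut_iff_mem_range_graftForest
    fun T => lab S T v

theorem labelled_graft_bot (v : ι ⊕ κ → V) :
    labelled S (ι := Graft fun _ : RootChild ι => (⊥ : WithBot κ)) v =
      prodSum S DisjUnion (PForest.image Sum.inl Sum.inl_injective)
        (PForest.image Sum.inr Sum.inr_injective) v := by
  have h := finsum_eq_sum_ind (D := Unit) _
    (fun _ => graftForest fun _ : RootChild ι => (⊥ : WithBot κ)) (fun _ _ _ => rfl)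
    (fun T => (disjUnion_iff_eq_graftForest T).trans ⟨fun h => ⟨(), h⟩, fun ⟨_, h⟩ => h⟩)
    fun T => lab S T v
  rw [labelled_graft, prodSum, ← h, finsum_unique]

theorem finsum_labelled_branch (v : ι → V) :
    ∑ᶠ J : Set (RootChild ι),
      tens (labelled S (ι := Σ c : J, Branch c.1) fun x => v x.2.1)
        (labelled S (ι := Σ c : (Jᶜ : Set (RootChild ι)), Branch c.1) fun x => v x.2.1) =
      coprodSum S DisjUnion (PForest.image id Function.injective_id) v := by
  have h : ∀ J : Set (RootChild ι), (labelled S (ι := Σ c : J, Branch c.1) fun x => v x.2.1) =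
      lab S (branchForest J) v := fun J => labelled_eq_lab S _ (branch_injective J) v
  simp only [h]
  exact finsum_eq_sum_ind _ (fun J : Set (RootChild ι) => (branchForest J, branchForest Jᶜ))
    (fun J J' h => branchForest_injective (congrArg Prod.fst h))
    disjUnion_iff_mem_range_branchForest fun p => tens (lab S p.1 v) (lab S p.2 v)

theorem finsum_labelled_cut (v : ι → V) :
    ∑ᶠ C : AdmissibleCut ι, tens (labelled S (ι := CutOff C.1) fun x => v x.1)
        (labelled S (ι := Remain C.1) fun x => v x.1) =
      coprodSum S Cut (PForest.image id Function.injective_id) v := by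
  have h1 : ∀ C : AdmissibleCut ι, (labelled S (ι := CutOff C.1) fun x => v x.1) =
      lab S (cutForest C).1 v := fun C => labelled_eq_lab S _ Subtype.val_injective v
  have h2 : ∀ C : AdmissibleCut ι, (labelled S (ι := Remain C.1) fun x => v x.1) =
      lab S (cutForest C).2 v := fun C => labelled_eq_lab S _ Subtype.val_injective v
  simp only [h1, h2]
  exact finsum_eq_sum_ind _ cutForest cutForest_injective cut_iff_mem_range_cutForest
    fun p => tens (lab S p.1 v) (lab S p.2 v)

end Sums

/-! ## The two Hopf algebras -/

section Main

variable {V : Type*} [AddCommGroup V] [Module ℝ V] [TopologicalSpace V] {I : Type*}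
variable {S : SymmetricCrossSeminorms V I} {A A' : HopfOps S treeShape}

theorem labelled_eq_lab_id {ι : Type} [Finite ι] [PartialOrder ι] [IsForest ι] (v : ι → V) :
    labelled S v = lab S (PForest.image id Function.injective_id) v :=
  labelled_eq_lab S id Function.injective_id v

theorem IsForestOps.hasTreeUnits {M D : ForestRel} (hA : IsForestOps M D A) : HasTreeUnits A where
  unit_apply c := by
    rw [hA.unit_apply c PEmpty PEmpty.elim, labelled_eq_lab_id]
    congr 2
    exact (PForest.eq_empty fun x => x.elim).symm
  counit_one ι _ _ _ _ v := by
    rw [labelled_eq_lab_id, hA.counit_lab, ind_pos]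
    exact PForest.eq_empty fun x => isEmptyElim x
  counit_of_nonempty ι _ _ _ h v := by
    rw [labelled_eq_lab_id, hA.counit_lab, ind_neg]
    intro h'
    obtain ⟨x⟩ := h
    have : (PForest.image (id : ι → ι) Function.injective_id).r x x := ⟨x, x, le_rfl, rfl, rfl⟩
    rw [h'] at this
    exact this

theorem IsForestOps.mul_labelled {M D : ForestRel} (hA : IsForestOps M D A) {ι κ : Type}
    [Finite ι] [PartialOrder ι] [IsForest ι] [Finite κ] [PartialOrder κ] [IsForest κ]
    (v : ι → V) (w : κ → V) :
    A.mul (tens (labelled S v) (labelled S w)) =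
      prodSum S M (PForest.image Sum.inl Sum.inl_injective)
        (PForest.image Sum.inr Sum.inr_injective) (Sum.elim v w) := by
  rw [← hA.mul_lab, ← labelled_eq_lab, ← labelled_eq_lab]
  · rfl
  · simp only [image_inl_r, image_inr_r]
    rintro (a | x) <;> simp

theorem IsForestOps.isGrossmanLarson (hA : IsForestOps Cut DisjUnion A) : IsGrossmanLarson A where
  toHasTreeUnits := hA.hasTreeUnits
  mul_labelled ι κ _ _ _ _ _ _ v w := by rw [hA.mul_labelled, finsum_labelled_graft]
  comul_labelled ι _ _ _ v := by rw [labelled_eq_lab_id, hA.comul_lab, finsum_labelled_branch]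

theorem IsForestOps.isConnesKreimer (hA : IsForestOps DisjUnion Cut A) : IsConnesKreimer A where
  toHasTreeUnits := hA.hasTreeUnits
  mul_labelled ι κ _ _ _ _ _ _ v w := by rw [hA.mul_labelled, labelled_graft_bot]
  comul_labelled ι _ _ _ v := by rw [labelled_eq_lab_id, hA.comul_lab, finsum_labelled_cut]

/-- Continuous operations are determined by density from their values on labelled trees, and every
`lab` is a `labelled` tree by definition. -/
theorem HasTreeUnits.eq (hA : HasTreeUnits A) (hA' : HasTreeUnits A')
    (hmul : ∀ (ι κ : Type) [Finite ι] [PartialOrder ι] [IsForest ι] [Finite κ] [PartialOrder κ]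
      [IsForest κ] (v : ι → V) (w : κ → V),
      A.mul (tens (labelled S v) (labelled S w)) = A'.mul (tens (labelled S v) (labelled S w)))
    (hcomul : ∀ (ι : Type) [Finite ι] [PartialOrder ι] [IsForest ι] (v : ι → V),
      A.comul (labelled S v) = A'.comul (labelled S v)) : A = A' := by
  have h1 : A.mul = A'.mul := HatTr.ext_tens_lab fun α _ P Q v _ => hmul _ _ _ _
  have h2 : A.unit = A'.unit := ContinuousLinearMap.ext fun c => by
    rw [hA.unit_apply, hA'.unit_apply]
  have h3 : A.comul = A'.comul := HatTr.ext_lab fun α _ P v => hcomul _ _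
  have h4 : A.counit = A'.counit := HatTr.ext_lab fun α _ P v => by
    rcases isEmpty_or_nonempty P.Pt with h | h
    · exact (hA.counit_one P.Pt _).trans (hA'.counit_one P.Pt _).symm
    · exact (hA.counit_of_nonempty P.Pt _).trans (hA'.counit_of_nonempty P.Pt _).symm
  cases A
  cases A'
  congr

theorem IsGrossmanLarson.unique (hA : IsGrossmanLarson A) (hA' : IsGrossmanLarson A') : A = A' :=
  hA.toHasTreeUnits.eq hA'.toHasTreeUnits
    (fun ι κ _ _ _ _ _ _ v w => (hA.mul_labelled ι κ v w).trans (hA'.mul_labelled ι κ v w).symm)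
    fun ι _ _ _ v => (hA.comul_labelled ι v).trans (hA'.comul_labelled ι v).symm

theorem IsConnesKreimer.unique (hA : IsConnesKreimer A) (hA' : IsConnesKreimer A') : A = A' :=
  hA.toHasTreeUnits.eq hA'.toHasTreeUnits
    (fun ι κ _ _ _ _ _ _ v w => (hA.mul_labelled ι κ v w).trans (hA'.mul_labelled ι κ v w).symm)
    fun ι _ _ _ v => (hA.comul_labelled ι v).trans (hA'.comul_labelled ι v).symm

end Main

end TreeHopf

end

theorem mainTheorem5 {V : Type*} [AddCommGroup V] [Module ℝ V] [UniformSpace V]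
    [IsUniformAddGroup V] [ContinuousSMul ℝ V] [LocallyConvexSpace ℝ V] [CompleteSpace V]
    {I : Type*} (S : TreeHopf.SymmetricCrossSeminorms V I) :
    (∃! A : TreeHopf.HopfOps S TreeHopf.treeShape, TreeHopf.IsGrossmanLarson A) ∧
    (∃! A : TreeHopf.HopfOps S TreeHopf.treeShape, TreeHopf.IsConnesKreimer A) ∧
    ∀ A : TreeHopf.HopfOps S TreeHopf.treeShape,
      TreeHopf.IsGrossmanLarson A ∨ TreeHopf.IsConnesKreimer A →
        TreeHopf.IsTopologicalGradedBialgebra (TreeHopf.degreePart S TreeHopf.treeShape) A ∧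
        TreeHopf.IsTopologicalHopfAlgebra A := by
  obtain ⟨G, hG⟩ := TreeHopf.exists_isForestOps S TreeHopf.cut_good TreeHopf.union_good
  obtain ⟨K, hK⟩ := TreeHopf.exists_isForestOps S TreeHopf.union_good TreeHopf.cut_good
  refine ⟨⟨G, hG.isGrossmanLarson, fun A hA => hA.unique hG.isGrossmanLarson⟩,
    ⟨K, hK.isConnesKreimer, fun A hA => hA.unique hK.isConnesKreimer⟩, ?_⟩
  -- By uniqueness `A` is one of the two constructed tuples, whose structure constants are those of
  -- `Cut` and `DisjUnion`.
  rintro A (hA | hA)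
  · obtain rfl := hA.unique hG.isGrossmanLarson
    exact ⟨hG.isTopologicalGradedBialgebra TreeHopf.cut_good TreeHopf.union_good
      TreeHopf.compatible_cut_union, hG.isTopologicalHopfAlgebra TreeHopf.cut_good
      TreeHopf.union_good TreeHopf.compatible_cut_union⟩
  · obtain rfl := hA.unique hK.isConnesKreimer
    exact ⟨hK.isTopologicalGradedBialgebra TreeHopf.union_good TreeHopf.cut_good
      TreeHopf.compatible_union_cut, hK.isTopologicalHopfAlgebra TreeHopf.union_good
      TreeHopf.cut_good TreeHopf.compatible_union_cut⟩
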